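/- Let $k$ be a field of characteristic different from $2$, and let $\lambda$ be a partition, $d=|\lambda|$, with conjugate $\lambda'$. **Setting.** For $r=0,1$ let $\mathcal C_r$ be the Clifford superalgebra ($\mathcal C_0=k$; $\mathcal C_1$ has one odd generator $c$ with $c^2=1$). Let $\mathrm{smod}\,\mathcal C_r$ be the category of finite dimensional right $\mathcal C_r$-supermodules with all (not only even) $\mathcal C_r$-linear maps; for $r=0$ this is the category $\mathrm{svec}$ of finite dimensional vector superspaces. For a superspace $M$ let $\Gamma^dM\subseteq M^{\otimes d}$ be the invariants of the symmetric group $\mathfrak S_d$, acting with the usual signs. The category $\Gamma^d(\mathrm{smod}\,\mathcal C_r)$ has the same objects as $\mathrm{smod}\,\mathcal C_r$ and morphism superspaces $\Gamma^d\mathrm{Hom}_{\mathcal C_r}(V,W)$, with the composition induced by that of $\mathrm{smod}\,\mathcal C_r$. A homogeneous polynomial superfunctor of degree $d$ and of type I (resp. II) is an even $k$-linear functor $\Gamma^d(\mathrm{smod}\,\mathcal C_r)\to\mathrm{svec}$ with $r=0$ (resp. $r=1$). Restriction from type I to type II is composition with the functor forgetting the action of $\mathcal C_1$. **Schur superfunctors.**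 Let $\Pi$ denote parity change. For a superspace $M$ put $\Gamma_\Pi^{\lambda'}M=\Gamma^{\lambda'_1}(\Pi M)\otimes\Gamma^{\lambda'_2}(\Pi M)\otimes\cdots$ and $S^\lambda M=S^{\lambda_1}M\otimes S^{\lambda_2}M\otimes\cdots$. Let $\widehat\theta_\lambda$ be the composite $$\Gamma_\Pi^{\lambda'}M\hookrightarrow(\Pi M)^{\otimes d}\xrightarrow{\ 1^{\otimes d}\ }M^{\otimes d}\xrightarrow{\ \sigma_\lambda\ }M^{\otimes d}\twoheadrightarrow S^\lambda M,$$ where $\sigma_\lambda\in\mathfrak S_d$ sends the number of each box of the diagram of $\lambda$ in the numbering along successive rows to its number in the numbering along successive columns. The Schur superfunctor of type I is $\widehat S^{\mathsf I}_\lambda(M)=\widehat S_\lambda(M)=\operatorname{Im}\widehat\theta_\lambda\subseteq S^\lambda M$, and $\widehat S^{\mathsf{II}}_\lambda$ is its restriction to type II. **Formal characters.** Let $S(m|n,d)=\Gamma^d\mathrm{End}(k^{m|n})$ and $Q(n,d)=\Gamma^d\mathrm{End}_{\mathcal C_1}(V_n)$, where $V_n=(\mathcal C_1)^n$ is the free right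 $\mathcal C_1$-supermodule of rank $n$. As a superspace $V_n=k^{n|n}$, with basis $X_1,\dots,X_n$ (even) and $X_1c,\dots,X_nc$ (odd). For $1\le i\le m+n$ let $E_{i,i}$ be the diagonal matrix units of $\mathrm{End}(k^{m|n})$, and for $1\le i\le n$ put $E_{0;i,i}=E_{i,i}+E_{n+i,n+i}\in\mathrm{End}_{\mathcal C_1}(V_n)$. For a composition $\mu$ of $d$ with $m+n$ (resp. $n$) parts $\ge 0$, the weight idempotent of weight $\mu$ in $S(m|n,d)$ (resp. $Q(n,d)$) is $\sum e_{i_1}\otimes\cdots\otimes e_{i_d}$ with $e_i=E_{i,i}$ (resp. $e_i=E_{0;i,i}$), summed over all words $i_1\cdots i_d$ in which each letter $s$ occurs exactly $\mu_s$ times. The weight space $W_\mu$ of a finite dimensional supermodule $W$ is the image of this idempotent, and the formal character is $$\mathrm{ch}(W)=\sum_\mu\dim(W_\mu)\,z^\mu .$$ It is a polynomial in $z=(x_1,\dots,x_m,y_1,\dots,y_n)$ for $S(m|n,d)$ and in $z=(x_1,\dots,x_n)$ for $Q(n,d)$. Let $X(\infty,d)$ (resp. $Z(\infty|\infty,d)$)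 be the inverse limit of the groups of homogeneous polynomials of degree $d$ over $\mathbb Z$ in $x_1,\dots,x_n$ (resp. in $x_1,\dots,x_m,y_1,\dots,y_n$) with respect to the maps setting the additional variables equal to $0$. For $T$ of type I (resp. II) the families $\mathrm{ch}(T(k^{m|n}))$, $m,n\ge0$ (resp. $\mathrm{ch}(T(V_n))$, $n\ge0$) are compatible with these maps. Let $$\mathrm{ch}^{\mathsf I}(T)=\varprojlim\mathrm{ch}(T(k^{m|n}))\in Z(\infty|\infty,d)\quad\text{and}\quad\mathrm{ch}^{\mathsf{II}}(T)=\varprojlim\mathrm{ch}(T(V_n))\in X(\infty,d).$$ **Symmetric functions.** With $s_\mu$ and $s_{\lambda/\mu}$ the (skew) Schur functions, the hook Schur function is $$hs_\lambda(x_1,\dots,x_m;y_1,\dots,y_n)=\sum_{\mu\subseteq\lambda}s_\mu(x_1,\dots,x_m)\,s_{\lambda'/\mu'}(y_1,\dots,y_n),$$ and the Hall–Littlewood symmetric function is $$S_\lambda(x_1,\dots,x_n)=hs_\lambda(x_1,\dots,x_n;x_1,\dots,x_n).$$ Both families are compatible with setting additional variables equal to $0$; their inverse limits are denoted by $hs_\lambda(x;y)\in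 Z(\infty|\infty,d)$ and $S_\lambda(x)\in X(\infty,d)$. **Theorem.** For every $n\ge0$, the formal character of the $Q(n,d)$-supermodule $\widehat S^{\mathsf{II}}_\lambda(V_n)$ is $$\mathrm{ch}\bigl(\widehat S^{\mathsf{II}}_\lambda(V_n)\bigr)=S_\lambda(x_1,\dots,x_n).$$ Moreover, $$\mathrm{ch}^{\mathsf I}(\widehat S^{\mathsf I}_\lambda)=hs_\lambda(x;y)\qquad\text{and}\qquad\mathrm{ch}^{\mathsf{II}}(\widehat S^{\mathsf{II}}_\lambda)=S_\lambda(x).$$ -/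

import Mathlib

open scoped TensorProduct

noncomputable section

namespace SchurSuper

universe u

/-! ### Vector superspaces -/

/-- A vector superspace `M = M₀ ⊕ M₁` over `k`.  The `ℤ/2`-grading is recorded by the two
projections `proj ε` of `M` onto its homogeneous components `M_ε = {v | proj ε v = v}`. -/
class SuperSpace (k : Type u) [Field k] (M : Type u) [AddCommMonoid M] [Module k M] where
  proj : ZMod 2 → M →ₗ[k] M
  proj_proj : ∀ (ε δ : ZMod 2) (v : M), proj ε (proj δ v) = if ε = δ then proj δ v else 0
  proj_add : ∀ v : M, proj 0 v + proj 1 v = v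

/-- The projection of a superspace onto its component of degree `ε`. -/
abbrev pr (k : Type u) [Field k] {M : Type u} [AddCommMonoid M] [Module k M] [SuperSpace k M]
    (ε : ZMod 2) : M →ₗ[k] M := SuperSpace.proj ε

theorem zmod2_cases (ε : ZMod 2) : ε = 0 ∨ ε = 1 := by revert ε; decide

theorem sum_zmod2 {A : Type*} [AddCommMonoid A] (f : ZMod 2 → A) : ∑ ε, f ε = f 0 + f 1 :=
  Fin.sum_univ_two f

/-- The sign `(-1)^a`. -/
def koszul (k : Type u) [Field k] (a : ZMod 2) : k := if a = 0 then 1 else -1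

theorem koszul_zero (k : Type u) [Field k] : koszul k 0 = 1 := by simp [koszul]

theorem koszul_add (k : Type u) [Field k] (a b : ZMod 2) :
    koszul k (a + b) = koszul k a * koszul k b := by
  rcases zmod2_cases a with rfl | rfl <;> rcases zmod2_cases b with rfl | rfl <;>
    simp [koszul, show (1 + 1 : ZMod 2) = 0 from rfl]

theorem koszul_mul_self (k : Type u) [Field k] (a : ZMod 2) : koszul k a * koszul k a = 1 := by
  rw [← koszul_add, CharTwo.add_self_eq_zero, koszul_zero]

section SuperSpace

variable {k : Type u} [Field k] {M N : Type u} [AddCommGroup M] [Module k M] [SuperSpace k M]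
  [AddCommGroup N] [Module k N] [SuperSpace k N]

theorem pr_pr (ε δ : ZMod 2) (v : M) :
    (pr k ε (pr k δ v : M) : M) = if ε = δ then (pr k δ v : M) else 0 := SuperSpace.proj_proj ε δ v

theorem pr_self (ε : ZMod 2) (v : M) : (pr k ε (pr k ε v : M) : M) = pr k ε v := by
  rw [pr_pr, if_pos rfl]

theorem pr_add (v : M) : (pr k 0 v + pr k 1 v : M) = v := SuperSpace.proj_add v

theorem sum_pr (v : M) : ∑ ε, (pr k ε v : M) = v := by
  rw [sum_zmod2, pr_add]

theorem pr_of_homog {δ : ZMod 2} {v : M} (h : pr k δ v = v) (ε : ZMod 2) :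
    pr k ε v = if ε = δ then v else 0 := by
  conv_lhs => rw [← h]
  rw [pr_pr, h]

/-- A subsuperspace: `N = (N ∩ M₀) ⊕ (N ∩ M₁)`. -/
def IsGraded (N : Submodule k M) : Prop := ∀ ε : ZMod 2, ∀ v ∈ N, (pr k ε v : M) ∈ N

/-- The superspace structure on a subsuperspace. -/
@[reducible] def SuperSpace.sub (N : Submodule k M) (h : IsGraded N) : SuperSpace k N where
  proj ε := (pr k ε : M →ₗ[k] M).restrict (h ε)
  proj_proj ε δ v := by
    ext
    have := pr_pr (k := k) ε δ (v : M)
    split_ifs at this ⊢ <;> simpa using this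
  proj_add v := by
    ext
    exact pr_add (k := k) (v : M)

/-- The superspace structure on the quotient by a subsuperspace. -/
@[reducible] def SuperSpace.quot (N : Submodule k M) (h : IsGraded N) : SuperSpace k (M ⧸ N) where
  proj ε := N.mapQ N (pr k ε) (h ε)
  proj_proj ε δ v := by
    obtain ⟨v, rfl⟩ := N.mkQ_surjective v
    have := congrArg N.mkQ (pr_pr (k := k) ε δ v)
    split_ifs at this ⊢ <;> simpa using this
  proj_add v := by
    obtain ⟨v, rfl⟩ := N.mkQ_surjective v
    simpa using congrArg N.mkQ (pr_add (k := k) v)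

/-- The superspace of all linear maps `M → N`; a map `f` is homogeneous of degree `ε` when
`f(M_δ) ⊆ N_(ε+δ)` for all `δ`. -/
instance homSuperSpace : SuperSpace k (M →ₗ[k] N) where
  proj ε := ∑ δ, (LinearMap.compRight k (pr k (ε + δ) : N →ₗ[k] N)) ∘ₗ
    (pr k δ : M →ₗ[k] M).lcomp k N
  proj_proj ε δ f := by
    ext v
    rcases zmod2_cases ε with rfl | rfl <;> rcases zmod2_cases δ with rfl | rfl <;>
    simp [sum_zmod2, pr_pr, show (1 + 1 : ZMod 2) = 0 from rfl]
  proj_add f := by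
    ext v
    conv_rhs => rw [← pr_add (k := k) v, map_add, ← pr_add (k := k) (f (pr k 0 v)),
      ← pr_add (k := k) (f (pr k 1 v))]
    simp [sum_zmod2, show (1 + 1 : ZMod 2) = 0 from rfl]
    abel

theorem pr_hom_apply (ε : ZMod 2) (f : M →ₗ[k] N) (v : M) :
    (pr k ε f : M →ₗ[k] N) v = ∑ δ, (pr k (ε + δ) (f (pr k δ v)) : N) := by
  simp [pr, SuperSpace.proj]

end SuperSpace

/-! ### Tensor powers, the signed action of the symmetric group, and the rule of signs -/

/-- The tensor power `M^{⊗d}`. -/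
abbrev TPow (k : Type u) [Field k] (M : Type u) [AddCommMonoid M] [Module k M] (d : ℕ) : Type u :=
  ⨂[k] _ : Fin d, M

section Tensor

variable {k : Type u} [Field k] {d : ℕ}
  {M A B C D E F : Type u}
  [AddCommGroup M] [Module k M] [SuperSpace k M]
  [AddCommGroup A] [Module k A] [SuperSpace k A] [AddCommGroup B] [Module k B] [SuperSpace k B]
  [AddCommGroup C] [Module k C] [SuperSpace k C] [AddCommGroup D] [Module k D] [SuperSpace k D]
  [AddCommGroup E] [Module k E] [SuperSpace k E] [AddCommGroup F] [Module k F] [SuperSpace k F]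
  {A' B' C' : Type u}
  [AddCommGroup A'] [Module k A'] [SuperSpace k A'] [AddCommGroup B'] [Module k B']
  [SuperSpace k B'] [AddCommGroup C'] [Module k C'] [SuperSpace k C']

/-- `∑ φ_t ε_s` over `s < t`: the exponent of the sign in
`(f₁ ⊗ ⋯ ⊗ f_d)(v₁ ⊗ ⋯ ⊗ v_d) = ± f₁(v₁) ⊗ ⋯ ⊗ f_d(v_d)`, where `|f_t| = φ_t`, `|v_s| = ε_s`. -/
def charge (φ ε : Fin d → ZMod 2) : ZMod 2 := ∑ s, ∑ t, if s < t then φ t * ε s else 0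

/-- `∑ ε_s ε_t` over all `s < t` with `σ⁻¹ s > σ⁻¹ t`. -/
def invCharge (ε : Fin d → ZMod 2) (σ : Equiv.Perm (Fin d)) : ZMod 2 :=
  ∑ s, ∑ t, if s < t ∧ σ.symm t < σ.symm s then ε s * ε t else 0

theorem charge_perm (φ ε : Fin d → ZMod 2) (σ : Equiv.Perm (Fin d)) :
    charge φ ε + invCharge (φ + ε) σ = invCharge φ σ + invCharge ε σ + charge (φ ∘ σ) (ε ∘ σ) := by
  have h1 : charge (φ ∘ σ) (ε ∘ σ)
      = ∑ s, ∑ t, if σ.symm s < σ.symm t then φ t * ε s else 0 := by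
    rw [charge, ← Equiv.sum_comp σ (fun s => ∑ t, if σ.symm s < σ.symm t then φ t * ε s else 0)]
    refine Finset.sum_congr rfl fun s _ => ?_
    rw [← Equiv.sum_comp σ (fun t => if σ.symm (σ s) < σ.symm t then φ t * ε (σ s) else 0)]
    simp
  have h2 : invCharge (φ + ε) σ = invCharge φ σ + invCharge ε σ +
      ((∑ s, ∑ t, if t < s ∧ σ.symm s < σ.symm t then φ t * ε s else 0) +
       ∑ s, ∑ t, if s < t ∧ σ.symm t < σ.symm s then φ t * ε s else 0) := by
    rw [Finset.sum_comm (f := fun s t => if t < s ∧ σ.symm s < σ.symm t then φ t * ε s else 0)]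
    simp only [invCharge, ← Finset.sum_add_distrib]
    refine Finset.sum_congr rfl fun s _ => Finset.sum_congr rfl fun t _ => ?_
    split_ifs
    · simp only [Pi.add_apply]; ring
    · simp
  have h3 : charge φ ε + (∑ s, ∑ t, if σ.symm s < σ.symm t then φ t * ε s else 0) +
      ((∑ s, ∑ t, if t < s ∧ σ.symm s < σ.symm t then φ t * ε s else 0) +
       ∑ s, ∑ t, if s < t ∧ σ.symm t < σ.symm s then φ t * ε s else 0) = 0 := by
    simp only [charge, ← Finset.sum_add_distrib]
    refine Finset.sum_eq_zero fun s _ => Finset.sum_eq_zero fun t _ => ?_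
    have e : ∀ a : ZMod 2, a + a = 0 := CharTwo.add_self_eq_zero
    rcases lt_trichotomy s t with h | rfl | h
    · have hne : σ.symm s ≠ σ.symm t := fun h' => h.ne (σ.symm.injective h')
      rcases lt_or_gt_of_ne hne with h' | h' <;> simp [h, h', h.not_gt, h'.not_gt, e]
    · simp
    · have hne : σ.symm s ≠ σ.symm t := fun h' => h.ne' (σ.symm.injective h')
      rcases lt_or_gt_of_ne hne with h' | h' <;> simp [h, h', h.not_gt, h'.not_gt, e]
  rw [h1, h2]
  have e : ∀ a b c : ZMod 2, a + b + c = 0 → a + c = b := by decide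
  have := e _ _ _ h3
  linear_combination this

/-- The projection of `M^{⊗d}` onto `M_(δ₁) ⊗ ⋯ ⊗ M_(δ_d)`. -/
def multiProj (δ : Fin d → ZMod 2) :
    TPow k M d →ₗ[k] TPow k M d :=
  PiTensorProduct.map fun i => pr k (δ i)

theorem multiProj_tprod {ε : Fin d → ZMod 2} {v : Fin d → M}
    (h : ∀ i, pr k (ε i) (v i) = v i) (δ : Fin d → ZMod 2) :
    multiProj δ (PiTensorProduct.tprod k v) = if δ = ε then PiTensorProduct.tprod k v else 0 := by
  rw [multiProj, PiTensorProduct.map_tprod]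
  split_ifs with hδ
  · subst hδ; simp [h]
  · obtain ⟨i, hi⟩ := Function.ne_iff.1 hδ
    exact MultilinearMap.map_coord_zero _ i (by rw [pr_of_homog (h i), if_neg hi])

/-- Linear maps out of a tensor power are determined on tensors of homogeneous vectors. -/
theorem homog_ext {G : Type*} [AddCommGroup G] [Module k G]
    {f g : TPow k M d →ₗ[k] G}
    (h : ∀ (ε : Fin d → ZMod 2) (v : Fin d → M), (∀ i, pr k (ε i) (v i) = v i) →
      f (PiTensorProduct.tprod k v) = g (PiTensorProduct.tprod k v)) : f = g := by
  refine PiTensorProduct.ext (MultilinearMap.ext fun v => ?_)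
  have hv : v = fun i => ∑ ε, pr k ε (v i) := funext fun i => (sum_pr (v i)).symm
  simp only [LinearMap.compMultilinearMap_apply]
  rw [hv, MultilinearMap.map_sum, map_sum, map_sum]
  exact Finset.sum_congr rfl fun ε _ => h ε _ fun i => pr_self _ _

/-- The superspace `M^{⊗d}`; a tensor of homogeneous vectors has degree the sum of the degrees. -/
instance tpowSuperSpace : SuperSpace k (TPow k M d) where
  proj ε := ∑ δ : Fin d → ZMod 2, if ∑ i, δ i = ε then multiProj δ else 0
  proj_proj ε δ v := by
    have key : ∀ (ε : ZMod 2) (α : Fin d → ZMod 2) (v : Fin d → M),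
        (∀ i, pr k (α i) (v i) = v i) →
        (∑ δ : Fin d → ZMod 2, if ∑ i, δ i = ε then multiProj δ else 0 :
          TPow k M d →ₗ[k] TPow k M d) (PiTensorProduct.tprod k v) = if ε = ∑ i, α i then PiTensorProduct.tprod k v else 0 := by
      intro ε α v h
      rw [LinearMap.sum_apply, Finset.sum_eq_single α]
      · by_cases hh : ∑ i, α i = ε
        · simp [hh, multiProj_tprod h]
        · simp [hh, Ne.symm hh]
      · intro β _ hβ
        split_ifs
        · rw [multiProj_tprod h, if_neg hβ]
        · rfl
      · simp
    have : (∑ δ : Fin d → ZMod 2, if ∑ i, δ i = ε then multiProj δ else 0 :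
          TPow k M d →ₗ[k] TPow k M d) ∘ₗ
        (∑ δ' : Fin d → ZMod 2, if ∑ i, δ' i = δ then multiProj δ' else 0) =
        if ε = δ then (∑ δ' : Fin d → ZMod 2, if ∑ i, δ' i = δ then multiProj δ' else 0)
        else 0 := by
      refine homog_ext fun α v h => ?_
      rw [LinearMap.comp_apply, key δ α v h]
      by_cases h1 : δ = ∑ i, α i
      · rw [if_pos h1, key ε α v h]
        by_cases h2 : ε = δ
        · rw [if_pos (h2.trans h1), if_pos h2, key δ α v h, if_pos h1]
        · rw [if_neg (h1 ▸ h2), if_neg h2]; rfl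
      · rw [if_neg h1, map_zero]
        split_ifs
        · rw [key δ α v h, if_neg h1]
        · rfl
    have := LinearMap.congr_fun this v
    split_ifs at this ⊢ <;> exact this
  proj_add v := by
    have : (∑ δ : Fin d → ZMod 2, if ∑ i, δ i = 0 then multiProj δ else 0) +
        (∑ δ : Fin d → ZMod 2, if ∑ i, δ i = 1 then multiProj δ else 0) =
        (LinearMap.id : TPow k M d →ₗ[k] TPow k M d) := by
      refine homog_ext fun α v h => ?_
      rw [← Finset.sum_add_distrib, LinearMap.sum_apply, Finset.sum_eq_single α]
      · rcases zmod2_cases (∑ i, α i) with hh | hh <;> simp [hh, multiProj_tprod h]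
      · intro β _ hβ
        rcases zmod2_cases (∑ i, β i) with hh | hh <;> simp [hh, multiProj_tprod h, hβ]
      · simp
    exact LinearMap.congr_fun this v

theorem pr_tprod {α : Fin d → ZMod 2} {v : Fin d → M}
    (h : ∀ i, pr k (α i) (v i) = v i) (ε : ZMod 2) :
    pr k ε (PiTensorProduct.tprod k v) =
      if ε = ∑ i, α i then PiTensorProduct.tprod k v else 0 := by
  change (∑ δ : Fin d → ZMod 2, if ∑ i, δ i = ε then multiProj δ else 0 : TPow k M d →ₗ[k] TPow k M d)
      (PiTensorProduct.tprod k v) = _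
  rw [LinearMap.sum_apply, Finset.sum_eq_single α]
  · by_cases hh : ∑ i, α i = ε
    · simp [hh, multiProj_tprod h]
    · simp [hh, Ne.symm hh]
  · intro β _ hβ
    split_ifs
    · rw [multiProj_tprod h, if_neg hβ]
    · rfl
  · simp

/-- The right action of `σ ∈ 𝔖_d` on `M^{⊗d}`: for homogeneous `v_i`,
`(v₁ ⊗ ⋯ ⊗ v_d).σ = sgn(|v|, σ) v_(σ 1) ⊗ ⋯ ⊗ v_(σ d)`. -/
def tperm (σ : Equiv.Perm (Fin d)) : TPow k M d →ₗ[k] TPow k M d :=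
  ∑ ε : Fin d → ZMod 2, koszul k (invCharge ε σ) •
    ((PiTensorProduct.reindex k (fun _ => M) σ.symm).toLinearMap ∘ₗ multiProj ε)

theorem tperm_tprod (σ : Equiv.Perm (Fin d)) {ε : Fin d → ZMod 2} {v : Fin d → M}
    (h : ∀ i, pr k (ε i) (v i) = v i) :
    tperm σ (PiTensorProduct.tprod k v) =
      koszul k (invCharge ε σ) • PiTensorProduct.tprod k (v ∘ σ) := by
  rw [tperm, LinearMap.sum_apply, Finset.sum_eq_single ε]
  · rw [LinearMap.smul_apply, LinearMap.comp_apply, multiProj_tprod h, if_pos rfl]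
    congr 1
    exact PiTensorProduct.reindex_tprod _ _
  · intro β _ hβ
    rw [LinearMap.smul_apply, LinearMap.comp_apply, multiProj_tprod h, if_neg hβ, map_zero,
      smul_zero]
  · simp

theorem pr_tperm (σ : Equiv.Perm (Fin d)) (ε : ZMod 2) (x : TPow k M d) :
    pr k ε (tperm σ x) = tperm σ (pr k ε x) := by
  refine LinearMap.congr_fun (f := pr k ε ∘ₗ tperm σ)
    (g := tperm σ ∘ₗ pr k ε) (homog_ext fun α v h => ?_) x
  have h' : ∀ i, pr k ((α ∘ σ) i) ((v ∘ σ) i) = (v ∘ σ) i := fun i => h (σ i)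
  rw [LinearMap.comp_apply, LinearMap.comp_apply, tperm_tprod σ h, map_smul,
    pr_tprod h', pr_tprod h]
  have : ∑ i, (α ∘ σ) i = ∑ i, α i := Equiv.sum_comp σ α
  rw [this]
  split_ifs
  · rw [tperm_tprod σ h]
  · simp

/-- An even bilinear map `A × B → C` of superspaces. -/
def IsEvenBilin (β : A →ₗ[k] B →ₗ[k] C) : Prop :=
  ∀ (ε δ : ZMod 2) (a : A) (b : B), pr k ε a = a → pr k δ b = b →
    pr k (ε + δ) (β a b) = β a b

/-- The map `A^{⊗d} × B^{⊗d} → C^{⊗d}` induced by an even bilinear map `β` through the rule of signs: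
`(a₁ ⊗ ⋯ ⊗ a_d, b₁ ⊗ ⋯ ⊗ b_d) ↦ ∏_{s<t} (-1)^(|a_t||b_s|) β(a₁,b₁) ⊗ ⋯ ⊗ β(a_d,b_d)`. -/
def tbilin (β : A →ₗ[k] B →ₗ[k] C) (d : ℕ) :
    TPow k A d →ₗ[k] TPow k B d →ₗ[k] TPow k C d :=
  ∑ φ : Fin d → ZMod 2, ∑ ε : Fin d → ZMod 2, koszul k (charge φ ε) •
    (PiTensorProduct.map₂ fun _ : Fin d => β).compl₁₂ (multiProj φ) (multiProj ε)

theorem tbilin_tprod (β : A →ₗ[k] B →ₗ[k] C)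
    {φ ε : Fin d → ZMod 2} {a : Fin d → A} {b : Fin d → B}
    (ha : ∀ i, pr k (φ i) (a i) = a i) (hb : ∀ i, pr k (ε i) (b i) = b i) :
    tbilin β d (PiTensorProduct.tprod k a) (PiTensorProduct.tprod k b) =
      koszul k (charge φ ε) • PiTensorProduct.tprod k fun i => β (a i) (b i) := by
  rw [tbilin]
  simp only [LinearMap.sum_apply, LinearMap.smul_apply, LinearMap.compl₁₂_apply]
  rw [Finset.sum_eq_single φ, Finset.sum_eq_single ε]
  · rw [multiProj_tprod ha, multiProj_tprod hb, if_pos rfl, if_pos rfl,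
      PiTensorProduct.map₂_tprod_tprod]
  · intro β' _ hβ
    rw [multiProj_tprod hb, if_neg hβ, map_zero, smul_zero]
  · simp
  · intro β' _ hβ
    refine Finset.sum_eq_zero fun _ _ => ?_
    rw [multiProj_tprod ha, if_neg hβ, map_zero, LinearMap.zero_apply, smul_zero]
  · simp

/-- Bilinear maps out of tensor powers are determined on tensors of homogeneous vectors. -/
theorem homog_ext₂ {e : ℕ} {G : Type*} [AddCommGroup G] [Module k G]
    {f g : TPow k A d →ₗ[k] TPow k B e →ₗ[k] G}
    (h : ∀ (φ : Fin d → ZMod 2) (ε : Fin e → ZMod 2) (a : Fin d → A) (b : Fin e → B),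
      (∀ i, pr k (φ i) (a i) = a i) → (∀ i, pr k (ε i) (b i) = b i) →
      f (PiTensorProduct.tprod k a) (PiTensorProduct.tprod k b) =
        g (PiTensorProduct.tprod k a) (PiTensorProduct.tprod k b)) : f = g :=
  homog_ext fun φ a ha => homog_ext fun ε b hb => h φ ε a b ha hb

theorem tbilin_tperm {β : A →ₗ[k] B →ₗ[k] C} (hβ : IsEvenBilin β)
    (σ : Equiv.Perm (Fin d)) (x : TPow k A d) (y : TPow k B d) :
    tperm σ (tbilin β d x y) = tbilin β d (tperm σ x) (tperm σ y) := by
  have : (tbilin β d).compr₂ (tperm σ) = (tbilin β d).compl₁₂ (tperm σ) (tperm σ) := by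
    refine homog_ext₂ fun φ ε a b ha hb => ?_
    have ha' : ∀ i, pr k ((φ ∘ σ) i) ((a ∘ σ) i) = (a ∘ σ) i := fun i => ha (σ i)
    have hb' : ∀ i, pr k ((ε ∘ σ) i) ((b ∘ σ) i) = (b ∘ σ) i := fun i => hb (σ i)
    have hc : ∀ i, pr k ((φ + ε) i) (β (a i) (b i)) = β (a i) (b i) :=
      fun i => hβ _ _ _ _ (ha i) (hb i)
    rw [LinearMap.compr₂_apply, LinearMap.compl₁₂_apply, tbilin_tprod β ha hb, map_smul,
      tperm_tprod σ hc, tperm_tprod σ ha, tperm_tprod σ hb, map_smul, map_smul,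
      LinearMap.smul_apply, tbilin_tprod β ha' hb', smul_smul, smul_smul, smul_smul, ← koszul_add,
      ← koszul_add, ← koszul_add, charge_perm,
      add_comm (invCharge φ σ)]
    rfl
  exact LinearMap.congr_fun₂ this x y

theorem pr_tbilin {β : A →ₗ[k] B →ₗ[k] C} (hβ : IsEvenBilin β)
    (ε : ZMod 2) (x : TPow k A d) (y : TPow k B d) :
    pr k ε (tbilin β d x y) =
      ∑ δ, tbilin β d (pr k (ε + δ) x) (pr k δ y) := by
  have : (tbilin β d).compr₂ (pr k ε) =
      ∑ δ, (tbilin β d).compl₁₂ (pr k (ε + δ)) (pr k δ) := by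
    refine homog_ext₂ fun φ α a b ha hb => ?_
    have hc : ∀ i, pr k ((φ + α) i) (β (a i) (b i)) = β (a i) (b i) :=
      fun i => hβ _ _ _ _ (ha i) (hb i)
    simp only [LinearMap.sum_apply, LinearMap.compr₂_apply, LinearMap.compl₁₂_apply]
    rw [tbilin_tprod β ha hb, map_smul, pr_tprod hc, Finset.sum_eq_single (∑ i, α i)]
    · rw [pr_tprod ha, pr_tprod hb, if_pos rfl]
      have e : ∀ a b c : ZMod 2, (a = b + c ↔ a + c = b) := by decide
      have e' : (ε = ∑ i, (φ + α) i) ↔ (ε + ∑ i, α i = ∑ i, φ i) := by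
        rw [← e]; simp [Finset.sum_add_distrib]
      by_cases h : ε = ∑ i, (φ + α) i
      · rw [if_pos h, if_pos (e'.1 h), tbilin_tprod β ha hb]
      · rw [if_neg h, if_neg (fun h' => h (e'.2 h'))]; simp
    · intro β' _ hβ'
      rw [pr_tprod hb, if_neg hβ', map_zero]
    · simp
  have := LinearMap.congr_fun₂ this x y
  simpa [LinearMap.sum_apply] using this

theorem charge_assoc (φ ψ ε : Fin d → ZMod 2) :
    charge φ ψ + charge (φ + ψ) ε = charge ψ ε + charge φ (ψ + ε) := by
  simp only [charge, ← Finset.sum_add_distrib]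
  refine Finset.sum_congr rfl fun s _ => Finset.sum_congr rfl fun t _ => ?_
  split_ifs
  · simp only [Pi.add_apply]; ring
  · simp

theorem tbilin_assoc
    {β₁ : A →ₗ[k] B →ₗ[k] D} {β₂ : D →ₗ[k] C →ₗ[k] F}
    {β₃ : B →ₗ[k] C →ₗ[k] E} {β₄ : A →ₗ[k] E →ₗ[k] F}
    (h₁ : IsEvenBilin β₁) (h₃ : IsEvenBilin β₃)
    (h : ∀ a b c, β₂ (β₁ a b) c = β₄ a (β₃ b c)) (x : TPow k A d) (y : TPow k B d) (z : TPow k C d) :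
    tbilin β₂ d (tbilin β₁ d x y) z = tbilin β₄ d x (tbilin β₃ d y z) := by
  have : (tbilin β₁ d).compr₂ (tbilin β₂ d) =
      ((LinearMap.llcomp k (TPow k B d) (TPow k C d →ₗ[k] TPow k E d) (TPow k C d →ₗ[k] TPow k F d)).flip
        (tbilin β₃ d)) ∘ₗ (LinearMap.llcomp k (TPow k C d) (TPow k E d) (TPow k F d)) ∘ₗ tbilin β₄ d := by
    refine homog_ext₂ fun φ ψ a b ha hb => homog_ext fun ε c hc => ?_
    have h1 : ∀ i, pr k ((φ + ψ) i) (β₁ (a i) (b i)) = β₁ (a i) (b i) :=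
      fun i => h₁ _ _ _ _ (ha i) (hb i)
    have h3 : ∀ i, pr k ((ψ + ε) i) (β₃ (b i) (c i)) = β₃ (b i) (c i) :=
      fun i => h₃ _ _ _ _ (hb i) (hc i)
    simp only [LinearMap.compr₂_apply, LinearMap.comp_apply, LinearMap.flip_apply,
      LinearMap.llcomp_apply]
    rw [tbilin_tprod β₁ ha hb, tbilin_tprod β₃ hb hc, map_smul, map_smul, LinearMap.smul_apply,
      tbilin_tprod β₂ h1 hc, tbilin_tprod β₄ ha h3, smul_smul, smul_smul, ← koszul_add,
      ← koszul_add, charge_assoc]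
    simp only [h]
  exact LinearMap.congr_fun (LinearMap.congr_fun₂ this x y) z

/-- The map `A^{⊗d} → B^{⊗d}` induced by an even map `A → B`. -/
def tmap (f : A →ₗ[k] B) (d : ℕ) : TPow k A d →ₗ[k] TPow k B d :=
  PiTensorProduct.map fun _ => f

theorem tmap_tperm {f : A →ₗ[k] B} (hf : ∀ ε a, pr k ε (f a) = f (pr k ε a))
    (σ : Equiv.Perm (Fin d)) (x : TPow k A d) :
    tperm σ (tmap f d x) = tmap f d (tperm σ x) := by
  refine LinearMap.congr_fun (f := tperm σ ∘ₗ tmap f d) (g := tmap f d ∘ₗ tperm σ)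
    (homog_ext fun α v h => ?_) x
  have h' : ∀ i, pr k (α i) (f (v i)) = f (v i) := fun i => by rw [hf, h]
  rw [LinearMap.comp_apply, LinearMap.comp_apply, tperm_tprod σ h, map_smul, tmap,
    PiTensorProduct.map_tprod, PiTensorProduct.map_tprod, tperm_tprod σ h']
  rfl

theorem pr_tmap {f : A →ₗ[k] B} (hf : ∀ ε a, pr k ε (f a) = f (pr k ε a))
    (ε : ZMod 2) (x : TPow k A d) :
    pr k ε (tmap f d x) = tmap f d (pr k ε x) := by
  refine LinearMap.congr_fun (f := pr k ε ∘ₗ tmap f d)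
    (g := tmap f d ∘ₗ pr k ε) (homog_ext fun α v h => ?_) x
  have h' : ∀ i, pr k (α i) (f (v i)) = f (v i) := fun i => by rw [hf, h]
  rw [LinearMap.comp_apply, LinearMap.comp_apply, pr_tprod h, tmap,
    PiTensorProduct.map_tprod, pr_tprod h']
  split_ifs
  · rw [PiTensorProduct.map_tprod]
  · rw [map_zero]

theorem tmap_tbilin {β : A →ₗ[k] B →ₗ[k] C} {β' : A' →ₗ[k] B' →ₗ[k] C'}
    {f : A →ₗ[k] A'} {g : B →ₗ[k] B'} {h : C →ₗ[k] C'}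
    (hf : ∀ ε a, pr k ε (f a) = f (pr k ε a)) (hg : ∀ ε a, pr k ε (g a) = g (pr k ε a))
    (H : ∀ a b, β' (f a) (g b) = h (β a b)) (x : TPow k A d) (y : TPow k B d) :
    tbilin β' d (tmap f d x) (tmap g d y) = tmap h d (tbilin β d x y) := by
  have : (tbilin β' d).compl₁₂ (tmap f d) (tmap g d) = (tbilin β d).compr₂ (tmap h d) := by
    refine homog_ext₂ fun φ ε a b ha hb => ?_
    have ha' : ∀ i, pr k (φ i) (f (a i)) = f (a i) := fun i => by rw [hf, ha]
    have hb' : ∀ i, pr k (ε i) (g (b i)) = g (b i) := fun i => by rw [hg, hb]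
    rw [LinearMap.compr₂_apply, LinearMap.compl₁₂_apply, tbilin_tprod β ha hb, map_smul, tmap, tmap,
      tmap, PiTensorProduct.map_tprod, PiTensorProduct.map_tprod, PiTensorProduct.map_tprod,
      tbilin_tprod β' ha' hb']
    simp only [H]
  exact LinearMap.congr_fun₂ this x y

end Tensor

/-! ### Divided powers and the categories of supermodules -/

/-- The divided power `Γ^d M`, realised as the subsuperspace of `𝔖_d`-invariants of `M^{⊗d}`. -/
def gammaSub (k : Type u) [Field k] (M : Type u) [AddCommGroup M] [Module k M] [SuperSpace k M]
    (d : ℕ) : Submodule k (TPow k M d) where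
  carrier := {x | ∀ σ : Equiv.Perm (Fin d), tperm σ x = x}
  add_mem' hx hy σ := by rw [map_add, hx, hy]
  zero_mem' σ := map_zero _
  smul_mem' c x hx σ := by rw [map_smul, hx]

/-- `Γ^d M` as a type. -/
abbrev Gam (k : Type u) [Field k] (M : Type u) [AddCommGroup M] [Module k M] [SuperSpace k M]
    (d : ℕ) : Type u := gammaSub k M d

instance gamSuperSpace (k : Type u) [Field k] (M : Type u) [AddCommGroup M] [Module k M]
    [SuperSpace k M] (d : ℕ) : SuperSpace k (Gam k M d) :=
  SuperSpace.sub _ fun ε x hx σ => by rw [← pr_tperm, hx]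

/-- The category `svec` of finite dimensional vector superspaces; its morphisms are all linear
maps. -/
structure SVec (k : Type u) [Field k] where
  carrier : Type u
  [addCommGroup : AddCommGroup carrier]
  [module : Module k carrier]
  [finite : Module.Finite k carrier]
  [superSpace : SuperSpace k carrier]

attribute [instance] SVec.addCommGroup SVec.module SVec.finite SVec.superSpace

/-- The category `smod 𝒞_r` of finite dimensional right supermodules over the Clifford superalgebra
`𝒞_r`, which is generated by odd elements `c_1, …, c_r` with `c_i² = 1` and `c_i c_j = -c_j c_i` for
`i ≠ j`; here `c i` is the right action of `c_i`.  As `𝒞_0 = k`, the case `r = 0` is `svec`. -/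
structure CliffMod (k : Type u) [Field k] (r : ℕ) where
  carrier : Type u
  [addCommGroup : AddCommGroup carrier]
  [module : Module k carrier]
  [finite : Module.Finite k carrier]
  [superSpace : SuperSpace k carrier]
  c : Fin r → carrier →ₗ[k] carrier
  c_odd : ∀ (i : Fin r) (ε : ZMod 2) (v : carrier), c i (pr k ε v) = pr k (ε + 1) (c i v)
  c_sq : ∀ (i : Fin r) (v : carrier), c i (c i v) = v
  c_anticomm : ∀ i j : Fin r, i ≠ j → ∀ v : carrier, c i (c j v) = -c j (c i v)

attribute [instance] CliffMod.addCommGroup CliffMod.module CliffMod.finite CliffMod.superSpace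

section Cliff

variable {k : Type u} [Field k] {r d : ℕ}

/-- `Hom_{𝒞_r}(V, W)`: the linear maps, even or odd or mixed, with `f(vc) = f(v)c`. -/
def cliffHom (V W : CliffMod k r) : Submodule k (V.carrier →ₗ[k] W.carrier) where
  carrier := {f | ∀ i v, f (V.c i v) = W.c i (f v)}
  add_mem' hf hg i v := by simp [hf i v, hg i v]
  zero_mem' i v := by simp
  smul_mem' a f hf i v := by simp [hf i v]

/-- `Hom_{𝒞_r}(V, W)` as a type. -/
abbrev CHom (V W : CliffMod k r) : Type u := cliffHom V W

theorem isGraded_cliffHom (V W : CliffMod k r) : IsGraded (cliffHom V W) := by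
  intro ε f hf i v
  have e : ∀ δ : ZMod 2, (pr k (ε + δ) (f (pr k δ (V.c i v))) : W.carrier) =
      W.c i (pr k (ε + (δ + 1)) (f (pr k (δ + 1) v))) := by
    intro δ
    have h2 : ∀ δ : ZMod 2, δ + 1 + 1 = δ := by decide
    rw [W.c_odd, ← hf i, V.c_odd, h2, add_assoc, h2]
  rw [pr_hom_apply, pr_hom_apply, map_sum]
  simp only [e]
  exact Equiv.sum_comp (Equiv.addRight (1 : ZMod 2))
    fun δ => W.c i (pr k (ε + δ) (f (pr k δ v)))

instance cliffHomSuperSpace (V W : CliffMod k r) : SuperSpace k (CHom V W) :=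
  SuperSpace.sub _ (isGraded_cliffHom V W)

/-- The evaluation `Hom_{𝒞_r}(V, W) × V → W`. -/
def cliffEval (V W : CliffMod k r) : CHom V W →ₗ[k] V.carrier →ₗ[k] W.carrier :=
  (cliffHom V W).subtype

/-- Composition `Hom_{𝒞_r}(V, W) × Hom_{𝒞_r}(U, V) → Hom_{𝒞_r}(U, W)`. -/
def cliffComp (U V W : CliffMod k r) : CHom V W →ₗ[k] CHom U V →ₗ[k] CHom U W :=
  LinearMap.mk₂ k (fun f g => ⟨f.1 ∘ₗ g.1, fun i v => by
      rw [LinearMap.comp_apply, LinearMap.comp_apply, g.2, f.2]⟩)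
    (fun _ _ _ => rfl) (fun _ _ _ => rfl)
    (fun f g h => Subtype.ext (LinearMap.comp_add _ _ _))
    (fun a f g => Subtype.ext (LinearMap.comp_smul _ _ _))

/-- The identity of `V`. -/
def cliffId (V : CliffMod k r) : CHom V V := ⟨LinearMap.id, fun _ _ => rfl⟩

theorem coe_pr_cliffHom {V W : CliffMod k r} (ε : ZMod 2) (f : CHom V W) :
    ((pr k ε f : CHom V W) : V.carrier →ₗ[k] W.carrier) = pr k ε f.1 := rfl

theorem pr_apply_of_homog {M N : Type u} [AddCommGroup M] [Module k M] [SuperSpace k M]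
    [AddCommGroup N] [Module k N] [SuperSpace k N] {ε δ : ZMod 2} {f : M →ₗ[k] N} {v : M}
    (hf : pr k ε f = f) (hv : pr k δ v = v) : pr k (ε + δ) (f v) = f v := by
  rw [← hf, pr_hom_apply, Finset.sum_eq_single δ]
  · rw [hv, pr_self]
  · intro β _ hβ
    rw [pr_of_homog hv, if_neg hβ, map_zero, map_zero]
  · simp

theorem isEvenBilin_eval {M N : Type u} [AddCommGroup M] [Module k M] [SuperSpace k M]
    [AddCommGroup N] [Module k N] [SuperSpace k N] :
    IsEvenBilin (LinearMap.id : (M →ₗ[k] N) →ₗ[k] M →ₗ[k] N) :=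
  fun _ _ _ _ hf hv => pr_apply_of_homog hf hv

theorem isEvenBilin_cliffEval (V W : CliffMod k r) : IsEvenBilin (cliffEval V W) :=
  fun _ _ _ _ hf hv => pr_apply_of_homog (congrArg Subtype.val hf) hv

theorem isEvenBilin_cliffComp (U V W : CliffMod k r) : IsEvenBilin (cliffComp U V W) := by
  intro ε δ f g hf hg
  refine Subtype.ext (LinearMap.ext fun v => ?_)
  have hf' : pr k ε f.1 = f.1 := congrArg Subtype.val hf
  have hg' : pr k δ g.1 = g.1 := congrArg Subtype.val hg
  have key : ∀ α : ZMod 2, (pr k (ε + δ + α) (f.1 (g.1 (pr k α v))) : W.carrier) =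
      f.1 (g.1 (pr k α v)) := by
    intro α
    rw [add_assoc]
    exact pr_apply_of_homog hf' (pr_apply_of_homog hg' (pr_self α v))
  rw [coe_pr_cliffHom, pr_hom_apply]
  change ∑ α, (pr k (ε + δ + α) (f.1 (g.1 (pr k α v))) : W.carrier) = f.1 (g.1 v)
  simp only [key]
  rw [← map_sum, ← map_sum, sum_pr]

theorem pr_cliffId (V : CliffMod k r) : pr k 0 (cliffId V) = cliffId V := by
  refine Subtype.ext (LinearMap.ext fun v => ?_)
  rw [coe_pr_cliffHom, pr_hom_apply]
  change ∑ δ, (pr k (0 + δ) (pr k δ v) : V.carrier) = v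
  simp only [zero_add, pr_self]
  exact sum_pr v

/-- A tensor power of one even vector is `𝔖_d`-invariant, and so are symmetric sums of tensors of
even vectors. -/
theorem tperm_tprod_even {M : Type u} [AddCommGroup M] [Module k M] [SuperSpace k M]
    (σ : Equiv.Perm (Fin d)) {v : Fin d → M} (h : ∀ i, pr k 0 (v i) = v i) :
    tperm σ (PiTensorProduct.tprod k v) = PiTensorProduct.tprod k (v ∘ σ) := by
  rw [tperm_tprod σ (ε := fun _ => 0) h]
  simp [invCharge, koszul_zero]

/-- The identity of `V` in `Γ^d(smod 𝒞_r)`, as an element of `Γ^d Hom_{𝒞_r}(V, V)`. -/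
def gamId (V : CliffMod k r) (d : ℕ) : Gam k (CHom V V) d :=
  ⟨PiTensorProduct.tprod k fun _ => cliffId V,
    fun σ => tperm_tprod_even σ fun _ => pr_cliffId V⟩

/-- Composition in `Γ^d(smod 𝒞_r)`, induced by composition of `𝒞_r`-homomorphisms through the rule
of signs. -/
def gamComp {U V W : CliffMod k r} (f : Gam k (CHom V W) d) (g : Gam k (CHom U V) d) :
    Gam k (CHom U W) d :=
  ⟨tbilin (cliffComp U V W) d f.1 g.1, fun σ => by
    rw [tbilin_tperm (isEvenBilin_cliffComp U V W), f.2, g.2]⟩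

/-- The vector superspace underlying a right `𝒞_r`-supermodule. -/
abbrev CliffMod.forget (V : CliffMod k r) : CliffMod k 0 where
  carrier := V.carrier
  c := Fin.elim0
  c_odd i := i.elim0
  c_sq i := i.elim0
  c_anticomm i := i.elim0

/-- The inclusion `Hom_{𝒞_r}(V, W) ⊆ Hom(V, W)`. -/
def forgetHom (V W : CliffMod k r) : CHom V W →ₗ[k] CHom V.forget W.forget where
  toFun f := ⟨f.1, fun i => i.elim0⟩
  map_add' _ _ := rfl
  map_smul' _ _ := rfl

theorem pr_forgetHom {V W : CliffMod k r} (ε : ZMod 2) (f : CHom V W) :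
    pr k ε (forgetHom V W f) = forgetHom V W (pr k ε f) := rfl

/-- The forgetful functor `Γ^d(smod 𝒞_r) → Γ^d(svec)` on morphisms. -/
def forgetGam (V W : CliffMod k r) (d : ℕ) :
    Gam k (CHom V W) d →ₗ[k] Gam k (CHom V.forget W.forget) d :=
  (tmap (forgetHom V W) d).restrict fun x hx σ => by
    rw [tmap_tperm pr_forgetHom, hx]

theorem forgetGam_id (V : CliffMod k r) : forgetGam V V d (gamId V d) = gamId V.forget d :=
  Subtype.ext (PiTensorProduct.map_tprod _ _)

theorem forgetGam_comp {U V W : CliffMod k r} (f : Gam k (CHom V W) d) (g : Gam k (CHom U V) d) :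
    forgetGam U W d (gamComp f g) = gamComp (forgetGam V W d f) (forgetGam U V d g) :=
  Subtype.ext (tmap_tbilin pr_forgetHom pr_forgetHom (fun _ _ => rfl) f.1 g.1).symm

theorem pr_forgetGam {V W : CliffMod k r} (ε : ZMod 2) (f : Gam k (CHom V W) d) :
    pr k ε (forgetGam V W d f) = forgetGam V W d (pr k ε f) :=
  Subtype.ext (pr_tmap pr_forgetHom ε f.1)

end Cliff

/-! ### Polynomial superfunctors and supermodules over Schur superalgebras -/

/-- A strict polynomial superfunctor, homogeneous of degree `d`: an even `k`-linear functor
`Γ^d(smod 𝒞_r) → svec`.  It is of type I for `r = 0` and of type II for `r = 1`. -/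
structure PolFunctor (k : Type u) [Field k] (r d : ℕ) where
  obj : CliffMod k r → SVec k
  map : ∀ V W : CliffMod k r,
    Gam k (CHom V W) d →ₗ[k] ((obj V).carrier →ₗ[k] (obj W).carrier)
  map_even : ∀ (V W : CliffMod k r) (ε : ZMod 2) (f : Gam k (CHom V W) d),
    map V W (pr k ε f) = pr k ε (map V W f)
  map_id : ∀ V : CliffMod k r, map V V (gamId V d) = LinearMap.id
  map_comp : ∀ (U V W : CliffMod k r) (f : Gam k (CHom V W) d) (g : Gam k (CHom U V) d),
    map U W (gamComp f g) = map V W f ∘ₗ map U V g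

/-- The restriction functor from superfunctors of type I to type II: composition with the functor
forgetting the action of the Clifford superalgebra. -/
def PolFunctor.res {k : Type u} [Field k] {d : ℕ} (T : PolFunctor k 0 d) (r : ℕ) :
    PolFunctor k r d where
  obj V := T.obj V.forget
  map V W := T.map V.forget W.forget ∘ₗ forgetGam V W d
  map_even V W ε f := by
    rw [LinearMap.comp_apply, LinearMap.comp_apply, ← pr_forgetGam, T.map_even]
  map_id V := by rw [LinearMap.comp_apply, forgetGam_id, T.map_id]
  map_comp U V W f g := by
    rw [LinearMap.comp_apply, LinearMap.comp_apply, LinearMap.comp_apply, forgetGam_comp,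
      T.map_comp]

/-- A finite dimensional left supermodule over the superalgebra `Γ^d End_{𝒞_r}(V)`. -/
structure SchurMod {k : Type u} [Field k] {r : ℕ} (V : CliffMod k r) (d : ℕ) extends SVec k where
  act : Gam k (CHom V V) d →ₗ[k] (carrier →ₗ[k] carrier)
  act_even : ∀ (ε : ZMod 2) (f : Gam k (CHom V V) d), act (pr k ε f) = pr k ε (act f)
  act_one : act (gamId V d) = LinearMap.id
  act_mul : ∀ f g : Gam k (CHom V V) d, act (gamComp f g) = act f ∘ₗ act g

/-- The evaluation `T(V)` of a polynomial superfunctor, with its structure of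
`Γ^d End_{𝒞_r}(V)`-supermodule. -/
def PolFunctor.ev {k : Type u} [Field k] {r d : ℕ} (T : PolFunctor k r d) (V : CliffMod k r) :
    SchurMod V d where
  toSVec := T.obj V
  act := T.map V V
  act_even := T.map_even V V
  act_one := T.map_id V
  act_mul := T.map_comp V V V

/-! ### Schur superfunctors -/

/-- The parity change `ΠM`: the same vector space with the opposite grading. -/
def Par (M : Type u) : Type u := M

section Par

variable (k : Type u) [Field k] (M : Type u) [AddCommGroup M] [Module k M]

instance : AddCommGroup (Par M) := inferInstanceAs (AddCommGroup M)

instance : Module k (Par M) := inferInstanceAs (Module k M)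

/-- The identity map `ΠM → M`. -/
def parTo : Par M →ₗ[k] M := LinearMap.id

/-- The identity map `M → ΠM`. -/
def toPar : M →ₗ[k] Par M := LinearMap.id

variable [SuperSpace k M]

instance parSuperSpace : SuperSpace k (Par M) where
  proj ε := toPar k M ∘ₗ pr k (ε + 1) ∘ₗ parTo k M
  proj_proj ε δ v := by
    change (pr k (ε + 1) (pr k (δ + 1) (parTo k M v)) : M) = _
    rw [pr_pr]
    simp only [add_left_inj]
    rfl
  proj_add v := by
    change (pr k (0 + 1) (parTo k M v) + pr k (1 + 1) (parTo k M v) : M) = _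
    rw [add_comm]
    exact pr_add (parTo k M v)

theorem pr_par (ε : ZMod 2) (v : Par M) : parTo k M (pr k ε v) = pr k (ε + 1) (parTo k M v) := rfl

theorem pr_parTo : pr k 1 (parTo k M) = parTo k M := by
  ext v
  have h : ∀ δ : ZMod 2, 1 + δ = δ + 1 := by decide
  rw [pr_hom_apply]
  simp only [pr_par, h, pr_self]
  exact Equiv.sum_comp (Equiv.addRight (1 : ZMod 2)) (fun δ => (pr k δ (parTo k M v) : M)) |>.trans
    (sum_pr _)

theorem pr_toPar : pr k 1 (toPar k M) = toPar k M := by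
  ext v
  have h : ∀ δ : ZMod 2, 1 + δ + 1 = δ := by decide
  rw [pr_hom_apply]
  change ∑ δ, (pr k (1 + δ + 1) (pr k δ v) : M) = v
  simp only [h, pr_self]
  exact sum_pr v

end Par

section Schur

/-- The numbering of the boxes of a Young diagram along the rows: from left to right in each row,
and from the top row to the bottom row.  (Boxes are pairs (row, column).) -/
def rowBox (lam : YoungDiagram) : Fin lam.card ≃ lam.cells :=
  (Finset.orderIsoOfFin (lam.cells.map (toLex : ℕ × ℕ ≃ ℕ ×ₗ ℕ).toEmbedding)
    (Finset.card_map _)).toEquiv.trans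
  ((toLex : ℕ × ℕ ≃ ℕ ×ₗ ℕ).subtypeEquiv fun _ => by simp).symm

/-- The numbering of the boxes of a Young diagram along the columns: from top to bottom in each
column, and from the leftmost column to the rightmost column. -/
def colBox (lam : YoungDiagram) : Fin lam.card ≃ lam.cells :=
  (Finset.orderIsoOfFin
    (lam.cells.map ((Equiv.prodComm ℕ ℕ).trans (toLex : ℕ × ℕ ≃ ℕ ×ₗ ℕ)).toEmbedding)
    (Finset.card_map _)).toEquiv.trans
  (((Equiv.prodComm ℕ ℕ).trans (toLex : ℕ × ℕ ≃ ℕ ×ₗ ℕ)).subtypeEquiv fun _ => by simp).symm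

/-- The permutation `σ_λ`, sending the number of a box along the rows to its number along the
columns. -/
def sigmaPerm (lam : YoungDiagram) : Equiv.Perm (Fin lam.card) :=
  (rowBox lam).trans (colBox lam).symm

/-- The Young subgroup `𝔖_(λ₁) × 𝔖_(λ₂) × ⋯`. -/
def IsRowPerm (lam : YoungDiagram) (σ : Equiv.Perm (Fin lam.card)) : Prop :=
  ∀ s, (rowBox lam (σ s)).1.1 = (rowBox lam s).1.1

/-- The Young subgroup `𝔖_(λ'₁) × 𝔖_(λ'₂) × ⋯`. -/
def IsColPerm (lam : YoungDiagram) (σ : Equiv.Perm (Fin lam.card)) : Prop :=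
  ∀ s, (colBox lam (σ s)).1.2 = (colBox lam s).1.2

variable (k : Type u) [Field k] (lam : YoungDiagram)
  (M : Type u) [AddCommGroup M] [Module k M] [SuperSpace k M]

/-- The kernel of the multiplication `m : M^{⊗d} → S^λ M = S^(λ₁) M ⊗ S^(λ₂) M ⊗ ⋯`. -/
def symKer : Submodule k (TPow k M lam.card) :=
  Submodule.span k {y | ∃ σ x, IsRowPerm lam σ ∧ y = tperm σ x - x}

/-- `S^λ M = S^(λ₁) M ⊗ S^(λ₂) M ⊗ ⋯`, the coinvariants of the Young subgroup of `λ`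
in `M^{⊗d}`. -/
abbrev SymPow : Type u := TPow k M lam.card ⧸ symKer k lam M

/-- `Γ_Π^λ' M = Γ^(λ'₁)(ΠM) ⊗ Γ^(λ'₂)(ΠM) ⊗ ⋯`, the invariants of the Young subgroup of `λ'`
in `(ΠM)^{⊗d}`. -/
def divPowPar : Submodule k (TPow k (Par M) lam.card) where
  carrier := {x | ∀ σ, IsColPerm lam σ → tperm σ x = x}
  add_mem' hx hy σ h := by rw [map_add, hx σ h, hy σ h]
  zero_mem' σ _ := map_zero _
  smul_mem' c x hx σ h := by rw [map_smul, hx σ h]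

/-- The `d`-th tensor power, formed with the rule of signs, of a linear map `f : M → N` which need
not be even. -/
def signedPow {k M} [Field k] [AddCommGroup M] [Module k M] [SuperSpace k M] {N : Type u}
    [AddCommGroup N] [Module k N] [SuperSpace k N] (f : M →ₗ[k] N) (d : ℕ) :
    TPow k M d →ₗ[k] TPow k N d :=
  tbilin (LinearMap.id : (M →ₗ[k] N) →ₗ[k] M →ₗ[k] N) d (PiTensorProduct.tprod k fun _ => f)

/-- The map `θ̂_λ : Γ_Π^λ' M → S^λ M`, the composite of the inclusion of `Γ_Π^λ' M` in `(ΠM)^{⊗d}`,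
the map `1^{⊗d} : (ΠM)^{⊗d} → M^{⊗d}`, the action of `σ_λ` and multiplication. -/
def theta : divPowPar k lam M →ₗ[k] SymPow k lam M :=
  (symKer k lam M).mkQ ∘ₗ tperm (sigmaPerm lam) ∘ₗ signedPow (parTo k M) lam.card ∘ₗ
    (divPowPar k lam M).subtype

/-- `Ŝ_λ(M)`, the image of `θ̂_λ` in `S^λ M`. -/
def schurSub : Submodule k (SymPow k lam M) := LinearMap.range (theta k lam M)

variable {k lam M}

theorem isGraded_symKer : IsGraded (symKer k lam M) := by
  intro ε x hx
  induction hx using Submodule.span_induction with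
  | mem x h =>
    obtain ⟨σ, y, hσ, rfl⟩ := h
    exact Submodule.subset_span ⟨σ, pr k ε y, hσ, by rw [map_sub, pr_tperm]⟩
  | zero => rw [map_zero]; exact zero_mem _
  | add x y _ _ h1 h2 => rw [map_add]; exact add_mem h1 h2
  | smul a x _ h => rw [map_smul]; exact Submodule.smul_mem _ _ h

instance symPowSuperSpace : SuperSpace k (SymPow k lam M) :=
  SuperSpace.quot _ isGraded_symKer

theorem pr_mkQ (ε : ZMod 2) (x : TPow k M lam.card) :
    (pr k ε ((symKer k lam M).mkQ x) : SymPow k lam M) = (symKer k lam M).mkQ (pr k ε x) := rfl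

theorem mem_schurSub {y : SymPow k lam M} : y ∈ schurSub k lam M ↔
    ∃ x ∈ divPowPar k lam M, (symKer k lam M).mkQ
      (tperm (sigmaPerm lam) (signedPow (parTo k M) lam.card x)) = y := by
  constructor
  · rintro ⟨x, rfl⟩
    exact ⟨x.1, x.2, rfl⟩
  · rintro ⟨x, hx, rfl⟩
    exact ⟨⟨x, hx⟩, rfl⟩

variable {d : ℕ} {N : Type u} [AddCommGroup N] [Module k N] [SuperSpace k N]

/-- The tensor power of a homogeneous vector is homogeneous. -/
theorem pr_tprod_const {δ : ZMod 2} {v : M} (h : pr k δ v = v) (ε : ZMod 2) :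
    (pr k ε (PiTensorProduct.tprod k fun _ : Fin d => v) : TPow k M d) =
      if ε = ∑ _i : Fin d, δ then PiTensorProduct.tprod k fun _ : Fin d => v else 0 :=
  pr_tprod (α := fun _ => δ) (fun _ => h) ε

theorem pr_signedPow {δ : ZMod 2} {f : M →ₗ[k] N} (h : pr k δ f = f) (ε : ZMod 2)
    (x : TPow k M d) :
    (pr k (ε + ∑ _i : Fin d, δ) (signedPow f d x) : TPow k N d) = signedPow f d (pr k ε x) := by
  rw [signedPow, pr_tbilin isEvenBilin_eval, Finset.sum_eq_single ε]
  · have e : ∀ a b : ZMod 2, a + b + a = b := by decide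
    rw [pr_tprod_const h, e, if_pos rfl]
  · intro β _ hβ
    have e : ∀ a b c : ZMod 2, a + b + c = b → c = a := by decide
    rw [pr_tprod_const h, if_neg (fun h' => hβ (e _ _ _ h')), map_zero, LinearMap.zero_apply]
  · simp

/-- The tensor power of an odd map commutes with permutations up to the sign of the permutation. -/
theorem tperm_signedPow {f : M →ₗ[k] N} (h : pr k 1 f = f) (σ : Equiv.Perm (Fin d))
    (x : TPow k M d) :
    tperm σ (signedPow f d x) =
      koszul k (invCharge (fun _ => 1) σ) • signedPow f d (tperm σ x) := by
  rw [signedPow, tbilin_tperm isEvenBilin_eval, tperm_tprod σ (ε := fun _ => 1) fun _ => h,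
    map_smul]
  rfl

theorem isGraded_schurSub : IsGraded (schurSub k lam M) := by
  intro ε y hy
  obtain ⟨x, hx, rfl⟩ := mem_schurSub.1 hy
  have e : ∀ a b : ZMod 2, a = a + b + b := by decide
  rw [pr_mkQ, pr_tperm, e ε (∑ _i : Fin lam.card, 1), pr_signedPow (pr_parTo k M)]
  exact mem_schurSub.2 ⟨_, fun σ hσ => by rw [← pr_tperm, hx σ hσ], rfl⟩

instance schurSuperSpace : SuperSpace k (schurSub k lam M) :=
  SuperSpace.sub _ isGraded_schurSub

theorem signedPow_toPar_parTo (x : TPow k M d) :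
    signedPow (parTo k M) d (signedPow (toPar k M) d x) =
      koszul k (charge (d := d) (fun _ => 1) (fun _ => 1)) • x := by
  refine LinearMap.congr_fun (f := signedPow (parTo k M) d ∘ₗ signedPow (toPar k M) d)
    (g := koszul k (charge (d := d) (fun _ => 1) (fun _ => 1)) • LinearMap.id)
    (homog_ext fun ε v h => ?_) x
  have h1 : ∀ i, pr k (((fun _ => 1 : Fin d → ZMod 2) + ε) i) (toPar k M (v i)) = toPar k M (v i) :=
    fun i => pr_apply_of_homog (pr_toPar k M) (h i)
  have h2 : (fun _ : Fin d => (1 : ZMod 2)) + ((fun _ => 1) + ε) = ε := by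
    funext i
    have e : ∀ a : ZMod 2, 1 + (1 + a) = a := by decide
    exact e _
  rw [LinearMap.comp_apply, signedPow, signedPow,
    tbilin_tprod _ (φ := fun _ => 1) (fun _ => pr_toPar k M) h, map_smul]
  simp only [LinearMap.id_apply]
  rw [tbilin_tprod (LinearMap.id : (Par M →ₗ[k] M) →ₗ[k] Par M →ₗ[k] M) (φ := fun _ => 1)
      (fun _ => pr_parTo k M) h1, smul_smul, ← koszul_add,
    ← charge_assoc]
  have h3 : charge ((fun _ : Fin d => (1 : ZMod 2)) + fun _ => 1) ε = 0 := by
    have e : (1 + 1 : ZMod 2) = 0 := rfl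
    simp [charge, e]
  rw [h3, add_zero]
  rfl

variable {V W : CliffMod k 0}

/-- The action of `Γ^d Hom(V, W)` on tensors. -/
def gamAct (d : ℕ) (f : Gam k (CHom V W) d) : TPow k V.carrier d →ₗ[k] TPow k W.carrier d :=
  tbilin (cliffEval V W) d f.1

theorem tperm_gamAct (f : Gam k (CHom V W) d) (σ : Equiv.Perm (Fin d)) (x : TPow k V.carrier d) :
    tperm σ (gamAct d f x) = gamAct d f (tperm σ x) := by
  rw [gamAct, tbilin_tperm (isEvenBilin_cliffEval V W), f.2]

theorem coe_pr_gam (ε : ZMod 2) (f : Gam k M d) :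
    ((pr k ε f : Gam k M d) : TPow k M d) = pr k ε f.1 := rfl

theorem pr_gamAct (f : Gam k (CHom V W) d) (ε δ : ZMod 2) (x : TPow k V.carrier d) :
    (pr k (ε + δ) (gamAct d f (pr k δ x)) : TPow k W.carrier d) =
      gamAct d (pr k ε f) (pr k δ x) := by
  rw [gamAct, gamAct, pr_tbilin (isEvenBilin_cliffEval V W), Finset.sum_eq_single δ]
  · have e : ε + δ + δ = ε := by revert ε δ; decide
    rw [pr_self, e, coe_pr_gam]
  · intro β _ hβ
    rw [pr_pr, if_neg hβ, map_zero]
  · simp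

theorem gamAct_id (x : TPow k V.carrier d) : gamAct d (gamId V d) x = x := by
  refine LinearMap.congr_fun (f := gamAct d (gamId V d)) (g := LinearMap.id)
    (homog_ext fun ε v h => ?_) x
  rw [gamAct, gamId, tbilin_tprod _ (φ := fun _ => 0) (fun _ => pr_cliffId V) h]
  simp [charge, koszul_zero, cliffEval, cliffId]

theorem gamAct_comp {U : CliffMod k 0} (f : Gam k (CHom V W) d) (g : Gam k (CHom U V) d)
    (x : TPow k U.carrier d) : gamAct d (gamComp f g) x = gamAct d f (gamAct d g x) :=
  tbilin_assoc (isEvenBilin_cliffComp U V W) (isEvenBilin_cliffEval U V)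
    (fun _ _ _ => rfl) f.1 g.1 x

theorem gamAct_symKer (f : Gam k (CHom V W) lam.card) :
    symKer k lam V.carrier ≤ (symKer k lam W.carrier).comap (gamAct lam.card f) := by
  rw [symKer, Submodule.span_le]
  rintro _ ⟨σ, x, hσ, rfl⟩
  exact Submodule.subset_span ⟨σ, gamAct _ f x, hσ, by rw [map_sub, tperm_gamAct]⟩

/-- The action of `Γ^d Hom(V, W)` on the symmetric powers. -/
def symAct (lam : YoungDiagram) (f : Gam k (CHom V W) lam.card) :
    SymPow k lam V.carrier →ₗ[k] SymPow k lam W.carrier :=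
  (symKer k lam V.carrier).mapQ (symKer k lam W.carrier) (gamAct lam.card f) (gamAct_symKer f)

theorem symAct_mkQ (f : Gam k (CHom V W) lam.card) (x : TPow k V.carrier lam.card) :
    symAct lam f ((symKer k lam V.carrier).mkQ x) =
      (symKer k lam W.carrier).mkQ (gamAct lam.card f x) := rfl

theorem symAct_id (y : SymPow k lam V.carrier) : symAct lam (gamId V lam.card) y = y := by
  obtain ⟨x, rfl⟩ := (symKer k lam V.carrier).mkQ_surjective y
  rw [symAct_mkQ, gamAct_id]

theorem symAct_comp {U : CliffMod k 0} (f : Gam k (CHom V W) lam.card)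
    (g : Gam k (CHom U V) lam.card) (y : SymPow k lam U.carrier) :
    symAct lam (gamComp f g) y = symAct lam f (symAct lam g y) := by
  obtain ⟨x, rfl⟩ := (symKer k lam U.carrier).mkQ_surjective y
  rw [symAct_mkQ, symAct_mkQ, symAct_mkQ, gamAct_comp]

theorem symAct_schurSub (f : Gam k (CHom V W) lam.card) :
    ∀ y ∈ schurSub k lam V.carrier, symAct lam f y ∈ schurSub k lam W.carrier := by
  intro y hy
  obtain ⟨x, hx, rfl⟩ := mem_schurSub.1 hy
  set z := gamAct lam.card f (signedPow (parTo k V.carrier) lam.card x) with hz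
  refine mem_schurSub.2
    ⟨koszul k (charge (d := lam.card) (fun _ => 1) (fun _ => 1)) •
      signedPow (toPar k W.carrier) lam.card z, fun σ hσ => ?_, ?_⟩
  · rw [map_smul, tperm_signedPow (pr_toPar k _), hz, tperm_gamAct,
      tperm_signedPow (pr_parTo k _), hx σ hσ, map_smul, map_smul,
      smul_smul (koszul k (invCharge _ σ)), koszul_mul_self, one_smul]
  · rw [map_smul, signedPow_toPar_parTo, smul_smul, koszul_mul_self, one_smul, symAct_mkQ,
      ← tperm_gamAct]

end Schur

/-- The Schur superfunctor `Ŝ_λ` of type I. -/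
def schurI (k : Type u) [Field k] (lam : YoungDiagram) : PolFunctor k 0 lam.card where
  obj V := { carrier := schurSub k lam V.carrier }
  map V W :=
    { toFun := fun f => (symAct lam f).restrict (symAct_schurSub f)
      map_add' := fun f g => by
        ext ⟨y, hy⟩
        obtain ⟨x, rfl⟩ := (symKer k lam V.carrier).mkQ_surjective y
        change (symKer k lam W.carrier).mkQ (gamAct _ (f + g) x) =
          (symKer k lam W.carrier).mkQ (gamAct _ f x) + (symKer k lam W.carrier).mkQ (gamAct _ g x)
        rw [← map_add]
        simp [gamAct]
      map_smul' := fun a f => by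
        ext ⟨y, hy⟩
        obtain ⟨x, rfl⟩ := (symKer k lam V.carrier).mkQ_surjective y
        change (symKer k lam W.carrier).mkQ (gamAct _ (a • f) x) =
          a • (symKer k lam W.carrier).mkQ (gamAct _ f x)
        rw [← map_smul]
        simp [gamAct] }
  map_even V W ε f := by
    ext ⟨y, hy⟩
    rw [pr_hom_apply]
    obtain ⟨x, rfl⟩ := (symKer k lam V.carrier).mkQ_surjective y
    rw [AddSubmonoidClass.coe_finsetSum]
    change (symKer k lam W.carrier).mkQ (gamAct _ (pr k ε f) x) =
      ∑ δ, (symKer k lam W.carrier).mkQ (pr k (ε + δ) (gamAct _ f (pr k δ x)))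
    rw [← map_sum]
    congr 1
    simp only [pr_gamAct]
    rw [← map_sum, sum_pr]
  map_id V := LinearMap.ext fun y => Subtype.ext (symAct_id y.1)
  map_comp U V W f g := LinearMap.ext fun y => Subtype.ext (symAct_comp f g y.1)

/-- The Schur superfunctor `Ŝ_λ^II` of type II. -/
def schurII (k : Type u) [Field k] (lam : YoungDiagram) : PolFunctor k 1 lam.card :=
  (schurI k lam).res 1

/-! ### The supermodules `k^(m|n)` and `V_n`, weight idempotents, formal characters -/

section Characters

/-- The space of families `ι → k` with the grading in which the `i`-th basis vector has degree
`p i`. -/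
@[reducible] def piSuperSpace (k : Type u) [Field k] {ι : Type} (p : ι → ZMod 2) :
    SuperSpace k (ι → k) where
  proj ε := LinearMap.pi fun i => if p i = ε then LinearMap.proj i else 0
  proj_proj ε δ v := by
    funext i
    by_cases h1 : p i = ε <;> by_cases h2 : p i = δ <;> by_cases h3 : ε = δ <;> simp_all
  proj_add v := by
    funext i
    rcases zmod2_cases (p i) with h | h <;> simp [h]

theorem piSuperSpace_apply (k : Type u) [Field k] {ι : Type} (p : ι → ZMod 2) (ε : ZMod 2)
    (v : ι → k) (i : ι) : (piSuperSpace k p).proj ε v i = if p i = ε then v i else 0 := by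
  change (if p i = ε then LinearMap.proj i else 0 : (ι → k) →ₗ[k] k) v = _
  split_ifs <;> rfl

/-- The parity of the basis `X_1, …, X_m, Y_1, …, Y_n` of `k^(m|n)`. -/
def parity (m n : ℕ) : Fin m ⊕ Fin n → ZMod 2 := Sum.elim (fun _ => 0) fun _ => 1

/-- The superspace `k^(m|n)`. -/
def kmn (k : Type u) [Field k] (m n : ℕ) : CliffMod k 0 where
  carrier := Fin m ⊕ Fin n → k
  superSpace := piSuperSpace k (parity m n)
  c := Fin.elim0
  c_odd i := i.elim0
  c_sq i := i.elim0
  c_anticomm i := i.elim0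

/-- The right `𝒞_1`-supermodule `V_n = (𝒞_1)^n`: the superspace `k^(n|n)`, with
`X_i c = Y_i` and `Y_i c = X_i`. -/
def Vn (k : Type u) [Field k] (n : ℕ) : CliffMod k 1 where
  carrier := Fin n ⊕ Fin n → k
  superSpace := piSuperSpace k (parity n n)
  c _ := LinearMap.funLeft k k Sum.swap
  c_odd _ ε v := by
    funext i
    rw [LinearMap.funLeft_apply]
    refine (piSuperSpace_apply k _ _ _ _).trans (Eq.trans ?_ (piSuperSpace_apply k _ _ _ _).symm)
    rcases i with i | i <;> rcases zmod2_cases ε with rfl | rfl <;>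
      simp [parity, LinearMap.funLeft_apply, show (1 + 1 : ZMod 2) = 0 from rfl]
  c_sq _ v := by
    funext i
    simp [LinearMap.funLeft_apply]
  c_anticomm i j h := absurd (Subsingleton.elim i j) h

variable {k : Type u} [Field k]

/-- The matrix unit `E_(i,i)`. -/
def matUnit (k : Type u) [Field k] {ι : Type} [DecidableEq ι] (i : ι) : (ι → k) →ₗ[k] ι → k :=
  LinearMap.single k (fun _ => k) i ∘ₗ LinearMap.proj i

/-- `E_(i,i) ∈ End(k^(m|n))`. -/
def unitS (k : Type u) [Field k] {m n : ℕ} (i : Fin m ⊕ Fin n) : CHom (kmn k m n) (kmn k m n) :=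
  ⟨matUnit k i, fun j => j.elim0⟩

theorem matUnit_swap {n : ℕ} (i : Fin n) (v : Fin n ⊕ Fin n → k) :
    (matUnit k (Sum.inl i) + matUnit k (Sum.inr i) :
        (Fin n ⊕ Fin n → k) →ₗ[k] Fin n ⊕ Fin n → k) (LinearMap.funLeft k k Sum.swap v) =
      LinearMap.funLeft k k Sum.swap ((matUnit k (Sum.inl i) + matUnit k (Sum.inr i) :
        (Fin n ⊕ Fin n → k) →ₗ[k] Fin n ⊕ Fin n → k) v) := by
  funext j
  rcases j with j | j <;> simp [matUnit, LinearMap.funLeft_apply, Pi.single_apply]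

/-- `E_(0;i,i) = E_(i,i) + E_(n+i,n+i) ∈ End_{𝒞_1}(V_n)`. -/
def unitQ (k : Type u) [Field k] {n : ℕ} (i : Fin n) : CHom (Vn k n) (Vn k n) :=
  ⟨matUnit k (Sum.inl i) + matUnit k (Sum.inr i), fun _ v => matUnit_swap i v⟩

/-- The weight of a word `i : Fin d → ι`; `wordWeight i s` is the number of times that `s` occurs
in `i`. -/
def wordWeight {ι : Type} {d : ℕ} (i : Fin d → ι) : ι →₀ ℕ := ∑ s, Finsupp.single (i s) 1

theorem wordWeight_perm {ι : Type} {d : ℕ} (i : Fin d → ι) (σ : Equiv.Perm (Fin d)) :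
    wordWeight (i ∘ σ) = wordWeight i :=
  Equiv.sum_comp σ fun s => Finsupp.single (i s) 1

variable {r d : ℕ}

open scoped Classical in
/-- The weight idempotent of weight `μ` for a family `e` of even endomorphisms of `V`:
the sum of `e_(i₁) ⊗ ⋯ ⊗ e_(i_d)` over all words `i` of weight `μ`. -/
def weightIdem {V : CliffMod k r} {ι : Type} [Fintype ι] (e : ι → CHom V V)
    (he : ∀ i, pr k 0 (e i) = e i) (d : ℕ) (μ : ι →₀ ℕ) : Gam k (CHom V V) d :=
  ⟨∑ i : Fin d → ι with wordWeight i = μ, PiTensorProduct.tprod k fun s => e (i s), fun σ => by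
    rw [map_sum]
    simp only [tperm_tprod_even σ fun s => he _]
    refine Finset.sum_equiv (Equiv.arrowCongr σ.symm (Equiv.refl ι)) (fun i => ?_) fun i _ => rfl
    simp only [Finset.mem_filter, Finset.mem_univ, true_and]
    rw [← wordWeight_perm i σ]
    rfl⟩

/-- The formal character `∑_μ dim(W_μ) z^μ` of a supermodule `W` over `Γ^d End_{𝒞_r}(V)`, where `μ`
runs over the weights with `|μ| = d`, and `W_μ` is the image of the weight idempotent of
weight `μ`. -/
def formalCh {V : CliffMod k r} {ι : Type} [Fintype ι] [DecidableEq ι] (e : ι → CHom V V)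
    (he : ∀ i, pr k 0 (e i) = e i) (W : SchurMod V d) : MvPolynomial ι ℤ :=
  ∑ μ ∈ Finset.univ.finsuppAntidiag d, MvPolynomial.monomial μ
    (Module.finrank k (LinearMap.range (W.act (weightIdem e he d μ))) : ℤ)

theorem pr_piSuperSpace_matUnit {ι : Type} [DecidableEq ι] (p : ι → ZMod 2) (i : ι) :
    letI := piSuperSpace k p
    pr k 0 (matUnit k i) = matUnit k i := by
  let _ := piSuperSpace k p
  refine LinearMap.ext fun v => ?_
  rw [pr_hom_apply]
  funext j
  rw [sum_zmod2, Pi.add_apply, piSuperSpace_apply, piSuperSpace_apply]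
  by_cases h : j = i
  · subst h
    rcases zmod2_cases (p j) with h' | h' <;> simp [piSuperSpace_apply, matUnit, h']
  · rcases zmod2_cases (p j) with h' | h' <;> simp [matUnit, h', h]

theorem pr_unitS {m n : ℕ} (i : Fin m ⊕ Fin n) : pr k 0 (unitS k i) = unitS k i :=
  Subtype.ext (pr_piSuperSpace_matUnit (parity m n) i)

theorem pr_piSuperSpace_add {ι : Type} (p : ι → ZMod 2) (f g : (ι → k) →ₗ[k] ι → k)
    (hf : (let _ := piSuperSpace k p; pr k 0 f = f)) (hg : (let _ := piSuperSpace k p; pr k 0 g = g)) :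
    let _ := piSuperSpace k p
    pr k 0 (f + g) = f + g := by
  let _ := piSuperSpace k p
  change pr k 0 (f + g) = f + g
  rw [map_add]
  exact congrArg₂ (· + ·) hf hg

theorem pr_unitQ {n : ℕ} (i : Fin n) : pr k 0 (unitQ k i) = unitQ k i :=
  Subtype.ext (pr_piSuperSpace_add (parity n n) (matUnit k (Sum.inl i)) (matUnit k (Sum.inr i))
    (pr_piSuperSpace_matUnit _ _) (pr_piSuperSpace_matUnit _ _))

/-- The formal character of a supermodule over the Schur superalgebra
`S(m|n,d) = Γ^d End(k^(m|n))`, a polynomial in `x_1, …, x_m` and `y_1, …, y_n`. -/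
def chS {m n : ℕ} (W : SchurMod (kmn k m n) d) : MvPolynomial (Fin m ⊕ Fin n) ℤ :=
  formalCh (unitS k) pr_unitS W

/-- The formal character of a supermodule over the Schur superalgebra
`Q(n,d) = Γ^d End_{𝒞_1}(V_n)`, a polynomial in `x_1, …, x_n`. -/
def chQ {n : ℕ} (W : SchurMod (Vn k n) d) : MvPolynomial (Fin n) ℤ :=
  formalCh (unitQ k) pr_unitQ W

theorem coeff_formalCh {V : CliffMod k r} {ι : Type} [Fintype ι] [DecidableEq ι]
    (e : ι → CHom V V) (he : ∀ i, pr k 0 (e i) = e i) (W : SchurMod V d) (μ : ι →₀ ℕ) :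
    (formalCh e he W).coeff μ = if μ.degree = d then
      (Module.finrank k (LinearMap.range (W.act (weightIdem e he d μ))) : ℤ) else 0 := by
  rw [formalCh, MvPolynomial.coeff_sum]
  simp only [MvPolynomial.coeff_monomial]
  rw [Finset.sum_ite_eq' (Finset.univ.finsuppAntidiag d) μ]
  have : μ ∈ Finset.univ.finsuppAntidiag d ↔ μ.degree = d := by
    rw [Finset.mem_finsuppAntidiag, Finsupp.degree_eq_sum]
    simp
  simp only [this]

theorem isHomogeneous_formalCh {V : CliffMod k r} {ι : Type} [Fintype ι] [DecidableEq ι]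
    (e : ι → CHom V V) (he : ∀ i, pr k 0 (e i) = e i) (W : SchurMod V d) :
    (formalCh e he W).IsHomogeneous d := by
  intro μ hμ
  rw [coeff_formalCh] at hμ
  change Finsupp.weight (fun _ => 1) μ = d
  rw [← Finsupp.degree_eq_weight_one]
  by_contra h
  exact hμ (if_neg h)

theorem degree_mapDomain_eq {ι ι' : Type} (j : ι → ι') (μ : ι →₀ ℕ) :
    (μ.mapDomain j).degree = μ.degree := by
  simp only [Finsupp.degree_eq_weight_one, Finsupp.weight_apply]
  rw [Finsupp.sum_mapDomain_index] <;> simp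

theorem wordWeight_comp {ι ι' : Type} (j : ι → ι') (i : Fin d → ι) :
    wordWeight (j ∘ i) = (wordWeight i).mapDomain j := by
  simp [wordWeight, Finsupp.mapDomain_finsetSum, Finsupp.mapDomain_single]

theorem wordWeight_ne_zero {ι : Type} (i : Fin d → ι) (s : Fin d) : wordWeight i (i s) ≠ 0 := by
  rw [wordWeight, Finsupp.finsetSum_apply]
  intro h
  have := (Finset.sum_eq_zero_iff.1 h) s (Finset.mem_univ s)
  simp at this

theorem gamComp_tprod {U V W : CliffMod k r} {f : Fin d → CHom V W} {g : Fin d → CHom U V}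
    (hf : ∀ i, pr k 0 (f i) = f i) (hg : ∀ i, pr k 0 (g i) = g i) :
    tbilin (cliffComp U V W) d (PiTensorProduct.tprod k f) (PiTensorProduct.tprod k g) =
      PiTensorProduct.tprod k fun i => cliffComp U V W (f i) (g i) := by
  rw [tbilin_tprod _ (φ := fun _ => 0) (ε := fun _ => 0) hf hg]
  simp [charge, koszul_zero]

/-- The `d`-th power of an even homomorphism, as a morphism of `Γ^d(smod 𝒞_r)`. -/
def gamPow {V W : CliffMod k r} (f : CHom V W) (hf : pr k 0 f = f) (d : ℕ) :
    Gam k (CHom V W) d :=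
  ⟨PiTensorProduct.tprod k fun _ => f, fun σ => tperm_tprod_even σ fun _ => hf⟩

theorem weightIdem_conj {V V' : CliffMod k r} {ι ι' : Type} [Fintype ι] [Fintype ι']
    (e : ι → CHom V V) (he : ∀ i, pr k 0 (e i) = e i)
    (e' : ι' → CHom V' V') (he' : ∀ i, pr k 0 (e' i) = e' i) {j : ι → ι'}
    (hj : Function.Injective j) (a : CHom V V') (ha : pr k 0 a = a) (b : CHom V' V)
    (hb : pr k 0 b = b)
    (h : ∀ i, cliffComp V' V V' (cliffComp V V V' a (e i)) b = e' (j i)) (μ : ι →₀ ℕ) :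
    gamComp (gamComp (gamPow a ha d) (weightIdem e he d μ)) (gamPow b hb d) =
      weightIdem e' he' d (μ.mapDomain j) := by
  classical
  refine Subtype.ext ?_
  change tbilin (cliffComp V' V V') d (tbilin (cliffComp V V V') d
    (PiTensorProduct.tprod k fun _ => a)
    (∑ i : Fin d → ι with wordWeight i = μ, PiTensorProduct.tprod k fun s => e (i s)))
    (PiTensorProduct.tprod k fun _ => b) =
    ∑ i : Fin d → ι' with wordWeight i = μ.mapDomain j, PiTensorProduct.tprod k fun s => e' (i s)
  have hae : ∀ i, pr k 0 (cliffComp V V V' a (e i)) = cliffComp V V V' a (e i) :=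
    fun i => isEvenBilin_cliffComp V V V' 0 0 a (e i) ha (he i)
  rw [map_sum, map_sum, LinearMap.sum_apply]
  refine Finset.sum_bij (fun i _ => j ∘ i) ?_ ?_ ?_ ?_
  · intro i hi
    simp only [Finset.mem_filter, Finset.mem_univ, true_and] at hi ⊢
    rw [wordWeight_comp, hi]
  · intro i _ i' _ hii
    funext s
    exact hj (congrFun hii s)
  · intro i' hi'
    simp only [Finset.mem_filter, Finset.mem_univ, true_and] at hi'
    have hr : ∀ s, ∃ i, j i = i' s := by
      intro s
      by_contra hn
      have := wordWeight_ne_zero i' s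
      rw [hi'] at this
      exact this (Finsupp.mapDomain_of_notMem_range _ _ (fun ⟨i, hi⟩ => hn ⟨i, hi⟩))
    choose i hi using hr
    have hi2 : j ∘ i = i' := funext hi
    refine ⟨i, ?_, hi2⟩
    simp only [Finset.mem_filter, Finset.mem_univ, true_and]
    rw [← hi2, wordWeight_comp] at hi'
    exact Finsupp.mapDomain_injective hj hi'
  · intro i _
    rw [gamComp_tprod (fun _ => ha) (fun _ => he _), gamComp_tprod (fun _ => hae _) (fun _ => hb)]
    simp only [h, Function.comp_apply]

theorem finrank_range_conj {A B : Type u} [AddCommGroup A] [Module k A] [AddCommGroup B]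
    [Module k B] (f : A →ₗ[k] B) (g : B →ₗ[k] A) (h : g ∘ₗ f = LinearMap.id) (e : A →ₗ[k] A) :
    Module.finrank k (LinearMap.range ((f ∘ₗ e) ∘ₗ g)) = Module.finrank k (LinearMap.range e) := by
  have h1 : Function.LeftInverse g f := fun x => LinearMap.congr_fun h x
  rw [LinearMap.range_comp_of_range_eq_top _ (LinearMap.range_eq_top.2 h1.surjective),
    LinearMap.range_comp]
  exact (Submodule.equivMapOfInjective f h1.injective _).finrank_eq.symm

theorem killCompl_formalCh (T : PolFunctor k r d) {V V' : CliffMod k r} {ι ι' : Type} [Fintype ι]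
    [Fintype ι'] [DecidableEq ι] [DecidableEq ι']
    (e : ι → CHom V V) (he : ∀ i, pr k 0 (e i) = e i)
    (e' : ι' → CHom V' V') (he' : ∀ i, pr k 0 (e' i) = e' i) {j : ι → ι'}
    (hj : Function.Injective j) (a : CHom V V') (ha : pr k 0 a = a) (b : CHom V' V)
    (hb : pr k 0 b = b) (hba : cliffComp V V' V b a = cliffId V)
    (h : ∀ i, cliffComp V' V V' (cliffComp V V V' a (e i)) b = e' (j i)) :
    MvPolynomial.killCompl hj (formalCh e' he' (T.ev V')) = formalCh e he (T.ev V) := by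
  ext μ
  rw [MvPolynomial.coeff_killCompl, coeff_formalCh, coeff_formalCh, degree_mapDomain_eq]
  congr 2
  change Module.finrank k (LinearMap.range (T.map V' V' (weightIdem e' he' d (μ.mapDomain j)))) =
    Module.finrank k (LinearMap.range (T.map V V (weightIdem e he d μ)))
  rw [← weightIdem_conj e he e' he' hj a ha b hb h, T.map_comp, T.map_comp]
  refine finrank_range_conj _ _ ?_ _
  rw [← T.map_comp, ← T.map_id]
  congr 1
  refine Subtype.ext ?_
  change tbilin (cliffComp V V' V) d (PiTensorProduct.tprod k fun _ => b)
    (PiTensorProduct.tprod k fun _ => a) = PiTensorProduct.tprod k fun _ => cliffId V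
  rw [gamComp_tprod (fun _ => hb) (fun _ => ha), hba]

end Characters

/-! ### Inverse limits and characters of polynomial superfunctors -/

section Limits

variable {k : Type u} [Field k] {d : ℕ}

theorem pr_zero_of_comm {M N : Type u} [AddCommGroup M] [Module k M] [SuperSpace k M]
    [AddCommGroup N] [Module k N] [SuperSpace k N] (f : M →ₗ[k] N)
    (h : ∀ ε v, f (pr k ε v) = pr k ε (f v)) : pr k 0 f = f := by
  refine LinearMap.ext fun v => ?_
  rw [pr_hom_apply]
  simp only [zero_add, h, pr_self]
  exact sum_pr (f v)

theorem funLeft_even {ι ι' : Type} (p : ι → ZMod 2) (p' : ι' → ZMod 2) (j : ι → ι')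
    (hp : ∀ i, p' (j i) = p i) :
    let _ := piSuperSpace k p
    let _ := piSuperSpace k p'
    pr k 0 (LinearMap.funLeft k k j) = LinearMap.funLeft k k j := by
  let _ := piSuperSpace k p
  let _ := piSuperSpace k p'
  refine pr_zero_of_comm _ fun ε v => ?_
  funext i
  rw [LinearMap.funLeft_apply, piSuperSpace_apply, piSuperSpace_apply, hp, LinearMap.funLeft_apply]

theorem extend_even {ι ι' : Type} (p : ι → ZMod 2) (p' : ι' → ZMod 2) {j : ι → ι'}
    (hj : Function.Injective j) (hp : ∀ i, p' (j i) = p i) :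
    let _ := piSuperSpace k p
    let _ := piSuperSpace k p'
    pr k 0 (Function.ExtendByZero.linearMap k j) = Function.ExtendByZero.linearMap k j := by
  let _ := piSuperSpace k p
  let _ := piSuperSpace k p'
  refine pr_zero_of_comm _ fun ε v => ?_
  funext i'
  rw [piSuperSpace_apply]
  change Function.extend j (SuperSpace.proj ε v) 0 i' = if p' i' = ε then Function.extend j v 0 i' else 0
  by_cases h : ∃ i, j i = i'
  · obtain ⟨i, rfl⟩ := h
    rw [hj.extend_apply, hj.extend_apply, piSuperSpace_apply, hp]
  · rw [Function.extend_apply' _ _ _ h, Function.extend_apply' _ _ _ h]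
    simp

theorem funLeft_extend {ι ι' : Type} {j : ι → ι'} (hj : Function.Injective j) :
    LinearMap.funLeft k k j ∘ₗ Function.ExtendByZero.linearMap k j = LinearMap.id := by
  refine LinearMap.ext fun v => funext fun i => ?_
  exact hj.extend_apply v 0 i

theorem extend_matUnit_funLeft {ι ι' : Type} [DecidableEq ι] [DecidableEq ι'] {j : ι → ι'}
    (hj : Function.Injective j) (i : ι) :
    (Function.ExtendByZero.linearMap k j ∘ₗ matUnit k i) ∘ₗ LinearMap.funLeft k k j =
      matUnit k (j i) := by
  refine LinearMap.ext fun v => funext fun i' => ?_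
  change Function.extend j (Pi.single i (v (j i))) 0 i' = (Pi.single (j i) (v (j i)) : ι' → k) i'
  by_cases h : ∃ i, j i = i'
  · obtain ⟨i₂, rfl⟩ := h
    rw [hj.extend_apply, Pi.single_apply, Pi.single_apply]
    simp [hj.eq_iff]
  · rw [Function.extend_apply' _ _ _ h, Pi.single_apply, if_neg fun e => h ⟨i, e.symm⟩]
    rfl

/-- The variables `x_1, …, x_n` among `x_1, …, x_n'`. -/
abbrev jX {n n' : ℕ} (h : n ≤ n') : Fin n → Fin n' := Fin.castLE h

/-- The variables `x_1, …, x_m, y_1, …, y_n` among `x_1, …, x_m', y_1, …, y_n'`. -/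
abbrev jZ {m m' n n' : ℕ} (hm : m ≤ m') (hn : n ≤ n') : Fin m ⊕ Fin n → Fin m' ⊕ Fin n' :=
  Sum.map (Fin.castLE hm) (Fin.castLE hn)

theorem jX_injective {n n' : ℕ} (h : n ≤ n') : Function.Injective (jX h) := Fin.castLE_injective h

theorem jZ_injective {m m' n n' : ℕ} (hm : m ≤ m') (hn : n ≤ n') :
    Function.Injective (jZ hm hn) :=
  (Fin.castLE_injective hm).sumMap (Fin.castLE_injective hn)

theorem parity_jZ {m m' n n' : ℕ} (hm : m ≤ m') (hn : n ≤ n') (i : Fin m ⊕ Fin n) :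
    parity m' n' (jZ hm hn i) = parity m n i := by
  rcases i with i | i <;> rfl

/-- The inverse limit over `n` of the groups of homogeneous polynomials of degree `d` in
`x_1, …, x_n`, with respect to the maps setting the additional variables equal to zero. -/
def XLim (d : ℕ) : Type :=
  {f : ∀ n, MvPolynomial (Fin n) ℤ // (∀ n, (f n).IsHomogeneous d) ∧
    ∀ (n n' : ℕ) (h : n ≤ n'), MvPolynomial.killCompl (jX_injective h) (f n') = f n}

/-- The inverse limit over `m` and `n` of the groups of homogeneous polynomials of degree `d` in
`x_1, …, x_m` and `y_1, …, y_n`, with respect to the maps setting the additional variables equal to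
zero. -/
def ZLim (d : ℕ) : Type :=
  {f : ∀ m n, MvPolynomial (Fin m ⊕ Fin n) ℤ // (∀ m n, (f m n).IsHomogeneous d) ∧
    ∀ (m m' n n' : ℕ) (hm : m ≤ m') (hn : n ≤ n'),
      MvPolynomial.killCompl (jZ_injective hm hn) (f m' n') = f m n}

theorem killCompl_chS (T : PolFunctor k 0 d) {m m' n n' : ℕ} (hm : m ≤ m') (hn : n ≤ n') :
    MvPolynomial.killCompl (jZ_injective hm hn) (chS (T.ev (kmn k m' n'))) =
      chS (T.ev (kmn k m n)) := by
  have hp := parity_jZ hm hn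
  refine killCompl_formalCh T (unitS k) pr_unitS (unitS k) pr_unitS (jZ_injective hm hn)
    ⟨Function.ExtendByZero.linearMap k (jZ hm hn), fun i => i.elim0⟩
    (Subtype.ext (extend_even (parity m n) (parity m' n') (jZ_injective hm hn) hp))
    ⟨LinearMap.funLeft k k (jZ hm hn), fun i => i.elim0⟩
    (Subtype.ext (funLeft_even (parity m n) (parity m' n') (jZ hm hn) hp))
    (Subtype.ext (funLeft_extend (jZ_injective hm hn)))
    fun i => Subtype.ext (extend_matUnit_funLeft (jZ_injective hm hn) i)

theorem extend_swap {n n' : ℕ} (h : n ≤ n') (v : Fin n ⊕ Fin n → k) :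
    Function.ExtendByZero.linearMap k (jZ h h) (LinearMap.funLeft k k Sum.swap v) =
      LinearMap.funLeft k k Sum.swap (Function.ExtendByZero.linearMap k (jZ h h) v) := by
  have hj := jZ_injective h h
  have hs : ∀ i, (jZ h h i).swap = jZ h h i.swap := fun i => by rcases i with i | i <;> rfl
  funext i'
  change Function.extend (jZ h h) (fun i => v i.swap) 0 i' =
    Function.extend (jZ h h) v 0 i'.swap
  by_cases hi : ∃ i, jZ h h i = i'
  · obtain ⟨i, rfl⟩ := hi
    rw [hj.extend_apply, hs, hj.extend_apply]
  · rw [Function.extend_apply' _ _ _ hi, Function.extend_apply' _ _ _]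
    · rfl
    · rintro ⟨i, hi'⟩
      exact hi ⟨i.swap, by rw [← hs, hi', Sum.swap_swap]⟩

theorem killCompl_chQ (T : PolFunctor k 1 d) {n n' : ℕ} (h : n ≤ n') :
    MvPolynomial.killCompl (jX_injective h) (chQ (T.ev (Vn k n'))) = chQ (T.ev (Vn k n)) := by
  have hp := parity_jZ h h
  have hj := jZ_injective h h
  refine killCompl_formalCh T (unitQ k) pr_unitQ (unitQ k) pr_unitQ (jX_injective h)
    ⟨Function.ExtendByZero.linearMap k (jZ h h), fun _ v => extend_swap h v⟩
    (Subtype.ext (extend_even (parity n n) (parity n' n') hj hp))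
    ⟨LinearMap.funLeft k k (jZ h h), fun _ v => ?_⟩
    (Subtype.ext (funLeft_even (parity n n) (parity n' n') (jZ h h) hp))
    (Subtype.ext (funLeft_extend hj))
    fun i => Subtype.ext ?_
  · refine funext fun i => ?_
    rcases i with i | i <;> rfl
  · change (Function.ExtendByZero.linearMap k (jZ h h) ∘ₗ
      (matUnit k (Sum.inl i) + matUnit k (Sum.inr i))) ∘ₗ LinearMap.funLeft k k (jZ h h) =
      matUnit k (Sum.inl (jX h i)) + matUnit k (Sum.inr (jX h i))
    rw [LinearMap.comp_add, LinearMap.add_comp]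
    exact congrArg₂ (· + ·) (extend_matUnit_funLeft hj (Sum.inl i))
      (extend_matUnit_funLeft hj (Sum.inr i))

/-- The formal character of a polynomial superfunctor of type I: the family of the formal
characters of the `S(m|n,d)`-supermodules `T(k^(m|n))`. -/
def chI (T : PolFunctor k 0 d) : ZLim d :=
  ⟨fun m n => chS (T.ev (kmn k m n)), fun _ _ => isHomogeneous_formalCh _ _ _,
    fun _ _ _ _ hm hn => killCompl_chS T hm hn⟩

/-- The formal character of a polynomial superfunctor of type II: the family of the formal
characters of the `Q(n,d)`-supermodules `T(V_n)`. -/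
def chII (T : PolFunctor k 1 d) : XLim d :=
  ⟨fun n => chQ (T.ev (Vn k n)), fun _ => isHomogeneous_formalCh _ _ _,
    fun _ _ h => killCompl_chQ T h⟩

end Limits

/-! ### Schur functions, hook Schur functions and Hall–Littlewood symmetric functions -/

section SymmetricFunctions

/-- The fillings of the skew diagram `λ/μ` by elements of `{1, …, n}` which weakly increase along
rows and strictly increase down columns.  (Boxes are pairs (row, column).) -/
def IsSemistandard (lam mu : YoungDiagram) {n : ℕ} (T : ↥(lam.cells \ mu.cells) → Fin n) : Prop :=
  (∀ b c, b.1.1 = c.1.1 → b.1.2 < c.1.2 → T b ≤ T c) ∧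
    ∀ b c, b.1.2 = c.1.2 → b.1.1 < c.1.1 → T b < T c

open scoped Classical in
/-- The skew Schur function `s_(λ/μ)(x_1, …, x_n)`, for `μ ⊆ λ`. -/
def skewSchur (lam mu : YoungDiagram) (n : ℕ) : MvPolynomial (Fin n) ℤ :=
  ∑ T : ↥(lam.cells \ mu.cells) → Fin n with IsSemistandard lam mu T, ∏ b, MvPolynomial.X (T b)

/-- The Schur function `s_μ(x_1, …, x_n)`. -/
def schur (mu : YoungDiagram) (n : ℕ) : MvPolynomial (Fin n) ℤ := skewSchur mu ⊥ n

theorem finite_subdiagrams (lam : YoungDiagram) : (Set.Iic lam).Finite := by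
  refine Set.Finite.of_injOn (f := YoungDiagram.cells) (t := ↑lam.cells.powerset) ?_ ?_
    (Finset.finite_toSet _)
  · intro mu h
    exact Finset.mem_coe.2 (Finset.mem_powerset.2 h)
  · intro mu _ nu _ h
    exact YoungDiagram.ext h

/-- The partitions `μ ⊆ λ`. -/
def subdiagrams (lam : YoungDiagram) : Finset YoungDiagram := (finite_subdiagrams lam).toFinset

/-- The hook Schur function
`hs_λ(x_1, …, x_m; y_1, …, y_n) = ∑_{μ ⊆ λ} s_μ(x_1, …, x_m) s_(λ'/μ')(y_1, …, y_n)`. -/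
def hookSchur (lam : YoungDiagram) (m n : ℕ) : MvPolynomial (Fin m ⊕ Fin n) ℤ :=
  ∑ mu ∈ subdiagrams lam, MvPolynomial.rename Sum.inl (schur mu m) *
    MvPolynomial.rename Sum.inr (skewSchur lam.transpose mu.transpose n)

/-- The Hall–Littlewood symmetric function
`S_λ(x_1, …, x_n) = hs_λ(x_1, …, x_n; x_1, …, x_n)`. -/
def hallLittlewood (lam : YoungDiagram) (n : ℕ) : MvPolynomial (Fin n) ℤ :=
  MvPolynomial.rename (Sum.elim id id) (hookSchur lam n n)

theorem isHomogeneous_skewSchur (lam mu : YoungDiagram) (n : ℕ) :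
    (skewSchur lam mu n).IsHomogeneous (lam.cells \ mu.cells).card := by
  refine MvPolynomial.IsHomogeneous.sum _ _ _ fun T _ => ?_
  have := MvPolynomial.IsHomogeneous.prod Finset.univ (fun b => MvPolynomial.X (R := ℤ) (T b))
    (fun _ => 1) fun b _ => MvPolynomial.isHomogeneous_X ℤ (T b)
  simpa using this

theorem card_transpose (lam : YoungDiagram) : lam.transpose.card = lam.card := by
  refine Finset.card_bij (fun c _ => c.swap) ?_ ?_ ?_
  · intro c hc
    exact (YoungDiagram.mem_transpose).1 hc
  · intro c _ c' _ h
    exact Prod.swap_injective h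
  · intro c hc
    exact ⟨c.swap, YoungDiagram.mem_transpose.2 (by simpa using hc), Prod.swap_swap c⟩

theorem isHomogeneous_hookSchur (lam : YoungDiagram) (m n : ℕ) :
    (hookSchur lam m n).IsHomogeneous lam.card := by
  refine MvPolynomial.IsHomogeneous.sum _ _ _ fun mu hmu => ?_
  have hle : mu ≤ lam := by simpa [subdiagrams] using hmu
  have h1 := (isHomogeneous_skewSchur mu ⊥ m).rename_isHomogeneous (f := (Sum.inl : _ → Fin m ⊕ Fin n))
  have h2 := (isHomogeneous_skewSchur lam.transpose mu.transpose n).rename_isHomogeneous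
    (f := (Sum.inr : _ → Fin m ⊕ Fin n))
  have h3 : (mu.cells \ (⊥ : YoungDiagram).cells).card +
      (lam.transpose.cells \ mu.transpose.cells).card = lam.card := by
    have e1 : (lam.transpose.cells \ mu.transpose.cells).card = lam.card - mu.card := by
      rw [Finset.card_sdiff_of_subset (YoungDiagram.transpose_le_iff.2 hle)]
      exact congrArg₂ (· - ·) (card_transpose lam) (card_transpose mu)
    have e2 : mu.card ≤ lam.card := Finset.card_le_card hle
    rw [e1, YoungDiagram.cells_bot, Finset.sdiff_empty]
    exact Nat.add_sub_cancel' e2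
  rw [← h3]
  exact h1.mul h2

theorem isHomogeneous_hallLittlewood (lam : YoungDiagram) (n : ℕ) :
    (hallLittlewood lam n).IsHomogeneous lam.card :=
  (isHomogeneous_hookSchur lam n n).rename_isHomogeneous

theorem killCompl_X_range {ι ι' : Type} {j : ι → ι'} (hj : Function.Injective j) (i : ι) :
    MvPolynomial.killCompl hj (MvPolynomial.X (R := ℤ) (j i)) = MvPolynomial.X i := by
  rw [← MvPolynomial.rename_X, MvPolynomial.killCompl_rename_app]

theorem killCompl_X_notMem {ι ι' : Type} {j : ι → ι'} (hj : Function.Injective j) {i' : ι'}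
    (h : i' ∉ Set.range j) :
    MvPolynomial.killCompl hj (MvPolynomial.X (R := ℤ) i') = 0 := by
  classical
  rw [MvPolynomial.killCompl, MvPolynomial.aeval_X, dif_neg h]

theorem killCompl_skewSchur (lam mu : YoungDiagram) {n n' : ℕ} (h : n ≤ n') :
    MvPolynomial.killCompl (jX_injective h) (skewSchur lam mu n') = skewSchur lam mu n := by
  classical
  rw [skewSchur, skewSchur, map_sum]
  symm
  refine Finset.sum_of_injOn (fun T => jX h ∘ T) ?_ ?_ ?_ ?_
  · intro T _ T' _ hT
    funext b
    exact jX_injective h (congrFun hT b)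
  · intro T hT
    simp only [Finset.coe_filter, Finset.mem_univ, true_and, Set.mem_ofPred_eq] at hT ⊢
    exact hT
  · intro T hT hT'
    have : ∃ b, T b ∉ Set.range (jX h) := by
      by_contra hcon
      push Not at hcon
      choose T₀ hT₀ using hcon
      have e : jX h ∘ T₀ = T := funext hT₀
      refine hT' ⟨T₀, ?_, e⟩
      simp only [Finset.mem_filter, Finset.mem_univ, true_and, Finset.coe_filter,
        Set.mem_ofPred_eq] at hT ⊢
      rw [← e] at hT
      exact hT
    obtain ⟨b, hb⟩ := this
    rw [map_prod]
    exact Finset.prod_eq_zero (Finset.mem_univ b) (killCompl_X_notMem _ hb)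
  · intro T _
    rw [map_prod]
    exact Finset.prod_congr rfl fun b _ => (killCompl_X_range (jX_injective h) (T b)).symm

theorem killCompl_rename {ι ι' κ κ' : Type} {j : ι → ι'} (hj : Function.Injective j) {l : κ → κ'}
    (hl : Function.Injective l) (f : ι → κ) (f' : ι' → κ') (h : ∀ i, f' (j i) = l (f i))
    (h' : ∀ i', i' ∉ Set.range j → f' i' ∉ Set.range l) (p : MvPolynomial ι' ℤ) :
    MvPolynomial.killCompl hl (MvPolynomial.rename f' p) =
      MvPolynomial.rename f (MvPolynomial.killCompl hj p) := by
  refine AlgHom.congr_fun (φ₁ := (MvPolynomial.killCompl hl).comp (MvPolynomial.rename f'))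
    (φ₂ := (MvPolynomial.rename f).comp (MvPolynomial.killCompl hj))
    (MvPolynomial.algHom_ext fun i' => ?_) p
  rw [AlgHom.comp_apply, AlgHom.comp_apply, MvPolynomial.rename_X]
  by_cases hi : i' ∈ Set.range j
  · obtain ⟨i, rfl⟩ := hi
    rw [h, killCompl_X_range, killCompl_X_range, MvPolynomial.rename_X]
  · rw [killCompl_X_notMem hj hi, killCompl_X_notMem hl (h' _ hi), map_zero]

theorem killCompl_hookSchur (lam : YoungDiagram) {m m' n n' : ℕ} (hm : m ≤ m') (hn : n ≤ n') :
    MvPolynomial.killCompl (jZ_injective hm hn) (hookSchur lam m' n') = hookSchur lam m n := by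
  rw [hookSchur, hookSchur, map_sum]
  refine Finset.sum_congr rfl fun mu _ => ?_
  rw [map_mul, killCompl_rename (jX_injective hm) (jZ_injective hm hn) Sum.inl Sum.inl
    (fun _ => rfl), killCompl_rename (jX_injective hn) (jZ_injective hm hn) Sum.inr Sum.inr
    (fun _ => rfl), schur, killCompl_skewSchur, killCompl_skewSchur, schur]
  · rintro i' hi' ⟨i | i, hi⟩
    · cases hi
    · exact hi' ⟨i, Sum.inr_injective hi⟩
  · rintro i' hi' ⟨i | i, hi⟩
    · exact hi' ⟨i, Sum.inl_injective hi⟩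
    · cases hi

theorem killCompl_hallLittlewood (lam : YoungDiagram) {n n' : ℕ} (h : n ≤ n') :
    MvPolynomial.killCompl (jX_injective h) (hallLittlewood lam n') = hallLittlewood lam n := by
  rw [hallLittlewood, hallLittlewood, killCompl_rename (jZ_injective h h) (jX_injective h)
    (Sum.elim id id), killCompl_hookSchur]
  · rintro (i | i) <;> rfl
  · rintro (i' | i') hi' ⟨i, hi⟩
    · exact hi' ⟨Sum.inl i, congrArg Sum.inl hi⟩
    · exact hi' ⟨Sum.inr i, congrArg Sum.inr hi⟩

/-- The hook Schur function `hs_λ(x; y)` in infinitely many variables, the inverse limit of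
the polynomials `hs_λ(x_1, …, x_m; y_1, …, y_n)`. -/
def hsLim (lam : YoungDiagram) : ZLim lam.card :=
  ⟨hookSchur lam, isHomogeneous_hookSchur lam, fun _ _ _ _ hm hn => killCompl_hookSchur lam hm hn⟩

/-- The Hall–Littlewood symmetric function `S_λ(x)` in infinitely many variables, the inverse limit
of the polynomials `S_λ(x_1, …, x_n)`. -/
def hallLittlewoodLim (lam : YoungDiagram) : XLim lam.card :=
  ⟨hallLittlewood lam, isHomogeneous_hallLittlewood lam,
    fun _ _ h => killCompl_hallLittlewood lam h⟩

end SymmetricFunctions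

end SchurSuper

end

/-!
The dimension of a weight space of `Ŝ_λ(V)` is the number of words of that weight that are
semistandard fillings of `λ`, where even letters may be repeated in rows only and odd letters in
columns only.  Indeed, `Ŝ_λ(V)` is the image in `S^λ V` of the tensors alternating along the columns
of `λ`, so a functional on it is a functional on `V^{⊗d}` that is invariant along the rows, modulo
those killing the alternating tensors.  A filling whose rows are sorted but which violates the
column order at two adjacent boxes gives a Garnir functional.  It kills the alternating tensors, by
pigeonhole on the columns, and its leading term is the coefficient of the filling itself: all the
others belong to fillings of larger energy, the sum over the boxes of the letter times the row
number.  So the coefficients of the semistandard words span the dual of `Ŝ_λ(V)`.  They are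
independent, since among the column rearrangements of a semistandard word the word itself has
maximal energy.  The weight idempotents multiply each of these coefficients by `0` or `1`.

Cutting a semistandard word in the letters `x₁ < ⋯ < x_m < y₁ < ⋯ < y_n` at the boxes holding some
`xᵢ` gives a semistandard filling of a diagram `μ ⊆ λ` and a transposed one of `λ'/μ'`, whence the
hook Schur function.  For `V_n` the weight idempotent of index `i` is the sum of those of `xᵢ` and
`yᵢ`, which identifies the two sets of variables.
-/

noncomputable section

open scoped Finset

namespace SchurSuper

universe u

section FiberPerms

variable {α β : Type*}

/-- The subgroup of the permutations of `α` that preserve the fibres of `c`. -/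
def fiberPerms (c : α → β) : Subgroup (Equiv.Perm α) where
  carrier := {σ | ∀ s, c (σ s) = c s}
  mul_mem' hσ hτ s := by rw [Equiv.Perm.mul_apply, hσ, hτ]
  one_mem' _ := rfl
  inv_mem' {σ} hσ s := by rw [← hσ, Equiv.Perm.coe_inv, σ.apply_symm_apply]

theorem mem_fiberPerms {c : α → β} {σ : Equiv.Perm α} :
    σ ∈ fiberPerms c ↔ ∀ s, c (σ s) = c s := Iff.rfl

theorem swap_mem_fiberPerms [DecidableEq α] {c : α → β} {a b : α} (h : c a = c b) :
    Equiv.swap a b ∈ fiberPerms c := by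
  intro s
  rw [Equiv.swap_apply_def]
  split_ifs with ha hb
  · rw [ha, h]
  · rw [hb, h]
  · rfl

theorem exists_fiberPerms_comp_eq_of_card [Fintype α] {ι : Type*} [DecidableEq β] [DecidableEq ι]
    {c : α → β} {v w : α → ι}
    (h : ∀ b i, Fintype.card {s // c s = b ∧ w s = i} = Fintype.card {s // c s = b ∧ v s = i}) :
    ∃ σ ∈ fiberPerms c, v ∘ σ = w := by
  have hcard (q : β × ι) : Fintype.card {s // (c s, w s) = q} =
      Fintype.card {s // (c s, v s) = q} := by
    simpa only [Prod.ext_iff] using h q.1 q.2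
  let σ : Equiv.Perm α := Equiv.ofFiberEquiv fun q => Fintype.equivOfCardEq (hcard q)
  have hσ (s) : (c (σ s), v (σ s)) = (c s, w s) :=
    Equiv.ofFiberEquiv_map (f := fun s => (c s, w s)) (g := fun s => (c s, v s)) _ s
  exact ⟨σ, fun s => (Prod.ext_iff.1 (hσ s)).1, funext fun s => (Prod.ext_iff.1 (hσ s)).2⟩

theorem card_filter_comp_and_eq [Fintype α] {ι : Type*} [DecidableEq β] [DecidableEq ι] {c : α → β}
    {v : α → ι} {g : Equiv.Perm α} {i₀ : ι} (h : ∀ s, v s ≠ i₀ → c (g s) = c s) (b : β) (i : ι) :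
    #{s | c (g s) = b ∧ v s = i} = #{s | c s = b ∧ v s = i} := by
  obtain hi | rfl := ne_or_eq i i₀
  · refine congrArg _ (Finset.filter_congr fun s _ => and_congr_left fun hs => ?_)
    rw [h s (hs ▸ hi)]
  have hfiber : #{s | c (g s) = b} = #{s | c s = b} := Finset.card_equiv g fun s => by simp
  have hrest : #{s | c (g s) = b ∧ ¬v s = i} = #{s | c s = b ∧ ¬v s = i} :=
    congrArg _ (Finset.filter_congr fun s _ => and_congr_left fun hs => by rw [h s hs])
  have hg := Finset.card_filter_add_card_filter_not (s := {s | c (g s) = b}) (fun s => v s = i)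
  have h1 := Finset.card_filter_add_card_filter_not (s := {s | c s = b}) (fun s => v s = i)
  simp only [Finset.filter_filter] at hg h1
  omega

theorem exists_fiberPerms_comp_eq [Finite α] {ι : Type*} {c : α → β} {v : α → ι}
    {g : Equiv.Perm α} {i₀ : ι} (h : ∀ s, v s ≠ i₀ → c (g s) = c s) :
    ∃ σ ∈ fiberPerms c, v ∘ σ = v ∘ g.symm := by
  classical
  have := Fintype.ofFinite α
  refine exists_fiberPerms_comp_eq_of_card fun b i => ?_
  rw [Fintype.card_subtype, Fintype.card_subtype, ← card_filter_comp_and_eq h]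
  exact Finset.card_equiv g.symm fun s => by simp

end FiberPerms

section FiberMonovary

variable {α β γ δ : Type*}

theorem exists_monotone_comp_equiv [Finite α] [LinearOrder γ] (f : α → γ) :
    ∃ e : Fin (Nat.card α) ≃ α, Monotone (f ∘ e) :=
  ⟨(Tuple.sort (f ∘ (Finite.equivFin α).symm)).trans (Finite.equivFin α).symm,
    Tuple.monotone_sort (f ∘ (Finite.equivFin α).symm)⟩

theorem exists_monovary_comp_perm [Finite α] [LinearOrder γ] [LinearOrder δ] (f : α → γ)
    (g : α → δ) : ∃ σ : Equiv.Perm α, Monovary (f ∘ σ) g := by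
  obtain ⟨e, he⟩ := exists_monotone_comp_equiv f
  obtain ⟨e', he'⟩ := exists_monotone_comp_equiv g
  refine ⟨e'.symm.trans e, fun s t hst => he (le_of_not_gt fun hlt => hst.not_ge ?_)⟩
  simpa using he' hlt.le

theorem comp_perm_eq_of_monovary [Finite α] [LinearOrder γ] [LinearOrder δ] {f : α → γ} {g : α → δ}
    (hg : Function.Injective g) {σ : Equiv.Perm α} (hf : Monovary f g)
    (hfσ : Monovary (f ∘ σ) g) : f ∘ σ = f := by
  obtain ⟨e, he⟩ := exists_monotone_comp_equiv g
  have hmono {f : α → γ} (hf : Monovary f g) : Monotone (f ∘ e) :=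
    monotone_iff_forall_lt.2 fun _ _ hst =>
      hf (he.strictMono_of_injective (hg.comp e.injective) hst)
  have h : (f ∘ e) ∘ (e.trans (σ.trans e.symm)) = (f ∘ e) ∘ (1 : Equiv.Perm (Fin (Nat.card α))) :=
    Tuple.unique_monotone (by simpa [Function.comp_def] using hmono hfσ) (hmono hf)
  funext s
  simpa using congrFun h (e.symm s)

/-- On each fibre of `c`, the function `f` monovaries with `g`. -/
def FiberMonovary [LE γ] [LT δ] (c : α → β) (f : α → γ) (g : α → δ) : Prop :=
  ∀ ⦃s t⦄, c s = c t → g s < g t → f s ≤ f t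

theorem FiberMonovary.le_of_le [Preorder γ] [PartialOrder δ] {c : α → β} {f : α → γ} {g : α → δ}
    (h : FiberMonovary c f g) (hcg : Function.Injective fun s => (c s, g s)) {s t : α}
    (hc : c s = c t) (hg : g s ≤ g t) : f s ≤ f t := by
  obtain heq | hlt := hg.eq_or_lt
  · rw [hcg (Prod.ext hc heq)]
  · exact h hc hlt

theorem FiberMonovary.monovary_toLex [LinearOrder β] [LinearOrder γ] [LinearOrder δ] {c : α → β}
    {f : α → γ} {g : α → δ} (h : FiberMonovary c f g) :
    Monovary (fun s => toLex (c s, f s)) fun s => toLex (c s, g s) := by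
  intro s t hst
  rw [Prod.Lex.toLex_le_toLex]
  exact (Prod.Lex.toLex_lt_toLex.1 hst).imp_right fun h' => ⟨h'.1, h h'.1 h'.2⟩

theorem FiberMonovary.comp_fiberPerms_eq [Finite α] [LinearOrder β] [LinearOrder γ] [LinearOrder δ]
    {c : α → β} {f : α → γ} {g : α → δ} (hcg : Function.Injective fun s => (c s, g s))
    {σ : Equiv.Perm α} (hσ : σ ∈ fiberPerms c) (h : FiberMonovary c f g)
    (h' : FiberMonovary c (f ∘ σ) g) : f ∘ σ = f := by
  have hlex : (fun s => toLex (c s, f s)) ∘ σ = fun s => toLex (c s, f s) :=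
    comp_perm_eq_of_monovary (toLex.injective.comp hcg) h.monovary_toLex
      (by simpa only [Function.comp_def, hσ _] using h'.monovary_toLex)
  exact funext fun s => (Prod.ext_iff.1 (toLex.injective (congrFun hlex s))).2

theorem exists_fiberMonovary_comp_perm [Finite α] [LinearOrder β] [LinearOrder γ] [LinearOrder δ]
    {c : α → β} (f : α → γ) {g : α → δ} (hcg : Function.Injective fun s => (c s, g s)) :
    ∃ σ ∈ fiberPerms c, FiberMonovary c (f ∘ σ) g := by
  obtain ⟨σ, hσ⟩ := exists_monovary_comp_perm (fun s => toLex (c s, f s)) fun s => toLex (c s, g s)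
  have hc : c ∘ σ = c := by
    refine comp_perm_eq_of_monovary (g := fun s => toLex (c s, g s)) (toLex.injective.comp hcg)
      (fun s t hst => Prod.Lex.monotone_fst _ _ hst.le) fun s t hst => ?_
    exact Prod.Lex.monotone_fst _ _ (hσ hst)
  refine ⟨σ, congrFun hc, fun s t hst hg => ?_⟩
  have hle := Prod.Lex.toLex_le_toLex.1 (hσ (Prod.Lex.toLex_lt_toLex.2 (Or.inr ⟨hst, hg⟩)))
  have hc' : c (σ s) = c (σ t) := ((congrFun hc s).trans hst).trans (congrFun hc t).symm
  exact (hle.resolve_left hc'.not_lt).2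

theorem sum_eq_sum_image_sum_fiber [Fintype α] [DecidableEq β] [AddCommMonoid γ] (c : α → β)
    (F : α → γ) : ∑ s, F s = ∑ b ∈ Finset.univ.image c, ∑ s : {s // c s = b}, F s := by
  rw [← Finset.sum_fiberwise_of_maps_to (g := c) fun s _ =>
    Finset.mem_image_of_mem c (Finset.mem_univ s)]
  exact Finset.sum_congr rfl fun b _ => Finset.sum_subtype _ (by simp) F

section Rearrangement

variable [Fintype α] [Semiring γ] [LinearOrder γ] [IsStrictOrderedRing γ] [ExistsAddOfLE γ]
  {c : α → β} {f g : α → γ} {σ : Equiv.Perm α}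

theorem FiberMonovary.sum_fiber_comp_perm_mul_le [DecidableEq β] (h : FiberMonovary c f g)
    (hσ : σ ∈ fiberPerms c) (b : β) :
    ∑ s : {s // c s = b}, f (σ s) * g s ≤ ∑ s : {s // c s = b}, f s * g s :=
  Monovary.sum_comp_perm_mul_le_sum_mul (f := fun s : {s // c s = b} => f s)
    (g := fun s => g s) (σ := σ.subtypePerm fun s => by rw [hσ s])
    fun s t hst => h (s.2.trans t.2.symm) hst

theorem FiberMonovary.sum_comp_perm_mul_le (h : FiberMonovary c f g) (hσ : σ ∈ fiberPerms c) :
    ∑ s, f (σ s) * g s ≤ ∑ s, f s * g s := by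
  classical
  rw [sum_eq_sum_image_sum_fiber c, sum_eq_sum_image_sum_fiber c fun s => f s * g s]
  exact Finset.sum_le_sum fun b _ => h.sum_fiber_comp_perm_mul_le hσ b

theorem FiberMonovary.comp_perm_of_sum_eq (h : FiberMonovary c f g) (hσ : σ ∈ fiberPerms c)
    (heq : ∑ s, f (σ s) * g s = ∑ s, f s * g s) : FiberMonovary c (f ∘ σ) g := by
  classical
  rw [sum_eq_sum_image_sum_fiber c, sum_eq_sum_image_sum_fiber c fun s => f s * g s,
    Finset.sum_eq_sum_iff_of_le fun b _ => h.sum_fiber_comp_perm_mul_le hσ b] at heq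
  intro s t hst hg
  have hfiber := (Monovary.sum_comp_perm_mul_eq_sum_mul_iff (f := fun s : {s // c s = c t} => f s)
    (g := fun s => g s) (σ := σ.subtypePerm fun s => by rw [hσ s])
    fun s t hst => h (s.2.trans t.2.symm) hst).1
    (heq (c t) (Finset.mem_image_of_mem c (Finset.mem_univ t)))
  exact hfiber (i := ⟨s, hst⟩) (j := ⟨t, rfl⟩) hg

end Rearrangement

end FiberMonovary

section Sign

variable {d : ℕ}

theorem sum_sum_eq_sum_lt {ι A : Type*} [Fintype ι] [LinearOrder ι] [AddCommMonoid A]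
    {f : ι → ι → A} (hf : ∀ s, f s s = 0) :
    ∑ s, ∑ t, f s t = ∑ s, ∑ t, if s < t then f s t + f t s else 0 := by
  have hsplit (s t : ι) : f s t = (if s < t then f s t else 0) + if t < s then f s t else 0 := by
    rcases lt_trichotomy s t with h | rfl | h
    · simp [h, h.not_gt]
    · simp [hf]
    · simp [h, h.not_gt]
  calc ∑ s, ∑ t, f s t
      = ∑ s, ∑ t, ((if s < t then f s t else 0) + if t < s then f s t else 0) :=
        Finset.sum_congr rfl fun s _ => Finset.sum_congr rfl fun t _ => hsplit s t
    _ = ∑ s, ∑ t, (if s < t then f s t else 0) + ∑ s, ∑ t, if s < t then f t s else 0 := by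
        simp only [Finset.sum_add_distrib]
        rw [Finset.sum_comm (f := fun s t => if t < s then f s t else 0)]
    _ = ∑ s, ∑ t, if s < t then f s t + f t s else 0 := by
        simp only [← Finset.sum_add_distrib]
        refine Finset.sum_congr rfl fun s _ => Finset.sum_congr rfl fun t _ => ?_
        split_ifs <;> simp

theorem invCharge_mul (ε : Fin d → ZMod 2) (τ σ : Equiv.Perm (Fin d)) :
    invCharge ε (τ * σ) = invCharge ε τ + invCharge (ε ∘ τ) σ := by
  have hreindex : invCharge (ε ∘ τ) σ = ∑ s, ∑ t, if τ.symm s < τ.symm t ∧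
      σ.symm (τ.symm t) < σ.symm (τ.symm s) then ε s * ε t else 0 := by
    rw [invCharge, ← Equiv.sum_comp τ.symm]
    refine Finset.sum_congr rfl fun s _ => ?_
    rw [← Equiv.sum_comp τ.symm]
    simp
  have hmul (s) : (τ * σ).symm s = σ.symm (τ.symm s) := rfl
  rw [hreindex, sum_sum_eq_sum_lt (fun s => by simp)]
  simp only [invCharge, ← Finset.sum_add_distrib, hmul]
  refine Finset.sum_congr rfl fun s _ => Finset.sum_congr rfl fun t _ => ?_
  by_cases hst : s < t
  · have hτ : τ.symm s ≠ τ.symm t := τ.symm.injective.ne hst.ne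
    rcases lt_or_gt_of_ne hτ with h | h <;>
      rcases lt_or_gt_of_ne (σ.symm.injective.ne hτ) with h' | h' <;>
      simp [hst, h, h', h.not_gt, h'.not_gt, mul_comm (ε t), CharTwo.add_self_eq_zero]
  · simp [hst]

theorem invCharge_one (ε : Fin d → ZMod 2) : invCharge ε 1 = 0 :=
  Finset.sum_eq_zero fun _ _ => Finset.sum_eq_zero fun _ _ => if_neg fun h => h.1.not_gt h.2

theorem invCharge_eq_zero_of_fixes_odd {ε : Fin d → ZMod 2} {σ : Equiv.Perm (Fin d)}
    (h : ∀ s, ε s ≠ 0 → σ s = s) : invCharge ε σ = 0 := by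
  refine Finset.sum_eq_zero fun s _ => Finset.sum_eq_zero fun t _ => ?_
  split_ifs with hst
  · by_contra hne
    have hs : σ.symm s = s := by rw [Equiv.symm_apply_eq, h s (left_ne_zero_of_mul hne)]
    have ht : σ.symm t = t := by rw [Equiv.symm_apply_eq, h t (right_ne_zero_of_mul hne)]
    rw [hs, ht] at hst
    exact hst.1.not_gt hst.2
  · rfl

theorem invCharge_swap {ε : Fin d → ZMod 2} {p q : Fin d} (hpq : p ≠ q) (hp : ε p = 1)
    (hq : ε q = 1) : invCharge ε (Equiv.swap p q) = 1 := by
  wlog hlt : p < q generalizing p q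
  · rw [Equiv.swap_comm]
    exact this hpq.symm hq hp (lt_of_le_of_ne (not_lt.1 hlt) hpq.symm)
  -- The inversions are `(p, q)` itself and, for each `t` between, the pairs `(p, t)` and `(t, q)`.
  have hinv (s t) : (if s < t ∧ (Equiv.swap p q).symm t < (Equiv.swap p q).symm s
      then ε s * ε t else 0) = (if s = p then if t = q then 1 else 0 else 0) +
      ((if s = p then if p < t ∧ t < q then ε t else 0 else 0) +
      if t = q then if p < s ∧ s < q then ε s else 0 else 0) := by
    rw [Equiv.symm_swap, Equiv.swap_apply_def, Equiv.swap_apply_def]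
    by_cases s = p <;> by_cases s = q <;> by_cases t = p <;> by_cases t = q
    all_goals simp_all
    all_goals try grind
  simp only [invCharge, hinv, Finset.sum_add_distrib]
  rw [Finset.sum_comm (f := fun s t => if t = q then if p < s ∧ s < q then ε s else 0 else 0)]
  simp [Finset.sum_ite_eq', CharTwo.add_self_eq_zero]

theorem koszul_invCharge_one (k : Type u) [Field k] (σ : Equiv.Perm (Fin d)) :
    koszul k (invCharge (fun _ => 1) σ) = ((Equiv.Perm.sign σ : ℤ) : k) := by
  induction σ using Equiv.Perm.swap_induction_on with
  | one => simp [invCharge_one, koszul_zero]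
  | swap_mul σ p q hpq ih =>
    have hswap : koszul k (invCharge (fun _ => 1) (Equiv.swap p q)) = -1 := by
      simp [invCharge_swap hpq, koszul]
    rw [invCharge_mul, koszul_add, hswap, Equiv.Perm.sign_mul, Equiv.Perm.sign_swap hpq]
    simp [← ih, Function.comp_def]

end Sign

section OrbitSum

variable {k G X Y : Type*} [CommSemiring k] [Group G] [AddCommMonoid X] [Module k X]
  [AddCommMonoid Y] {ρ : Representation k G X} {H : Subgroup G} {x : X}

/-- The sum of the distinct translates of `x` under `H`.  (The sum over all elements of `H` would
vanish whenever the characteristic of `k` divides the order of the stabilizer of `x`.) -/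
def orbitSum (ρ : Representation k G X) (H : Subgroup G) (x : X) : X :=
  ∑ᶠ y ∈ (ρ · x) '' H, y

theorem map_orbitSum [Finite G] (f : X →+ Y) :
    f (orbitSum ρ H x) = ∑ᶠ y ∈ (ρ · x) '' H, f y :=
  f.map_finsum_mem _ (Set.toFinite _)

theorem apply_orbitSum [Finite G] {g : G} (hg : g ∈ H) :
    ρ g (orbitSum ρ H x) = orbitSum ρ H x := by
  have himage : ρ g '' ((ρ · x) '' H) = (ρ · x) '' H := by
    conv_rhs => rw [← smul_coe_set hg, ← Set.image_smul, Set.image_image]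
    simp [Set.image_image]
  have hinj : Function.Injective (ρ g) := (ρ.apply_bijective g).1
  calc ρ g (orbitSum ρ H x) = ∑ᶠ y ∈ (ρ · x) '' H, ρ g y := map_orbitSum (ρ g).toAddMonoidHom
    _ = ∑ᶠ y ∈ ρ g '' ((ρ · x) '' H), y :=
      (finsum_mem_image (f := id) hinj.injOn).symm
    _ = orbitSum ρ H x := by rw [himage, orbitSum]

theorem exists_apply_ne_zero_of_orbitSum [Finite G] (f : X →+ Y) (h : f (orbitSum ρ H x) ≠ 0) :
    ∃ g ∈ H, f (ρ g x) ≠ 0 := by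
  rw [map_orbitSum] at h
  obtain ⟨_, ⟨g, hg, rfl⟩, hne⟩ := exists_ne_zero_of_finsum_mem_ne_zero h
  exact ⟨g, hg, hne⟩

theorem map_orbitSum_eq_of_forall [Finite G] (f : X →+ Y)
    (h : ∀ g ∈ H, f (ρ g x) ≠ 0 → ρ g x = x) : f (orbitSum ρ H x) = f x := by
  have hx : x ∈ (ρ · x) '' H := ⟨1, H.one_mem, by simp⟩
  calc f (orbitSum ρ H x) = ∑ᶠ y ∈ (ρ · x) '' H, f y := map_orbitSum f
    _ = ∑ᶠ y ∈ ({x} : Set X), f y := finsum_mem_inter_support_eq _ _ _ ?_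
    _ = f x := finsum_mem_singleton (f := f)
  ext y
  constructor
  · rintro ⟨⟨g, hg, rfl⟩, hne⟩
    exact ⟨h g hg hne, hne⟩
  · rintro ⟨rfl, hne⟩
    exact ⟨hx, hne⟩

theorem map_orbitSum_eq_smul [Finite G] {P : X →ₗ[k] X} {c : k}
    (h : ∀ g ∈ H, P (ρ g x) = c • ρ g x) : P (orbitSum ρ H x) = c • orbitSum ρ H x :=
  calc P (orbitSum ρ H x) = ∑ᶠ y ∈ (ρ · x) '' H, P y := map_orbitSum P.toAddMonoidHom
    _ = ∑ᶠ y ∈ (ρ · x) '' H, c • y :=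
      finsum_mem_congr rfl (by rintro _ ⟨g, hg, rfl⟩; exact h g hg)
    _ = c • orbitSum ρ H x := (map_orbitSum (DistribSMul.toAddMonoidHom X c)).symm

end OrbitSum

section TensorPermutations

variable {k : Type u} [Field k] {M : Type u} [AddCommGroup M] [Module k M] [SuperSpace k M] {d : ℕ}

theorem tperm_tperm (σ τ : Equiv.Perm (Fin d)) (x : TPow k M d) :
    tperm σ (tperm τ x) = tperm (τ * σ) x := by
  refine LinearMap.congr_fun (f := tperm σ ∘ₗ tperm τ) (g := tperm (τ * σ))
    (homog_ext fun ε v hv => ?_) x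
  have hvτ (i) : pr k ((ε ∘ τ) i) ((v ∘ τ) i) = (v ∘ τ) i := hv (τ i)
  rw [LinearMap.comp_apply, tperm_tprod τ hv, map_smul, tperm_tprod σ hvτ, tperm_tprod (τ * σ) hv,
    smul_smul, ← koszul_add, invCharge_mul]
  rfl

theorem tperm_one (x : TPow k M d) : tperm 1 x = x := by
  refine LinearMap.congr_fun (f := tperm 1) (g := LinearMap.id) (homog_ext fun ε v hv => ?_) x
  rw [tperm_tprod 1 hv, invCharge_one, koszul_zero, one_smul]
  rfl

variable (k M d)

/-- The tensor power as a representation of the symmetric group.  As `tperm` composes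
contravariantly, `σ` acts by `tperm σ⁻¹`. -/
def tpermRep : Representation k (Equiv.Perm (Fin d)) (TPow k M d) where
  toFun σ := tperm σ⁻¹
  map_one' := LinearMap.ext fun x => by rw [inv_one, tperm_one]; rfl
  map_mul' σ τ := LinearMap.ext fun x => by rw [Module.End.mul_apply, tperm_tperm, mul_inv_rev]

/-- The twist of `tpermRep` by the sign character; it is used to produce the tensors that alternate
along the columns of a diagram. -/
def signTpermRep : Representation k (Equiv.Perm (Fin d)) (TPow k M d) where
  toFun σ := ((Equiv.Perm.sign σ : ℤ) : k) • tpermRep k M d σ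
  map_one' := by simp
  map_mul' σ τ := by simp [smul_smul, mul_comm]

variable {k M d} {H : Subgroup (Equiv.Perm (Fin d))} {f : Module.Dual k (TPow k M d)}
  {x : TPow k M d} {σ : Equiv.Perm (Fin d)}

theorem dual_tpermRep (σ : Equiv.Perm (Fin d)) (f : Module.Dual k (TPow k M d)) :
    (tpermRep k M d).dual σ f = f ∘ₗ tperm σ := by
  conv_rhs => rw [← inv_inv σ]
  rfl

/-- The sum of the distinct translates of a functional under a group of place permutations. -/
def dualOrbitSum (H : Subgroup (Equiv.Perm (Fin d))) (f : Module.Dual k (TPow k M d)) :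
    Module.Dual k (TPow k M d) :=
  orbitSum (tpermRep k M d).dual H f

theorem dualOrbitSum_tperm (hσ : σ ∈ H) (x : TPow k M d) :
    dualOrbitSum H f (tperm σ x) = dualOrbitSum H f x := by
  rw [← LinearMap.comp_apply, ← dual_tpermRep, dualOrbitSum, apply_orbitSum hσ]

theorem exists_tperm_ne_zero_of_dualOrbitSum (h : dualOrbitSum H f x ≠ 0) :
    ∃ σ ∈ H, f (tperm σ x) ≠ 0 := by
  obtain ⟨σ, hσ, hne⟩ := exists_apply_ne_zero_of_orbitSum
    (LinearMap.applyₗ x : Module.Dual k (TPow k M d) →ₗ[k] k).toAddMonoidHom h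
  rw [dual_tpermRep] at hne
  exact ⟨σ, hσ, hne⟩

theorem dualOrbitSum_apply_eq (h : ∀ σ ∈ H, f (tperm σ x) ≠ 0 → f ∘ₗ tperm σ = f) :
    dualOrbitSum H f x = f x := by
  refine map_orbitSum_eq_of_forall
    (LinearMap.applyₗ x : Module.Dual k (TPow k M d) →ₗ[k] k).toAddMonoidHom fun σ hσ hne => ?_
  rw [dual_tpermRep] at hne ⊢
  exact h σ hσ hne

theorem sign_mul_self (k : Type*) [CommRing k] (σ : Equiv.Perm (Fin d)) :
    ((Equiv.Perm.sign σ : ℤ) : k) * (Equiv.Perm.sign σ : ℤ) = 1 := by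
  rw [← Int.cast_mul, Int.units_coe_mul_self, Int.cast_one]

/-- The tensors that alternate under the place permutations preserving the fibres of `c`. -/
def altSub (k : Type u) [Field k] (M : Type u) [AddCommGroup M] [Module k M] [SuperSpace k M]
    {β : Type*} (c : Fin d → β) : Submodule k (TPow k M d) where
  carrier := {x | ∀ σ ∈ fiberPerms c, tperm σ x = ((Equiv.Perm.sign σ : ℤ) : k) • x}
  add_mem' hx hy σ hσ := by rw [map_add, hx σ hσ, hy σ hσ, smul_add]
  zero_mem' σ _ := by rw [map_zero, smul_zero]
  smul_mem' a x hx σ hσ := by rw [map_smul, hx σ hσ, smul_comm]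

variable {β : Type*} {c : Fin d → β}

/-- The sum of the distinct signed translates of a tensor under the permutations preserving the
fibres of `c`. -/
def altOrbitSum (c : Fin d → β) (x : TPow k M d) : TPow k M d :=
  orbitSum (signTpermRep k M d) (fiberPerms c) x

theorem signTpermRep_inv (σ : Equiv.Perm (Fin d)) (x : TPow k M d) :
    signTpermRep k M d σ⁻¹ x = ((Equiv.Perm.sign σ : ℤ) : k) • tperm σ x := by
  change ((Equiv.Perm.sign σ⁻¹ : ℤ) : k) • tperm σ⁻¹⁻¹ x = _
  rw [Equiv.Perm.sign_inv, inv_inv]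

theorem altOrbitSum_mem_altSub (c : Fin d → β) (x : TPow k M d) :
    altOrbitSum c x ∈ altSub k M c := by
  intro σ hσ
  have hinv : ((Equiv.Perm.sign σ : ℤ) : k) • tperm σ (altOrbitSum c x) = altOrbitSum c x := by
    rw [← signTpermRep_inv]
    exact apply_orbitSum (inv_mem hσ)
  conv_rhs => rw [← hinv]
  rw [smul_smul, sign_mul_self, one_smul]

theorem exists_tperm_ne_zero_of_altOrbitSum (h : f (altOrbitSum c x) ≠ 0) :
    ∃ σ ∈ fiberPerms c, f (tperm σ x) ≠ 0 := by
  obtain ⟨σ, hσ, hne⟩ := exists_apply_ne_zero_of_orbitSum f.toAddMonoidHom h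
  rw [← inv_inv σ, signTpermRep_inv] at hne
  refine ⟨σ⁻¹, inv_mem hσ, right_ne_zero_of_smul (a := ((Equiv.Perm.sign σ⁻¹ : ℤ) : k)) ?_⟩
  rwa [← map_smul]

theorem apply_altOrbitSum_eq (h : ∀ σ ∈ fiberPerms c, f (tperm σ x) ≠ 0 →
    ((Equiv.Perm.sign σ : ℤ) : k) • tperm σ x = x) : f (altOrbitSum c x) = f x := by
  refine map_orbitSum_eq_of_forall f.toAddMonoidHom fun σ hσ hne => ?_
  rw [← inv_inv σ, signTpermRep_inv] at hne ⊢
  refine h σ⁻¹ (inv_mem hσ) (right_ne_zero_of_smul (a := ((Equiv.Perm.sign σ⁻¹ : ℤ) : k)) ?_)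
  rwa [← map_smul]

end TensorPermutations

section WordBasis

variable {k : Type u} [Field k] {M : Type u} [AddCommGroup M] [Module k M] {d : ℕ}
  {ι β : Type*} {p : ι → ZMod 2} {c : Fin d → β} {σ : Equiv.Perm (Fin d)} {T v w : Fin d → ι}

/-- No letter of parity `a` is repeated by the word `T` within a fibre of `c`. -/
def NoRepeat (p : ι → ZMod 2) (a : ZMod 2) (c : Fin d → β) (T : Fin d → ι) : Prop :=
  ∀ ⦃s t⦄, c s = c t → T s = T t → p (T s) = a → s = t

theorem koszul_invCharge_of_comp_eq (k : Type u) [Field k]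
    (hT : NoRepeat p 1 c T) (hσ : σ ∈ fiberPerms c)
    (h : T ∘ σ = T) : koszul k (invCharge (p ∘ T) σ) = 1 := by
  rw [invCharge_eq_zero_of_fixes_odd, koszul_zero]
  intro s hs
  exact (hT (hσ s).symm (congrFun h s).symm ((zmod2_cases _).resolve_left hs)).symm

theorem sign_mul_koszul_of_comp_eq (k : Type u) [Field k]
    (hT : NoRepeat p 0 c T) (hσ : σ ∈ fiberPerms c)
    (h : T ∘ σ = T) :
    ((Equiv.Perm.sign σ : ℤ) : k) * koszul k (invCharge (p ∘ T) σ) = 1 := by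
  have hcharge : invCharge ((fun _ => 1) + p ∘ T) σ =
      invCharge (fun _ => 1) σ + invCharge (p ∘ T) σ := by
    have hperm := charge_perm (fun _ => 1) (p ∘ T) σ
    have hpT : (p ∘ T) ∘ σ = p ∘ T := by rw [Function.comp_assoc, h]
    have hone : (fun _ : Fin d => (1 : ZMod 2)) ∘ σ = fun _ => 1 := rfl
    rwa [hpT, hone, add_comm, add_right_cancel_iff] at hperm
  rw [← koszul_invCharge_one, ← koszul_add, ← hcharge, invCharge_eq_zero_of_fixes_odd, koszul_zero]
  intro s hs
  have hp : p (T s) = 0 := (zmod2_cases _).resolve_right fun hp => hs (by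
    simp only [Pi.add_apply, Function.comp_apply, hp, CharTwo.add_self_eq_zero])
  exact (hT (hσ s).symm (congrFun h s).symm hp).symm

variable {e : Module.Basis ι k M}

/-- The basis of `M^{⊗d}` indexed by the words of length `d` in the basis of `M`. -/
def wordBasis (e : Module.Basis ι k M) (d : ℕ) : Module.Basis (Fin d → ι) k (TPow k M d) :=
  _root_.Basis.piTensorProduct fun _ => e

theorem wordBasis_apply (e : Module.Basis ι k M) (w : Fin d → ι) :
    wordBasis e d w = PiTensorProduct.tprod k fun s => e (w s) :=
  _root_.Basis.piTensorProduct_apply _ _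

theorem coord_wordBasis_self (e : Module.Basis ι k M) (T : Fin d → ι) :
    (wordBasis e d).coord T (wordBasis e d T) = 1 := by
  rw [Module.Basis.coord_apply, Module.Basis.repr_self, Finsupp.single_eq_same]

variable [SuperSpace k M] (he : ∀ i, pr k (p i) (e i) = e i)
include he

theorem tperm_wordBasis (σ : Equiv.Perm (Fin d)) (w : Fin d → ι) :
    tperm σ (wordBasis e d w) = koszul k (invCharge (p ∘ w) σ) • wordBasis e d (w ∘ σ) := by
  rw [wordBasis_apply, wordBasis_apply, tperm_tprod σ (ε := p ∘ w) fun s => he (w s)]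
  rfl

theorem comp_eq_of_coord_tperm_ne_zero
    (h : (wordBasis e d).coord w (tperm σ (wordBasis e d v)) ≠ 0) : v ∘ σ = w := by
  by_contra hne
  rw [tperm_wordBasis he, map_smul, Module.Basis.coord_apply, Module.Basis.repr_self,
    Finsupp.single_eq_of_ne (Ne.symm hne), smul_zero] at h
  exact h rfl

theorem coord_comp_tperm (h : T ∘ σ = T) (hsign : koszul k (invCharge (p ∘ T) σ) = 1) :
    (wordBasis e d).coord T ∘ₗ tperm σ = (wordBasis e d).coord T := by
  refine (wordBasis e d).ext fun w => ?_
  rw [LinearMap.comp_apply]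
  obtain rfl | hw := eq_or_ne w T
  · rw [tperm_wordBasis he, h, hsign, one_smul]
  · have hzero : (wordBasis e d).coord T (wordBasis e d w) = 0 := by
      rw [Module.Basis.coord_apply, Module.Basis.repr_self, Finsupp.single_eq_of_ne hw.symm]
    rw [hzero]
    by_contra hne
    have hcomp : w ∘ σ = T ∘ σ := (comp_eq_of_coord_tperm_ne_zero he hne).trans h.symm
    exact hw (σ.surjective.injective_comp_right hcomp)

theorem dualOrbitSum_coord_self
    (hT : NoRepeat p 1 c T) :
    dualOrbitSum (fiberPerms c) ((wordBasis e d).coord T) (wordBasis e d T) = 1 := by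
  rw [dualOrbitSum_apply_eq, coord_wordBasis_self]
  intro σ hσ h
  have hcomp := comp_eq_of_coord_tperm_ne_zero he h
  exact coord_comp_tperm he hcomp (koszul_invCharge_of_comp_eq k hT hσ hcomp)

theorem exists_comp_eq_of_dualOrbitSum_coord_ne_zero {H : Subgroup (Equiv.Perm (Fin d))}
    (h : dualOrbitSum H ((wordBasis e d).coord T) (wordBasis e d w) ≠ 0) :
    ∃ σ ∈ H, w ∘ σ = T := by
  obtain ⟨σ, hσ, hne⟩ := exists_tperm_ne_zero_of_dualOrbitSum h
  exact ⟨σ, hσ, comp_eq_of_coord_tperm_ne_zero he hne⟩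

end WordBasis

section Diagram

variable {lam : YoungDiagram}

/-- The row of the box numbered `s` along the rows. -/
def rowOf (lam : YoungDiagram) (s : Fin lam.card) : ℕ := (rowBox lam s).1.1

/-- The column of the box numbered `s` along the rows. -/
def colOf (lam : YoungDiagram) (s : Fin lam.card) : ℕ := (rowBox lam s).1.2

theorem rowOf_colOf_mem (s : Fin lam.card) : (rowOf lam s, colOf lam s) ∈ lam := (rowBox lam s).2

theorem exists_rowOf_eq_colOf_eq {i j : ℕ} (h : (i, j) ∈ lam) :
    ∃ s, rowOf lam s = i ∧ colOf lam s = j := by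
  refine ⟨(rowBox lam).symm ⟨(i, j), h⟩, ?_, ?_⟩ <;> simp [rowOf, colOf]

theorem injective_rowOf_colOf (lam : YoungDiagram) :
    Function.Injective fun s => (rowOf lam s, colOf lam s) :=
  Subtype.val_injective.comp (rowBox lam).injective

theorem injective_colOf_rowOf (lam : YoungDiagram) :
    Function.Injective fun s => (colOf lam s, rowOf lam s) :=
  Prod.swap_injective.comp (injective_rowOf_colOf lam)

theorem isColPerm_conj_sigmaPerm {σ : Equiv.Perm (Fin lam.card)} :
    IsColPerm lam (sigmaPerm lam * σ * (sigmaPerm lam)⁻¹) ↔ σ ∈ fiberPerms (colOf lam) := by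
  have hcol (s) : (colBox lam (sigmaPerm lam s)).1.2 = colOf lam s := by simp [sigmaPerm, colOf]
  rw [IsColPerm, (sigmaPerm lam).surjective.forall, mem_fiberPerms]
  simp [hcol]

end Diagram

section SchurFunctor

variable {k : Type u} [Field k] {lam : YoungDiagram} {M : Type u} [AddCommGroup M] [Module k M]
  [SuperSpace k M]

theorem tperm_sigmaPerm_signedPow_mem_altSub {x : TPow k (Par M) lam.card}
    (hx : x ∈ divPowPar k lam M) :
    tperm (sigmaPerm lam) (signedPow (parTo k M) lam.card x) ∈ altSub k M (colOf lam) := by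
  intro σ hσ
  have hconj : sigmaPerm lam * σ = sigmaPerm lam * σ * (sigmaPerm lam)⁻¹ * sigmaPerm lam := by group
  have hsign : Equiv.Perm.sign (sigmaPerm lam * σ * (sigmaPerm lam)⁻¹) = Equiv.Perm.sign σ := by
    simp [mul_comm, mul_left_comm]
  rw [tperm_tperm, hconj, ← tperm_tperm (sigmaPerm lam), tperm_signedPow (pr_parTo k M),
    koszul_invCharge_one, hx _ (isColPerm_conj_sigmaPerm.2 hσ), hsign, map_smul]

theorem signedPow_tperm_sigmaPerm_inv_mem_divPowPar {z : TPow k M lam.card}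
    (hz : z ∈ altSub k M (colOf lam)) :
    signedPow (toPar k M) lam.card (tperm (sigmaPerm lam)⁻¹ z) ∈ divPowPar k lam M := by
  intro τ hτ
  have hconj : (sigmaPerm lam)⁻¹ * τ =
      (sigmaPerm lam)⁻¹ * τ * sigmaPerm lam * (sigmaPerm lam)⁻¹ := by group
  have hcol : (sigmaPerm lam)⁻¹ * τ * sigmaPerm lam ∈ fiberPerms (colOf lam) := by
    rw [← isColPerm_conj_sigmaPerm]
    convert hτ using 1
    group
  have hsign : Equiv.Perm.sign ((sigmaPerm lam)⁻¹ * τ * sigmaPerm lam) = Equiv.Perm.sign τ := by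
    simp [mul_comm, mul_left_comm]
  rw [tperm_signedPow (pr_toPar k _), koszul_invCharge_one, tperm_tperm, hconj,
    ← tperm_tperm (sigmaPerm lam)⁻¹, hz _ hcol, hsign, map_smul, map_smul, smul_smul,
    sign_mul_self, one_smul]

theorem schurSub_eq_map_altSub :
    schurSub k lam M = (altSub k M (colOf lam)).map (symKer k lam M).mkQ := by
  ext y
  rw [mem_schurSub, Submodule.mem_map]
  constructor
  · rintro ⟨x, hx, rfl⟩
    exact ⟨_, tperm_sigmaPerm_signedPow_mem_altSub hx, rfl⟩
  · rintro ⟨z, hz, rfl⟩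
    refine ⟨koszul k (charge (d := lam.card) (fun _ => 1) fun _ => 1) •
      signedPow (toPar k M) lam.card (tperm (sigmaPerm lam)⁻¹ z),
      Submodule.smul_mem _ _ (signedPow_tperm_sigmaPerm_inv_mem_divPowPar hz), ?_⟩
    rw [map_smul, signedPow_toPar_parTo, smul_smul, koszul_mul_self, one_smul, tperm_tperm,
      inv_mul_cancel, tperm_one]

theorem mem_dualAnnihilator_symKer {f : Module.Dual k (TPow k M lam.card)} :
    f ∈ (symKer k lam M).dualAnnihilator ↔
      ∀ ρ ∈ fiberPerms (rowOf lam), ∀ x, f (tperm ρ x) = f x := by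
  have hker : f ∈ (symKer k lam M).dualAnnihilator ↔ symKer k lam M ≤ LinearMap.ker f :=
    Submodule.mem_dualAnnihilator f
  rw [hker, symKer, Submodule.span_le]
  constructor
  · exact fun hf ρ hρ x => sub_eq_zero.1 ((map_sub f _ _).symm.trans (hf ⟨ρ, x, hρ, rfl⟩))
  · rintro hf _ ⟨ρ, x, hρ, rfl⟩
    exact LinearMap.mem_ker.2 (by rw [map_sub, hf ρ hρ, sub_self])

end SchurFunctor

section SemistandardWords

variable {ι : Type*} {p : ι → ZMod 2} {rk : ι → ℕ}

section SortedOnFibers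

variable {d : ℕ} {c g : Fin d → ℕ} {a : ZMod 2} {T : Fin d → ι}

/-- On each fibre of `c`, the letters of `T` increase weakly with `g`, and only letters of parity
`a` are repeated. -/
def SortedOnFibers (p : ι → ZMod 2) (rk : ι → ℕ) (a : ZMod 2) (c g : Fin d → ℕ)
    (T : Fin d → ι) : Prop :=
  ∀ ⦃s t⦄, c s = c t → g s < g t → rk (T s) ≤ rk (T t) ∧ (T s = T t → p (T s) = a)

theorem SortedOnFibers.fiberMonovary (h : SortedOnFibers p rk a c g T) :
    FiberMonovary c (rk ∘ T) g :=
  fun _ _ hst hg => (h hst hg).1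

theorem SortedOnFibers.noRepeat (hcg : Function.Injective fun s => (c s, g s))
    (h : SortedOnFibers p rk a c g T) : NoRepeat p (a + 1) c T := by
  intro s t hst hT hp
  rcases lt_trichotomy (g s) (g t) with hg | hg | hg
  · simpa [hp] using (h hst hg).2 hT
  · exact hcg (Prod.ext hst hg)
  · simpa [← hT, hp] using (h hst.symm hg).2 hT.symm

theorem sortedOnFibers_of_fiberMonovary (h : FiberMonovary c (rk ∘ T) g)
    (hT : NoRepeat p (a + 1) c T) : SortedOnFibers p rk a c g T := by
  refine fun s t hst hg => ⟨h hst hg, fun hTst => ?_⟩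
  have hparity : ∀ b b' : ZMod 2, b' ≠ b → b' = b + 1 := by decide
  by_contra hp
  exact hg.ne (congrArg g (hT hst hTst (hparity _ _ hp)))

theorem comp_eq_of_fiberMonovary (hrk : Function.Injective rk)
    (hcg : Function.Injective fun s => (c s, g s)) {σ : Equiv.Perm (Fin d)}
    (hσ : σ ∈ fiberPerms c) (h : FiberMonovary c (rk ∘ T) g)
    (h' : FiberMonovary c (rk ∘ T ∘ σ) g) : T ∘ σ = T :=
  hrk.comp_left (h.comp_fiberPerms_eq hcg hσ h')

end SortedOnFibers

variable {lam : YoungDiagram} {T : Fin lam.card → ι} {σ : Equiv.Perm (Fin lam.card)}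

/-- The words that are semistandard as fillings of `lam`: even letters increase weakly along the
rows and strictly down the columns, odd letters strictly along the rows and weakly down the
columns. -/
def IsSemistandardWord (p : ι → ZMod 2) (rk : ι → ℕ) (T : Fin lam.card → ι) : Prop :=
  SortedOnFibers p rk 0 (rowOf lam) (colOf lam) T ∧ SortedOnFibers p rk 1 (colOf lam) (rowOf lam) T

theorem IsSemistandardWord.noRepeat_col (h : IsSemistandardWord p rk T) :
    NoRepeat p 0 (colOf lam) T :=
  h.2.noRepeat (injective_colOf_rowOf lam)

theorem IsSemistandardWord.rank_le (h : IsSemistandardWord p rk T) {s t : Fin lam.card}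
    (hst : (rowBox lam s).1 ≤ (rowBox lam t).1) : rk (T s) ≤ rk (T t) := by
  obtain ⟨q, hrow, hcol⟩ := exists_rowOf_eq_colOf_eq
    (lam.isLowerSet (Prod.mk_le_mk.2 ⟨hst.1, le_refl (colOf lam t)⟩) (rowOf_colOf_mem t))
  calc rk (T s) ≤ rk (T q) :=
        h.1.fiberMonovary.le_of_le (injective_rowOf_colOf lam) hrow.symm (hst.2.trans_eq hcol.symm)
    _ ≤ rk (T t) :=
        h.2.fiberMonovary.le_of_le (injective_colOf_rowOf lam) hcol (hrow.trans_le hst.1)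

/-- The sum of the products of the rank of a letter and the number of its row: the statistic that
controls the triangularity of the straightening. -/
def energy (rk : ι → ℕ) (w : Fin lam.card → ι) : ℕ := ∑ s, rk (w s) * rowOf lam s

theorem energy_comp (rk : ι → ℕ) (w : Fin lam.card → ι) (hσ : σ ∈ fiberPerms (rowOf lam)) :
    energy rk (w ∘ σ) = energy rk w := by
  rw [energy, energy, ← Equiv.sum_comp σ fun s => rk (w s) * rowOf lam s]
  exact Finset.sum_congr rfl fun s _ => by rw [hσ s, Function.comp_apply]

theorem IsSemistandardWord.energy_comp_le (h : IsSemistandardWord p rk T)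
    (hσ : σ ∈ fiberPerms (colOf lam)) : energy rk (T ∘ σ) ≤ energy rk T :=
  h.2.fiberMonovary.sum_comp_perm_mul_le hσ

theorem IsSemistandardWord.comp_eq_of_energy_eq (hrk : Function.Injective rk)
    (h : IsSemistandardWord p rk T) (hσ : σ ∈ fiberPerms (colOf lam))
    (heq : energy rk (T ∘ σ) = energy rk T) : T ∘ σ = T :=
  comp_eq_of_fiberMonovary hrk (injective_colOf_rowOf lam) hσ h.2.fiberMonovary
    (h.2.fiberMonovary.comp_perm_of_sum_eq hσ heq)

end SemistandardWords

section Garnir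

variable {lam : YoungDiagram} {ι : Type*} {p : ι → ZMod 2} {rk : ι → ℕ} {T w : Fin lam.card → ι}
  {a b s t : Fin lam.card} {ρ σ : Equiv.Perm (Fin lam.card)}

/-- The box `b` lies directly below `a`, and their letters are out of order for the condition that
semistandardness imposes on columns. -/
structure IsColumnViolation (p : ι → ZMod 2) (rk : ι → ℕ) (T : Fin lam.card → ι)
    (a b : Fin lam.card) : Prop where
  colOf_eq : colOf lam a = colOf lam b
  rowOf_eq : rowOf lam b = rowOf lam a + 1
  lt_or_eq : rk (T b) < rk (T a) ∨ T b = T a ∧ p (T a) = 0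

theorem IsColumnViolation.rk_le (h : IsColumnViolation p rk T a b) : rk (T b) ≤ rk (T a) := by
  rcases h.lt_or_eq with hlt | ⟨heq, -⟩
  · exact hlt.le
  · rw [heq]

theorem IsColumnViolation.parity_eq_zero (hrk : Function.Injective rk)
    (h : IsColumnViolation p rk T a b) (hs : rk (T a) ≤ rk (T s)) (hs' : rk (T s) ≤ rk (T b)) :
    p (T s) = 0 := by
  obtain ⟨heq, hp⟩ := h.lt_or_eq.resolve_left (by omega)
  rw [heq] at hs'
  rwa [← hrk (le_antisymm hs hs')]

theorem sortedOnFibers_colOf_of_forall_adjacent (hrk : Function.Injective rk)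
    (h : ∀ s t, colOf lam s = colOf lam t → rowOf lam t = rowOf lam s + 1 →
      rk (T s) ≤ rk (T t) ∧ (T s = T t → p (T s) = 1)) :
    SortedOnFibers p rk 1 (colOf lam) (rowOf lam) T := by
  suffices key : ∀ n s t, colOf lam s = colOf lam t → rowOf lam t = rowOf lam s + n + 1 →
      rk (T s) ≤ rk (T t) ∧ (T s = T t → p (T s) = 1) from
    fun s t hc hr => key (rowOf lam t - rowOf lam s - 1) s t hc (by omega)
  intro n
  induction n with
  | zero => exact h
  | succ n ih =>
    intro s t hc hr
    obtain ⟨m, hm, hm'⟩ := exists_rowOf_eq_colOf_eq (lam.isLowerSet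
      (Prod.mk_le_mk.2 ⟨show rowOf lam s + n + 1 ≤ rowOf lam t by omega, le_refl (colOf lam t)⟩)
      (rowOf_colOf_mem t))
    obtain ⟨hsm, hsm'⟩ := ih s m (hc.trans hm'.symm) hm
    obtain ⟨hmt, -⟩ := h m t hm' (by omega)
    exact ⟨hsm.trans hmt, fun hT => hsm' (hrk (le_antisymm hsm (hT ▸ hmt)))⟩

theorem exists_isColumnViolation (hrk : Function.Injective rk)
    (hrow : SortedOnFibers p rk 0 (rowOf lam) (colOf lam) T) (hT : ¬ IsSemistandardWord p rk T) :
    ∃ a b, IsColumnViolation p rk T a b := by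
  by_contra! hcon
  refine hT ⟨hrow, sortedOnFibers_colOf_of_forall_adjacent hrk fun s t hc hr => ⟨?_, fun hst => ?_⟩⟩
  · by_contra! hlt
    exact hcon s t ⟨hc, hr, Or.inl hlt⟩
  · exact (zmod2_cases _).resolve_left fun hp => hcon s t ⟨hc, hr, Or.inr ⟨hst.symm, hp⟩⟩

/-- The Garnir set of `a` and `b`, the boxes of the row of `a` whose letter is not less than that
of `a` together with the boxes of the row of `b` whose letter is not greater than that of `b`. -/
def InGarnir (rk : ι → ℕ) (T : Fin lam.card → ι) (a b s : Fin lam.card) : Prop :=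
  (rowOf lam s = rowOf lam a ∧ rk (T a) ≤ rk (T s)) ∨
    (rowOf lam s = rowOf lam b ∧ rk (T s) ≤ rk (T b))

open scoped Classical in
/-- The labelling whose fibres are the Garnir set, labelled `none`, and what remains of each row
outside of it. -/
def garnirBlock (rk : ι → ℕ) (T : Fin lam.card → ι) (a b s : Fin lam.card) : Option ℕ :=
  if InGarnir rk T a b s then none else some (rowOf lam s)

theorem garnirBlock_eq_none : garnirBlock rk T a b s = none ↔ InGarnir rk T a b s := by
  rw [garnirBlock]
  split_ifs with h <;> simp [h]

theorem garnirBlock_eq_some {i : ℕ} :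
    garnirBlock rk T a b s = some i ↔ ¬ InGarnir rk T a b s ∧ rowOf lam s = i := by
  rw [garnirBlock]
  split_ifs with h <;> simp [h]

theorem garnirBlock_eq_iff : garnirBlock rk T a b s = garnirBlock rk T a b t ↔
    (InGarnir rk T a b s ↔ InGarnir rk T a b t) ∧
      (¬ InGarnir rk T a b t → rowOf lam s = rowOf lam t) := by
  by_cases ht : InGarnir rk T a b t
  · rw [garnirBlock_eq_none.2 ht, garnirBlock_eq_none]
    simp [ht]
  · rw [garnirBlock_eq_some.2 ⟨ht, rfl⟩, garnirBlock_eq_some]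
    simp [ht]

theorem noRepeat_garnirBlock (hrk : Function.Injective rk) (hT : NoRepeat p 1 (rowOf lam) T)
    (hab : IsColumnViolation p rk T a b) : NoRepeat p 1 (garnirBlock rk T a b) T := by
  intro s t hst hTst hp
  have hodd : ¬ (rk (T a) ≤ rk (T s) ∧ rk (T s) ≤ rk (T b)) := fun h =>
    one_ne_zero (hp.symm.trans (hab.parity_eq_zero hrk h.1 h.2))
  obtain ⟨hiff, hout⟩ := garnirBlock_eq_iff.1 hst
  refine hT ?_ hTst hp
  by_cases ht : InGarnir rk T a b t
  · rcases hiff.2 ht with ⟨hs, hs'⟩ | ⟨hs, hs'⟩ <;> rcases ht with ⟨ht, ht'⟩ | ⟨ht, ht'⟩ <;>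
      rw [← hTst] at ht'
    · exact hs.trans ht.symm
    · exact (hodd ⟨hs', ht'⟩).elim
    · exact (hodd ⟨ht', hs'⟩).elim
    · exact hs.trans ht.symm
  · exact hout ht

theorem exists_inGarnir_of_le_rowLen (hT : FiberMonovary (rowOf lam) (rk ∘ T) (colOf lam))
    (hab : IsColumnViolation p rk T a b) {c : ℕ} (hc : c ≤ lam.rowLen (rowOf lam a)) :
    ∃ s, InGarnir rk T a b s ∧
      ((c ≤ colOf lam a ∧ rowOf lam s = rowOf lam b ∧ colOf lam s = c) ∨
        (colOf lam a < c ∧ rowOf lam s = rowOf lam a ∧ colOf lam s + 1 = c)) := by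
  have hmono {s t} (hrow : rowOf lam s = rowOf lam t) (hcol : colOf lam s ≤ colOf lam t) :
      rk (T s) ≤ rk (T t) :=
    hT.le_of_le (injective_rowOf_colOf lam) hrow hcol
  rcases le_or_gt c (colOf lam a) with hca | hca
  · have hcb : c ≤ colOf lam b := hab.colOf_eq ▸ hca
    obtain ⟨s, hs, hs'⟩ := exists_rowOf_eq_colOf_eq (lam.isLowerSet
      (Prod.mk_le_mk.2 ⟨le_refl (rowOf lam b), hcb⟩) (rowOf_colOf_mem b))
    exact ⟨s, Or.inr ⟨hs, hmono hs (hs'.trans_le hcb)⟩, Or.inl ⟨hca, hs, hs'⟩⟩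
  · have hmem : (rowOf lam a, c - 1) ∈ lam := YoungDiagram.mem_iff_lt_rowLen.2 (by omega)
    obtain ⟨s, hs, hs'⟩ := exists_rowOf_eq_colOf_eq hmem
    exact ⟨s, Or.inl ⟨hs, hmono hs.symm (by omega)⟩, Or.inr ⟨hca, hs, by omega⟩⟩

theorem exists_ne_inGarnir_colOf_eq (hT : FiberMonovary (rowOf lam) (rk ∘ T) (colOf lam))
    (hab : IsColumnViolation p rk T a b) (hρ : ρ ∈ fiberPerms (rowOf lam)) :
    ∃ s t, s ≠ t ∧ InGarnir rk T a b s ∧ InGarnir rk T a b t ∧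
      colOf lam (ρ s) = colOf lam (ρ t) := by
  set N := lam.rowLen (rowOf lam a)
  have hbox (c : Fin (N + 1)) := exists_inGarnir_of_le_rowLen hT hab (Nat.lt_succ_iff.1 c.2)
  choose g hg hpos using hbox
  have hrow := hab.rowOf_eq
  have hinj : Function.Injective g := by
    intro c c' h
    have hc := hpos c
    have hc' := hpos c'
    rw [h] at hc
    exact Fin.ext (by omega)
  have hlt (c) : colOf lam (ρ (g c)) < N := by
    have hle : rowOf lam a ≤ rowOf lam (ρ (g c)) := by
      rw [hρ]
      have hc := hpos c
      omega
    exact (YoungDiagram.mem_iff_lt_rowLen.1 (rowOf_colOf_mem _)).trans_le (lam.rowLen_anti _ _ hle)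
  obtain ⟨c, c', hne, heq⟩ := Fintype.exists_ne_map_eq_of_card_lt
    (fun c => (⟨colOf lam (ρ (g c)), hlt c⟩ : Fin N)) (by simp)
  exact ⟨g c, g c', hinj.ne hne, hg c, hg c', congrArg Fin.val heq⟩

theorem mem_fiberPerms_garnirBlock (hρ : ρ ∈ fiberPerms (rowOf lam))
    (hσ : σ ∈ fiberPerms (garnirBlock rk T a b)) (hT : (T ∘ ρ) ∘ σ = T) :
    ρ ∈ fiberPerms (garnirBlock rk T a b) := by
  have hTρ : T ∘ ρ = T ∘ σ.symm := (Equiv.eq_comp_symm σ _ _).2 hT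
  have hout : Set.MapsTo ρ {s | ¬ InGarnir rk T a b s} {s | ¬ InGarnir rk T a b s} := by
    intro s (hs : ¬ InGarnir rk T a b s)
    obtain ⟨hin, hrow⟩ := garnirBlock_eq_iff.1 (inv_mem hσ s)
    have hTs : T (ρ s) = T (σ⁻¹ s) := congrFun hTρ s
    change ¬ InGarnir rk T a b (ρ s)
    rw [InGarnir, hρ s, hTs, ← hrow hs]
    exact fun h => hs (hin.1 h)
  have hin {s} (hs : InGarnir rk T a b s) : InGarnir rk T a b (ρ s) := by
    by_contra hρs
    have hback := Equiv.Perm.perm_symm_mapsTo_of_mapsTo ρ hout hρs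
    rw [ρ.symm_apply_apply] at hback
    exact hback hs
  exact fun s => garnirBlock_eq_iff.2 ⟨not_iff_not.1 ⟨mt hin, fun hs => hout hs⟩, fun _ => hρ s⟩

theorem energy_comp_symm_sub_energy (rk : ι → ℕ) (T : Fin lam.card → ι)
    (σ : Equiv.Perm (Fin lam.card)) (m : ℤ) :
    (energy rk (T ∘ σ.symm) : ℤ) - energy rk T =
      ∑ s, ((rk (T s) : ℤ) - m) * ((rowOf lam (σ s) : ℤ) - rowOf lam s) := by
  have hrow : ∑ s, (rowOf lam (σ s) : ℤ) = ∑ s, (rowOf lam s : ℤ) :=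
    Equiv.sum_comp σ fun s => (rowOf lam s : ℤ)
  rw [energy, energy, ← Equiv.sum_comp σ fun s => rk ((T ∘ σ.symm) s) * rowOf lam s]
  simp only [sub_mul, mul_sub, Finset.sum_sub_distrib, ← Finset.mul_sum, hrow, Function.comp_apply,
    Equiv.symm_apply_apply]
  push_cast
  ring

theorem garnir_energy_term_nonneg (hab : IsColumnViolation p rk T a b)
    (hσ : σ ∈ fiberPerms (garnirBlock rk T a b)) (s : Fin lam.card) :
    0 ≤ ((rk (T s) : ℤ) - rk (T a)) * ((rowOf lam (σ s) : ℤ) - rowOf lam s) := by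
  obtain ⟨hin, hrow⟩ := garnirBlock_eq_iff.1 (hσ s)
  have hle := hab.rk_le
  have hab' := hab.rowOf_eq
  by_cases hs : InGarnir rk T a b s
  · have hσs : rowOf lam (σ s) = rowOf lam a ∨ rowOf lam (σ s) = rowOf lam b :=
      (hin.2 hs).imp And.left And.left
    rcases hs with ⟨hs, hs'⟩ | ⟨hs, hs'⟩
    · exact mul_nonneg (by omega) (by omega)
    · exact mul_nonneg_of_nonpos_of_nonpos (by omega) (by omega)
  · rw [hrow hs, sub_self, mul_zero]

theorem energy_lt_or_eq_of_garnir (hrk : Function.Injective rk)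
    (hT : FiberMonovary (rowOf lam) (rk ∘ T) (colOf lam)) (hab : IsColumnViolation p rk T a b)
    (hρ : ρ ∈ fiberPerms (rowOf lam)) (hσ : σ ∈ fiberPerms (garnirBlock rk T a b))
    (hw : FiberMonovary (rowOf lam) (rk ∘ w) (colOf lam)) (h : (w ∘ ρ) ∘ σ = T) :
    energy rk T < energy rk w ∨ w = T := by
  have hwT : w ∘ ρ = T ∘ σ.symm := (Equiv.eq_comp_symm σ _ _).2 h
  have hnonneg := garnir_energy_term_nonneg hab hσ
  have hsum := energy_comp_symm_sub_energy rk T σ (rk (T a))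
  rw [← hwT, energy_comp rk w hρ] at hsum
  have hle : energy rk T ≤ energy rk w := by
    have := Finset.sum_nonneg fun s (_ : s ∈ Finset.univ) => hnonneg s
    omega
  refine hle.lt_or_eq.imp_right fun heq => ?_
  rw [heq, sub_self, eq_comm, Finset.sum_eq_zero_iff_of_nonneg fun s _ => hnonneg s] at hsum
  have hfix (s) (hs : T s ≠ T a) : rowOf lam (σ s) = rowOf lam s := by
    have hne : (rk (T s) : ℤ) - rk (T a) ≠ 0 := sub_ne_zero.2 (by exact_mod_cast hrk.ne hs)
    exact_mod_cast sub_eq_zero.1 ((mul_eq_zero.1 (hsum s (Finset.mem_univ s))).resolve_left hne)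
  obtain ⟨τ, hτ, hTτ⟩ := exists_fiberPerms_comp_eq hfix
  have hw' : w = T ∘ (τ * ρ⁻¹ : Equiv.Perm _) :=
    (Equiv.eq_comp_symm ρ _ _).2 (hwT.trans hTτ.symm)
  rw [hw'] at hw ⊢
  exact comp_eq_of_fiberMonovary hrk (injective_rowOf_colOf lam) (mul_mem hτ (inv_mem hρ)) hT hw

variable {k : Type u} [Field k] {M : Type u} [AddCommGroup M] [Module k M] [SuperSpace k M]
  {e : Module.Basis ι k M}

/-- The functional that straightens the word `T` at the column violation `a`, `b`: the coordinate of
`T`, summed over its translates under the permutations of the Garnir set and then under those of the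
rows. -/
def garnirFunctional (e : Module.Basis ι k M) (rk : ι → ℕ) (T : Fin lam.card → ι)
    (a b : Fin lam.card) : Module.Dual k (TPow k M lam.card) :=
  dualOrbitSum (fiberPerms (rowOf lam))
    (dualOrbitSum (fiberPerms (garnirBlock rk T a b)) ((wordBasis e lam.card).coord T))

theorem apply_eq_zero_of_mem_altSub (hk : (2 : k) ≠ 0) {d : ℕ} {β γ : Type*} {c : Fin d → β}
    {g : Fin d → γ} {f : Module.Dual k (TPow k M d)} {ρ : Equiv.Perm (Fin d)} {s t : Fin d}
    (hf : ∀ σ ∈ fiberPerms g, ∀ x, f (tperm σ x) = f x) {z : TPow k M d} (hz : z ∈ altSub k M c)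
    (hst : s ≠ t) (hg : g s = g t) (hc : c (ρ s) = c (ρ t)) : f (tperm ρ z) = 0 := by
  have hconj : ρ * Equiv.swap s t = Equiv.swap (ρ s) (ρ t) * ρ := by
    rw [Equiv.swap_apply_apply]
    group
  have halt : tperm (Equiv.swap s t) (tperm ρ z) = -tperm ρ z := by
    rw [tperm_tperm, hconj, ← tperm_tperm ρ, hz _ (swap_mem_fiberPerms hc),
      Equiv.Perm.sign_swap (ρ.injective.ne hst)]
    simp
  have hneg := hf _ (swap_mem_fiberPerms hg) (tperm ρ z)
  rw [halt, map_neg] at hneg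
  exact (mul_eq_zero.1 (by linear_combination -hneg : (2 : k) * f (tperm ρ z) = 0)).resolve_left hk

theorem garnirFunctional_eq_zero_of_mem_altSub (hk : (2 : k) ≠ 0)
    (hT : FiberMonovary (rowOf lam) (rk ∘ T) (colOf lam)) (hab : IsColumnViolation p rk T a b)
    {z : TPow k M lam.card} (hz : z ∈ altSub k M (colOf lam)) :
    garnirFunctional e rk T a b z = 0 := by
  by_contra hne
  obtain ⟨ρ, hρ, hne⟩ := exists_tperm_ne_zero_of_dualOrbitSum hne
  obtain ⟨s, t, hst, hs, ht, hcol⟩ := exists_ne_inGarnir_colOf_eq hT hab hρ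
  refine hne (apply_eq_zero_of_mem_altSub hk (g := garnirBlock rk T a b)
    (fun σ hσ x => dualOrbitSum_tperm hσ x) hz hst ?_ hcol)
  rw [garnirBlock_eq_none.2 hs, garnirBlock_eq_none.2 ht]

variable (he : ∀ i, pr k (p i) (e i) = e i)
include he

theorem exists_comp_eq_of_dualOrbitSum_coord_tperm_ne_zero {d : ℕ}
    {H : Subgroup (Equiv.Perm (Fin d))} {T w : Fin d → ι} {ρ : Equiv.Perm (Fin d)}
    (h : dualOrbitSum H ((wordBasis e d).coord T) (tperm ρ (wordBasis e d w)) ≠ 0) :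
    ∃ σ ∈ H, (w ∘ ρ) ∘ σ = T := by
  rw [tperm_wordBasis he, map_smul] at h
  exact exists_comp_eq_of_dualOrbitSum_coord_ne_zero he (right_ne_zero_of_smul h)

theorem garnirFunctional_self (hrk : Function.Injective rk) (hT : NoRepeat p 1 (rowOf lam) T)
    (hab : IsColumnViolation p rk T a b) :
    garnirFunctional e rk T a b (wordBasis e lam.card T) = 1 := by
  rw [garnirFunctional, dualOrbitSum_apply_eq,
    dualOrbitSum_coord_self he (noRepeat_garnirBlock hrk hT hab)]
  intro ρ hρ hne
  obtain ⟨σ, hσ, hTσ⟩ := exists_comp_eq_of_dualOrbitSum_coord_tperm_ne_zero he hne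
  exact LinearMap.ext fun x => dualOrbitSum_tperm (mem_fiberPerms_garnirBlock hρ hσ hTσ) x

theorem energy_lt_or_eq_of_garnirFunctional_ne_zero (hrk : Function.Injective rk)
    (hT : FiberMonovary (rowOf lam) (rk ∘ T) (colOf lam)) (hab : IsColumnViolation p rk T a b)
    (hw : FiberMonovary (rowOf lam) (rk ∘ w) (colOf lam))
    (h : garnirFunctional e rk T a b (wordBasis e lam.card w) ≠ 0) :
    energy rk T < energy rk w ∨ w = T := by
  obtain ⟨ρ, hρ, hne⟩ := exists_tperm_ne_zero_of_dualOrbitSum h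
  obtain ⟨σ, hσ, hwσ⟩ := exists_comp_eq_of_dualOrbitSum_coord_tperm_ne_zero he hne
  exact energy_lt_or_eq_of_garnir hrk hT hab hρ hσ hw hwσ

end Garnir

section Triangularity

variable {k S : Type*} [Finite S]

theorem span_range_eq_top_of_triangular [Ring k] {α : Type*} [Preorder α] {r : S → α}
    {v : S → S → k} (hdiag : ∀ i, v i i = 1) (htri : ∀ i j, v i j ≠ 0 → r j < r i ∨ j = i) :
    Submodule.span k (Set.range v) = ⊤ := by
  classical
  have := Fintype.ofFinite S
  have hwf : WellFounded fun i j => r i < r j :=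
    have : Std.Irrefl fun i j => r i < r j := ⟨fun i => lt_irrefl (r i)⟩
    have : IsTrans S fun i j => r i < r j := ⟨fun _ _ _ => lt_trans⟩
    Finite.wellFounded_of_trans_of_irrefl _
  have hsingle (i) : Pi.single i 1 ∈ Submodule.span k (Set.range v) := by
    induction i using hwf.induction with
    | _ i ih =>
      have hsum : Pi.single i 1 = v i - ∑ j ∈ Finset.univ.erase i, v i j • Pi.single j (1 : k) := by
        have hexpand := Finset.add_sum_erase Finset.univ
          (fun j => v i j • (Pi.single j 1 : S → k)) (Finset.mem_univ i)
        rw [hdiag, one_smul, ← pi_eq_sum_univ'] at hexpand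
        exact eq_sub_of_add_eq hexpand
      rw [hsum]
      refine sub_mem (Submodule.subset_span ⟨i, rfl⟩) (Submodule.sum_mem _ fun j hj => ?_)
      obtain hzero | hne := eq_or_ne (v i j) 0
      · rw [hzero, zero_smul]
        exact zero_mem _
      · have hlt : r j < r i := (htri i j hne).resolve_right (Finset.ne_of_mem_erase hj)
        exact Submodule.smul_mem _ _ (ih j hlt)
  rw [eq_top_iff, ← (Pi.basisFun k S).span_eq, Submodule.span_le]
  rintro _ ⟨i, rfl⟩
  rw [Pi.basisFun_apply]
  exact hsingle i

theorem finrank_range_of_diagonal [Field k] {N : Type*} [AddCommGroup N] [Module k N]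
    (E : N ≃ₗ[k] S → k) {P : N →ₗ[k] N} {c : S → k} (hP : ∀ y i, E (P y) i = c i * E y i) :
    Module.finrank k (LinearMap.range P) = Nat.card {i // c i ≠ 0} := by
  classical
  have := Fintype.ofFinite S
  have hconj : E.toLinearMap ∘ₗ P = (Matrix.diagonal c).mulVecLin ∘ₗ E.toLinearMap := by
    refine LinearMap.ext fun y => funext fun i => ?_
    simp [hP, Matrix.mulVec_diagonal]
  have hrange : (LinearMap.range P).map E.toLinearMap =
      LinearMap.range (Matrix.diagonal c).mulVecLin := by
    rw [← LinearMap.range_comp, hconj, LinearMap.range_comp_of_range_eq_top _ E.range]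
  rw [← LinearEquiv.finrank_map_eq E, hrange, Nat.card_eq_fintype_card, ← Matrix.rank_diagonal]
  rfl

end Triangularity

section Straightening

variable {lam : YoungDiagram} {ι : Type*} {p : ι → ZMod 2} {rk : ι → ℕ}
  {k : Type u} [Field k] {M : Type u} [AddCommGroup M] [Module k M] [SuperSpace k M]
  {e : Module.Basis ι k M} {T T' w : Fin lam.card → ι} {f : Module.Dual k (TPow k M lam.card)}

/-- The coefficient in `S^λ M` of the class of the word `T`, as a functional on `M^{⊗d}`. -/
def rowCoeff (e : Module.Basis ι k M) (T : Fin lam.card → ι) : Module.Dual k (TPow k M lam.card) :=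
  dualOrbitSum (fiberPerms (rowOf lam)) ((wordBasis e lam.card).coord T)

theorem dualOrbitSum_mem_dualAnnihilator_symKer (f : Module.Dual k (TPow k M lam.card)) :
    dualOrbitSum (fiberPerms (rowOf lam)) f ∈ (symKer k lam M).dualAnnihilator :=
  mem_dualAnnihilator_symKer.2 fun _ hρ x => dualOrbitSum_tperm hρ x

section

variable (he : ∀ i, pr k (p i) (e i) = e i)
include he

theorem apply_wordBasis_eq_zero_of_not_noRepeat (hk : (2 : k) ≠ 0) {d : ℕ} {β : Type*}
    {c : Fin d → β} {f : Module.Dual k (TPow k M d)}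
    (hf : ∀ σ ∈ fiberPerms c, ∀ x, f (tperm σ x) = f x) {w : Fin d → ι} (hw : ¬ NoRepeat p 1 c w) :
    f (wordBasis e d w) = 0 := by
  simp only [NoRepeat, not_forall] at hw
  obtain ⟨s, t, hc, hst, hp, hne⟩ := hw
  have hswap : w ∘ Equiv.swap s t = w := Equiv.comp_swap_eq_update .. |>.trans (by simp [hst])
  have hneg := hf _ (swap_mem_fiberPerms hc) (wordBasis e d w)
  rw [tperm_wordBasis he, hswap, invCharge_swap hne hp ((congrArg p hst).symm.trans hp),
    map_smul, koszul, if_neg one_ne_zero, smul_eq_mul] at hneg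
  have hzero : (2 : k) * f (wordBasis e d w) = 0 := by linear_combination -hneg
  exact (mul_eq_zero.1 hzero).resolve_left hk

theorem eq_zero_of_forall_sortedOnFibers (hk : (2 : k) ≠ 0)
    (hf : f ∈ (symKer k lam M).dualAnnihilator)
    (h : ∀ T, SortedOnFibers p rk 0 (rowOf lam) (colOf lam) T → f (wordBasis e lam.card T) = 0) :
    f = 0 := by
  rw [mem_dualAnnihilator_symKer] at hf
  refine (wordBasis e lam.card).ext fun w => ?_
  obtain ⟨ρ, hρ, hsorted⟩ :=
    exists_fiberMonovary_comp_perm (rk ∘ w) (injective_rowOf_colOf lam)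
  have hzero : f (wordBasis e lam.card (w ∘ ρ)) = 0 := by
    by_cases hrep : NoRepeat p 1 (rowOf lam) (w ∘ ρ)
    · exact h _ (sortedOnFibers_of_fiberMonovary hsorted hrep)
    · exact apply_wordBasis_eq_zero_of_not_noRepeat he hk hf hrep
  rw [← hf ρ hρ, tperm_wordBasis he, map_smul, hzero, smul_zero, LinearMap.zero_apply]

theorem rowCoeff_self (hT : SortedOnFibers p rk 0 (rowOf lam) (colOf lam) T) :
    rowCoeff e T (wordBasis e lam.card T) = 1 :=
  dualOrbitSum_coord_self he (hT.noRepeat (injective_rowOf_colOf lam))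

theorem eq_of_rowCoeff_ne_zero (hrk : Function.Injective rk)
    (hT : SortedOnFibers p rk 0 (rowOf lam) (colOf lam) T)
    (hw : SortedOnFibers p rk 0 (rowOf lam) (colOf lam) w)
    (h : rowCoeff e T (wordBasis e lam.card w) ≠ 0) : w = T := by
  obtain ⟨σ, hσ, rfl⟩ := exists_comp_eq_of_dualOrbitSum_coord_ne_zero he h
  exact (comp_eq_of_fiberMonovary hrk (injective_rowOf_colOf lam) hσ hw.fiberMonovary
    hT.fiberMonovary).symm

theorem exists_straightening_functional (hk : (2 : k) ≠ 0) (hrk : Function.Injective rk)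
    (hT : SortedOnFibers p rk 0 (rowOf lam) (colOf lam) T) :
    ∃ f ∈ (symKer k lam M).dualAnnihilator,
      f ∈ Submodule.span k (Set.range fun T : {T // IsSemistandardWord p rk T} => rowCoeff e T.1) ⊔
        (altSub k M (colOf lam)).dualAnnihilator ∧
      f (wordBasis e lam.card T) = 1 ∧
      ∀ w, SortedOnFibers p rk 0 (rowOf lam) (colOf lam) w → f (wordBasis e lam.card w) ≠ 0 →
        energy rk T < energy rk w ∨ w = T := by
  by_cases hstd : IsSemistandardWord p rk T
  · exact ⟨rowCoeff e T, dualOrbitSum_mem_dualAnnihilator_symKer _,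
      Submodule.mem_sup_left (Submodule.subset_span ⟨⟨T, hstd⟩, rfl⟩), rowCoeff_self he hT,
      fun w hw hne => Or.inr (eq_of_rowCoeff_ne_zero he hrk hT hw hne)⟩
  · obtain ⟨a, b, hab⟩ := exists_isColumnViolation hrk hT hstd
    refine ⟨garnirFunctional e rk T a b, dualOrbitSum_mem_dualAnnihilator_symKer _,
      Submodule.mem_sup_right ((Submodule.mem_dualAnnihilator _).2 fun z hz =>
        garnirFunctional_eq_zero_of_mem_altSub hk hT.fiberMonovary hab hz),
      garnirFunctional_self he hrk (hT.noRepeat (injective_rowOf_colOf lam)) hab,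
      fun w hw hne => energy_lt_or_eq_of_garnirFunctional_ne_zero he hrk hT.fiberMonovary hab
        hw.fiberMonovary hne⟩

theorem dualAnnihilator_symKer_le [Finite ι] (hk : (2 : k) ≠ 0) (hrk : Function.Injective rk) :
    (symKer k lam M).dualAnnihilator ≤
      Submodule.span k (Set.range fun T : {T // IsSemistandardWord p rk T} => rowCoeff e T.1) ⊔
        (altSub k M (colOf lam)).dualAnnihilator := by
  intro f hf
  choose Θ hΘ hΘmem hΘself hΘtri using
    fun T : {T // SortedOnFibers p rk 0 (rowOf lam) (colOf lam) T} =>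
      exists_straightening_functional he hk hrk T.2
  let R : Module.Dual k (TPow k M lam.card) →ₗ[k]
      {T // SortedOnFibers p rk 0 (rowOf lam) (colOf lam) T} → k :=
    LinearMap.pi fun T => LinearMap.applyₗ (wordBasis e lam.card T.1)
  have htop : Submodule.map R (Submodule.span k (Set.range Θ)) = ⊤ := by
    rw [Submodule.map_span, ← Set.range_comp]
    exact span_range_eq_top_of_triangular (r := fun T => OrderDual.toDual (energy rk T.1)) hΘself
      fun T w hne => (hΘtri T w w.2 hne).imp OrderDual.toDual_lt_toDual.2 Subtype.ext
  obtain ⟨g, hg, hgf⟩ : R f ∈ Submodule.map R (Submodule.span k (Set.range Θ)) := by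
    rw [htop]
    exact Submodule.mem_top
  have hg' : g ∈ (symKer k lam M).dualAnnihilator :=
    Submodule.span_le.2 (Set.range_subset_iff.2 hΘ) hg
  have hfg : f - g = 0 := by
    refine eq_zero_of_forall_sortedOnFibers (rk := rk) he hk (sub_mem hf hg') fun T hT => ?_
    exact sub_eq_zero.2 (congrFun hgf ⟨T, hT⟩).symm
  rw [sub_eq_zero.1 hfg]
  exact Submodule.span_le.2 (Set.range_subset_iff.2 hΘmem) hg

theorem mkQ_eq_zero_of_rowCoeff [Finite ι] (hk : (2 : k) ≠ 0) (hrk : Function.Injective rk)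
    {z : TPow k M lam.card} (hz : z ∈ altSub k M (colOf lam))
    (hcoeff : ∀ T, IsSemistandardWord p rk T → rowCoeff e T z = 0) :
    (symKer k lam M).mkQ z = 0 := by
  refine (Module.forall_dual_apply_eq_zero_iff k _).1 fun φ => ?_
  have hφ : φ ∘ₗ (symKer k lam M).mkQ ∈ (symKer k lam M).dualAnnihilator :=
    (Submodule.mem_dualAnnihilator _).2 fun x hx => by
      rw [LinearMap.comp_apply, Submodule.mkQ_apply, (Submodule.Quotient.mk_eq_zero _).2 hx,
        map_zero]
  obtain ⟨g, hg, h, hh, hsum⟩ := Submodule.mem_sup.1 (dualAnnihilator_symKer_le he hk hrk hφ)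
  have hgz : Submodule.span k (Set.range fun T : {T // IsSemistandardWord p rk T} =>
      rowCoeff e T.1) ≤ LinearMap.ker (LinearMap.applyₗ z) := by
    rw [Submodule.span_le]
    rintro _ ⟨T, rfl⟩
    exact hcoeff T.1 T.2
  rw [← LinearMap.comp_apply, ← hsum, LinearMap.add_apply,
    (Submodule.mem_dualAnnihilator h).1 hh z hz, add_zero]
  exact hgz hg

theorem rowCoeff_altOrbitSum_self (hrk : Function.Injective rk) (hT : IsSemistandardWord p rk T) :
    rowCoeff e T (altOrbitSum (colOf lam) (wordBasis e lam.card T)) = 1 := by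
  rw [apply_altOrbitSum_eq, rowCoeff_self he hT.1]
  intro σ hσ hne
  obtain ⟨ρ, hρ, hTσ⟩ := exists_comp_eq_of_dualOrbitSum_coord_tperm_ne_zero he hne
  have henergy : energy rk (T ∘ σ) = energy rk T := by rw [← energy_comp rk (T ∘ σ) hρ, hTσ]
  have hfix := hT.comp_eq_of_energy_eq hrk hσ henergy
  rw [tperm_wordBasis he, smul_smul, hfix, sign_mul_koszul_of_comp_eq k hT.noRepeat_col hσ hfix,
    one_smul]

theorem energy_lt_or_eq_of_rowCoeff_altOrbitSum_ne_zero (hrk : Function.Injective rk)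
    (hT : IsSemistandardWord p rk T) (hT' : IsSemistandardWord p rk T')
    (h : rowCoeff e T' (altOrbitSum (colOf lam) (wordBasis e lam.card T)) ≠ 0) :
    energy rk T' < energy rk T ∨ T' = T := by
  obtain ⟨σ, hσ, hne⟩ := exists_tperm_ne_zero_of_altOrbitSum h
  obtain ⟨ρ, hρ, rfl⟩ := exists_comp_eq_of_dualOrbitSum_coord_tperm_ne_zero he hne
  rw [energy_comp rk (T ∘ σ) hρ]
  refine (hT.energy_comp_le hσ).lt_or_eq.imp_right fun henergy => ?_
  rw [hT.comp_eq_of_energy_eq hrk hσ henergy] at hT' ⊢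
  exact comp_eq_of_fiberMonovary hrk (injective_rowOf_colOf lam) hρ hT.1.fiberMonovary
    hT'.1.fiberMonovary

end

/-- The restriction of `rowCoeff e T` to the Schur superfunctor `Ŝ_λ(M) ⊆ S^λ M`. -/
def schurCoeff (e : Module.Basis ι k M) (T : Fin lam.card → ι) : Module.Dual k (schurSub k lam M) :=
  (symKer k lam M).liftQ (rowCoeff e T)
    ((Submodule.mem_dualAnnihilator _).1 (dualOrbitSum_mem_dualAnnihilator_symKer _)) ∘ₗ
    (schurSub k lam M).subtype

theorem bijective_schurCoeff [Finite ι] (he : ∀ i, pr k (p i) (e i) = e i) (hk : (2 : k) ≠ 0)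
    (hrk : Function.Injective rk) :
    Function.Bijective (LinearMap.pi fun T : {T // IsSemistandardWord p rk T} =>
      (schurCoeff e T.1 : Module.Dual k (schurSub k lam M))) := by
  constructor
  · rw [← LinearMap.ker_eq_bot, LinearMap.ker_eq_bot']
    rintro ⟨y, hy⟩ hzero
    obtain ⟨z, hz, rfl⟩ := schurSub_eq_map_altSub (k := k) (M := M) ▸ hy
    exact Subtype.ext (mkQ_eq_zero_of_rowCoeff he hk hrk hz fun T hT => congrFun hzero ⟨T, hT⟩)
  · have hmem (z) (hz : z ∈ altSub k M (colOf lam)) :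
        (symKer k lam M).mkQ z ∈ schurSub k lam M := by
      rw [schurSub_eq_map_altSub]
      exact Submodule.mem_map_of_mem hz
    rw [← LinearMap.range_eq_top, eq_top_iff, ← span_range_eq_top_of_triangular
      (r := fun T : {T // IsSemistandardWord p rk T} => energy rk T.1)
      (v := fun T T' => rowCoeff e T'.1 (altOrbitSum (colOf lam) (wordBasis e lam.card T.1)))
      (fun T => rowCoeff_altOrbitSum_self he hrk T.2) fun T T' hne =>
        (energy_lt_or_eq_of_rowCoeff_altOrbitSum_ne_zero he hrk T.2 T'.2 hne).imp_right Subtype.ext,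
      Submodule.span_le]
    rintro _ ⟨T, rfl⟩
    exact ⟨⟨_, hmem _ (altOrbitSum_mem_altSub (colOf lam) (wordBasis e lam.card T.1))⟩, rfl⟩

theorem dualOrbitSum_comp_eq_smul {d : ℕ} {H : Subgroup (Equiv.Perm (Fin d))}
    {f : Module.Dual k (TPow k M d)} {P : Module.End k (TPow k M d)} {c : k}
    (hP : ∀ σ x, tperm σ (P x) = P (tperm σ x)) (hf : f ∘ₗ P = c • f) :
    dualOrbitSum H f ∘ₗ P = c • dualOrbitSum H f := by
  refine map_orbitSum_eq_smul (P := P.dualMap) fun σ _ => ?_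
  rw [dual_tpermRep]
  refine LinearMap.ext fun x => ?_
  have hfx := LinearMap.congr_fun hf (tperm σ x)
  rw [LinearMap.comp_apply] at hfx
  simpa [hP] using hfx

theorem finrank_range_schurI_map {V : CliffMod k 0} {e : Module.Basis ι k V.carrier} [Finite ι]
    (he : ∀ i, pr k (p i) (e i) = e i) (hk : (2 : k) ≠ 0) (hrk : Function.Injective rk)
    {f : Gam k (CHom V V) lam.card} {c : (Fin lam.card → ι) → k}
    (hf : ∀ T, (wordBasis e lam.card).coord T ∘ₗ gamAct lam.card f =
      c T • (wordBasis e lam.card).coord T) :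
    Module.finrank k (LinearMap.range ((schurI k lam).map V V f)) =
      Nat.card {T // IsSemistandardWord p rk T ∧ c T ≠ 0} := by
  refine (finrank_range_of_diagonal (P := (symAct lam f).restrict (symAct_schurSub f))
    (LinearEquiv.ofBijective _ (bijective_schurCoeff he hk hrk)) (c := fun T => c T.1) ?_).trans
    (Nat.card_congr (Equiv.subtypeSubtypeEquivSubtypeInter _ fun T => c T ≠ 0))
  rintro ⟨y, hy⟩ T
  obtain ⟨z, rfl⟩ := (symKer k lam V.carrier).mkQ_surjective y
  exact LinearMap.congr_fun (dualOrbitSum_comp_eq_smul (tperm_gamAct f) (hf T.1)) z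

end Straightening

section HookSchur

variable {lam mu nu : YoungDiagram} {m n d : ℕ}

/-- The position of a letter in the order `x_1 < ⋯ < x_m < y_1 < ⋯ < y_n`. -/
def letterRank (m n : ℕ) : Fin m ⊕ Fin n → ℕ := Sum.elim (fun i => i) fun j => m + j

theorem letterRank_injective (m n : ℕ) : Function.Injective (letterRank m n) :=
  Function.Injective.sumElim Fin.val_injective
    (fun _ _ h => Fin.ext (Nat.add_left_cancel h)) fun i _ => by omega

theorem letterRank_lt_iff_isLeft {a : Fin m ⊕ Fin n} : letterRank m n a < m ↔ a.isLeft := by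
  cases a <;> simp [letterRank]

theorem sortedOnFibers_zero_sumMap_iff {A B : Type*} {c g : Fin d → ℕ} {e : A ⊕ B ≃ Fin d}
    (hc : ∀ a b, c (e (.inr b)) = c (e (.inl a)) → ¬ g (e (.inr b)) < g (e (.inl a)))
    {T₁ : A → Fin m} {T₂ : B → Fin n} :
    SortedOnFibers (parity m n) (letterRank m n) 0 c g (Sum.map T₁ T₂ ∘ e.symm) ↔
      (∀ a a', c (e (.inl a)) = c (e (.inl a')) → g (e (.inl a)) < g (e (.inl a')) →
        T₁ a ≤ T₁ a') ∧
      ∀ b b', c (e (.inr b)) = c (e (.inr b')) → g (e (.inr b)) < g (e (.inr b')) →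
        T₂ b < T₂ b' := by
  have hx (a : Fin m) (b : Fin n) : (a : ℕ) ≤ m + b := by omega
  simp only [SortedOnFibers, e.surjective.forall, Sum.forall, Function.comp_apply,
    Equiv.symm_apply_apply, Sum.map_inl, Sum.map_inr]
  simp +contextual [parity, letterRank, hc, hx, lt_iff_le_and_ne (a := T₂ _)]

theorem sortedOnFibers_one_sumMap_iff {A B : Type*} {c g : Fin d → ℕ} {e : A ⊕ B ≃ Fin d}
    (hc : ∀ a b, c (e (.inr b)) = c (e (.inl a)) → ¬ g (e (.inr b)) < g (e (.inl a)))
    {T₁ : A → Fin m} {T₂ : B → Fin n} :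
    SortedOnFibers (parity m n) (letterRank m n) 1 c g (Sum.map T₁ T₂ ∘ e.symm) ↔
      (∀ a a', c (e (.inl a)) = c (e (.inl a')) → g (e (.inl a)) < g (e (.inl a')) →
        T₁ a < T₁ a') ∧
      ∀ b b', c (e (.inr b)) = c (e (.inr b')) → g (e (.inr b)) < g (e (.inr b')) →
        T₂ b ≤ T₂ b' := by
  have hx (a : Fin m) (b : Fin n) : (a : ℕ) ≤ m + b := by omega
  simp only [SortedOnFibers, e.surjective.forall, Sum.forall, Function.comp_apply,
    Equiv.symm_apply_apply, Sum.map_inl, Sum.map_inr]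
  simp +contextual [parity, letterRank, hc, hx, lt_iff_le_and_ne (a := T₁ _)]

/-- The boxes of `μ` and the transposed boxes of `λ'/μ'`, numbered as boxes of `λ` along the
rows. -/
def boxSum (h : mu ≤ lam) : ↥(mu.cells \ (⊥ : YoungDiagram).cells) ⊕
    ↥(lam.transpose.cells \ mu.transpose.cells) ≃ Fin lam.card where
  toFun := Sum.elim
    (fun b => (rowBox lam).symm ⟨b.1, h (Finset.mem_sdiff.1 b.2).1⟩)
    fun b => (rowBox lam).symm ⟨b.1.swap, YoungDiagram.mem_transpose.1 (Finset.mem_sdiff.1 b.2).1⟩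
  invFun s := if hs : (rowBox lam s).1 ∈ mu
    then .inl ⟨(rowBox lam s).1, Finset.mem_sdiff.2 ⟨hs, by simp⟩⟩
    else .inr ⟨(rowBox lam s).1.swap, by simpa using hs⟩
  left_inv := by
    rintro (⟨b, hb⟩ | ⟨b, hb⟩)
    · have hmu : b ∈ mu := (Finset.mem_sdiff.1 hb).1
      simp [hmu]
    · have hmu : b.swap ∉ mu := fun hmu =>
        (Finset.mem_sdiff.1 hb).2 (YoungDiagram.mem_transpose.2 hmu)
      simp [hmu]
  right_inv s := by
    by_cases hs : (rowBox lam s).1 ∈ mu <;> simp [hs]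

theorem rowBox_boxSum_inl (h : mu ≤ lam) (b) : (rowBox lam (boxSum h (.inl b))).1 = b.1 := by
  simp [boxSum]

theorem rowBox_boxSum_inr (h : mu ≤ lam) (b) : (rowBox lam (boxSum h (.inr b))).1 = b.1.swap := by
  simp [boxSum]

theorem rowBox_boxSum_mem_iff (h : mu ≤ lam) (x) :
    (rowBox lam (boxSum h x)).1 ∈ mu ↔ x.isLeft := by
  obtain b | b := x
  · rw [rowBox_boxSum_inl]
    exact iff_of_true (Finset.mem_sdiff.1 b.2).1 rfl
  · rw [rowBox_boxSum_inr]
    exact iff_of_false (fun hb => (Finset.mem_sdiff.1 b.2).2 (YoungDiagram.mem_transpose.2 hb))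
      Bool.false_ne_true

theorem isSemistandardWord_boxSum_iff (h : mu ≤ lam)
    {T₁ : ↥(mu.cells \ (⊥ : YoungDiagram).cells) → Fin m}
    {T₂ : ↥(lam.transpose.cells \ mu.transpose.cells) → Fin n} :
    IsSemistandardWord (parity m n) (letterRank m n) (Sum.map T₁ T₂ ∘ (boxSum h).symm) ↔
      IsSemistandard mu ⊥ T₁ ∧ IsSemistandard lam.transpose mu.transpose T₂ := by
  have hlow (a b) : ¬ (rowBox lam (boxSum h (.inr b))).1 ≤ (rowBox lam (boxSum h (.inl a))).1 :=
    fun hle => Bool.false_ne_true ((rowBox_boxSum_mem_iff h (.inr b)).1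
      (mu.isLowerSet hle ((rowBox_boxSum_mem_iff h (.inl a)).2 rfl)))
  rw [IsSemistandardWord,
    sortedOnFibers_zero_sumMap_iff fun a b hrow hcol => hlow a b ⟨hrow.le, hcol.le⟩,
    sortedOnFibers_one_sumMap_iff fun a b hcol hrow => hlow a b ⟨hrow.le, hcol.le⟩]
  simp only [rowOf, colOf, rowBox_boxSum_inl, rowBox_boxSum_inr, Prod.fst_swap, Prod.snd_swap]
  rw [IsSemistandard, IsSemistandard]
  tauto

/-- The word `w`, read as a filling of the diagram of `λ` along the rows, has its letters `x`
exactly in the boxes of `μ`. -/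
def HasInnerShape (mu : YoungDiagram) (w : Fin lam.card → Fin m ⊕ Fin n) : Prop :=
  ∀ s, (rowBox lam s).1 ∈ mu ↔ (w s).isLeft

theorem hasInnerShape_iff_exists_eq_boxSum (h : mu ≤ lam) {w : Fin lam.card → Fin m ⊕ Fin n} :
    HasInnerShape mu w ↔ ∃ T₁ T₂, w = Sum.map T₁ T₂ ∘ (boxSum h).symm := by
  constructor
  · intro hw
    have hleft (x) : (w (boxSum h x)).isLeft ↔ x.isLeft :=
      (hw _).symm.trans (rowBox_boxSum_mem_iff h x)
    choose T₁ hT₁ using fun a => Sum.isLeft_iff.1 ((hleft (.inl a)).2 rfl)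
    choose T₂ hT₂ using fun b => Sum.isRight_iff.1
      (Sum.not_isLeft.1 fun hb => Bool.false_ne_true ((hleft (.inr b)).1 hb))
    refine ⟨T₁, T₂, (Equiv.eq_comp_symm _ _ _).2 (funext (Sum.rec hT₁ hT₂))⟩
  · rintro ⟨T₁, T₂, rfl⟩
    refine (boxSum h).surjective.forall.2 fun x => ?_
    rw [rowBox_boxSum_mem_iff, Function.comp_apply, Equiv.symm_apply_apply, Sum.isLeft_map]

theorem HasInnerShape.le {w : Fin lam.card → Fin m ⊕ Fin n} (hmu : mu ≤ lam)
    (h : HasInnerShape mu w) (h' : HasInnerShape nu w) : mu ≤ nu := by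
  intro b hb
  obtain ⟨s, hs⟩ := (rowBox lam).surjective ⟨b, hmu hb⟩
  have hmem := (h s).trans (h' s).symm
  rw [hs] at hmem
  exact hmem.1 hb

theorem IsSemistandardWord.exists_hasInnerShape {w : Fin lam.card → Fin m ⊕ Fin n}
    (hw : IsSemistandardWord (parity m n) (letterRank m n) w) :
    ∃ mu ≤ lam, HasInnerShape mu w := by
  classical
  let mu : YoungDiagram :=
    { cells := ({s | (w s).isLeft} : Finset (Fin lam.card)).image fun s => (rowBox lam s).1
      isLowerSet := by
        intro b b' hle hb
        obtain ⟨s, hs, rfl⟩ := Finset.mem_image.1 hb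
        obtain ⟨t, ht⟩ := (rowBox lam).surjective ⟨b', lam.isLowerSet hle (rowBox lam s).2⟩
        have hleft : (w t).isLeft := letterRank_lt_iff_isLeft.1
          ((hw.rank_le (by rwa [ht])).trans_lt
            (letterRank_lt_iff_isLeft.2 ((Finset.mem_filter_univ s).1 hs)))
        exact Finset.mem_image.2 ⟨t, (Finset.mem_filter_univ t).2 hleft, congrArg Subtype.val ht⟩ }
  have hmem (b) : b ∈ mu ↔ ∃ s, (w s).isLeft ∧ (rowBox lam s).1 = b := by
    rw [← YoungDiagram.mem_cells]
    simp [mu]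
  refine ⟨mu, fun b hb => ?_, fun s => (hmem _).trans ⟨?_, fun hs => ⟨s, hs, rfl⟩⟩⟩
  · obtain ⟨s, _, rfl⟩ := (hmem b).1 hb
    exact (rowBox lam s).2
  · rintro ⟨t, ht, hts⟩
    rwa [← (rowBox lam).injective (Subtype.ext hts)]

theorem monomial_wordWeight {ι : Type} (w : Fin d → ι) :
    MvPolynomial.monomial (wordWeight w) (1 : ℤ) = ∏ s, MvPolynomial.X (w s) :=
  MvPolynomial.monomial_sum_one _ _

open scoped Classical in
theorem rename_schur_mul_rename_skewSchur (h : mu ≤ lam) (m n : ℕ) :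
    MvPolynomial.rename Sum.inl (schur mu m) *
        MvPolynomial.rename Sum.inr (skewSchur lam.transpose mu.transpose n) =
      ∑ w : Fin lam.card → Fin m ⊕ Fin n with
        IsSemistandardWord (parity m n) (letterRank m n) w ∧ HasInnerShape mu w,
        MvPolynomial.monomial (wordWeight w) 1 := by
  rw [schur, skewSchur, skewSchur, map_sum, map_sum, Finset.sum_mul_sum, ← Finset.sum_product']
  refine Finset.sum_bij (fun T _ => Sum.map T.1 T.2 ∘ (boxSum h).symm) ?_ ?_ ?_ ?_
  · rintro T hT
    simp only [Finset.mem_product, Finset.mem_filter_univ] at hT ⊢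
    exact ⟨(isSemistandardWord_boxSum_iff h).2 hT,
      (hasInnerShape_iff_exists_eq_boxSum h).2 ⟨_, _, rfl⟩⟩
  · rintro T _ T' _ heq
    have hmap := (boxSum h).symm.surjective.injective_comp_right heq
    exact Prod.ext (funext fun b => Sum.inl_injective (congrFun hmap (.inl b)))
      (funext fun b => Sum.inr_injective (congrFun hmap (.inr b)))
  · intro w hw
    simp only [Finset.mem_filter_univ] at hw
    obtain ⟨T₁, T₂, rfl⟩ := (hasInnerShape_iff_exists_eq_boxSum h).1 hw.2
    refine ⟨(T₁, T₂), ?_, rfl⟩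
    simp only [Finset.mem_product, Finset.mem_filter_univ]
    exact (isSemistandardWord_boxSum_iff h).1 hw.1
  · intro T _
    rw [monomial_wordWeight, ← (boxSum h).prod_comp, Fintype.prod_sum_type]
    simp

open scoped Classical in
theorem hookSchur_eq_sum (lam : YoungDiagram) (m n : ℕ) :
    hookSchur lam m n = ∑ w : Fin lam.card → Fin m ⊕ Fin n with
      IsSemistandardWord (parity m n) (letterRank m n) w,
      MvPolynomial.monomial (wordWeight w) 1 := by
  have hsub (mu) : mu ∈ subdiagrams lam ↔ mu ≤ lam := by simp [subdiagrams]
  rw [hookSchur, Finset.sum_congr rfl fun mu hmu =>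
    rename_schur_mul_rename_skewSchur ((hsub mu).1 hmu) m n]
  simp only [← Finset.filter_filter, Finset.sum_filter (HasInnerShape _)]
  rw [Finset.sum_comm]
  refine Finset.sum_congr rfl fun w hw => ?_
  obtain ⟨mu, hmu, hshape⟩ := ((Finset.mem_filter_univ w).1 hw).exists_hasInnerShape
  rw [Finset.sum_eq_single_of_mem mu ((hsub mu).2 hmu), if_pos hshape]
  exact fun nu hnu hne => if_neg fun hshape' =>
    hne ((hshape'.le ((hsub nu).1 hnu) hshape).antisymm (hshape.le hmu hshape'))

theorem coeff_rename_hookSchur {κ : Type} (lam : YoungDiagram) (m n : ℕ)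
    (g : Fin m ⊕ Fin n → κ) (μ : κ →₀ ℕ) :
    (MvPolynomial.rename g (hookSchur lam m n)).coeff μ =
      Nat.card {w : Fin lam.card → Fin m ⊕ Fin n //
        IsSemistandardWord (parity m n) (letterRank m n) w ∧ wordWeight (g ∘ w) = μ} := by
  classical
  rw [hookSchur_eq_sum, map_sum, MvPolynomial.coeff_sum]
  simp only [MvPolynomial.rename_monomial, wordWeight_comp, MvPolynomial.coeff_monomial]
  rw [Finset.sum_boole, Finset.filter_filter, Nat.card_eq_fintype_card, Fintype.card_subtype]

end HookSchur

section Characters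

variable {k : Type u} [Field k] {lam : YoungDiagram} {d : ℕ} {ι κ : Type}

theorem forgetGam_weightIdem {r : ℕ} {V : CliffMod k r} [Fintype κ] {E : κ → CHom V V}
    (hE : ∀ a, pr k 0 (E a) = E a) (μ : κ →₀ ℕ) :
    forgetGam V V d (weightIdem E hE d μ) = weightIdem (fun a => forgetHom V V (E a))
      (fun a => by rw [pr_forgetHom, hE]) d μ := by
  refine Subtype.ext ?_
  change tmap (forgetHom V V) d (weightIdem E hE d μ).1 = _
  simp only [weightIdem, map_sum]
  exact Finset.sum_congr rfl fun i _ => PiTensorProduct.map_tprod _ _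

section Diagonal

variable {V : CliffMod k 0} {e : Module.Basis ι k V.carrier} {p : ι → ZMod 2} {E : κ → CHom V V}
  {g : ι → κ} [DecidableEq κ]
  (he : ∀ i, pr k (p i) (e i) = e i) (hE : ∀ a, pr k 0 (E a) = E a)
  (hdiag : ∀ a i, (E a).1 (e i) = if g i = a then e i else 0)
include he hE hdiag

theorem tbilin_cliffEval_wordBasis (i : Fin d → κ) (w : Fin d → ι) :
    tbilin (cliffEval V V) d (PiTensorProduct.tprod k fun s => E (i s)) (wordBasis e d w) =
      if g ∘ w = i then wordBasis e d w else 0 := by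
  have hcharge : charge (fun _ => 0) (p ∘ w) = 0 := by simp [charge]
  rw [wordBasis_apply, tbilin_tprod _ (φ := fun _ => 0) (ε := p ∘ w) (fun s => hE (i s))
    fun s => he (w s), hcharge, koszul_zero, one_smul]
  change (PiTensorProduct.tprod k fun s => (E (i s)).1 (e (w s))) = _
  split_ifs with hi
  · simp only [← hi, Function.comp_apply, hdiag, if_true]
  · obtain ⟨s, hs⟩ := Function.ne_iff.1 hi
    exact MultilinearMap.map_coord_zero _ s ((hdiag _ _).trans (if_neg hs))

variable [Fintype κ]

theorem gamAct_weightIdem_wordBasis (μ : κ →₀ ℕ) (w : Fin d → ι) :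
    gamAct d (weightIdem E hE d μ) (wordBasis e d w) =
      if wordWeight (g ∘ w) = μ then wordBasis e d w else 0 := by
  simp only [gamAct, weightIdem, map_sum, LinearMap.sum_apply,
    tbilin_cliffEval_wordBasis he hE hdiag, Finset.sum_ite_eq, Finset.mem_filter_univ]

theorem coord_comp_gamAct_weightIdem (μ : κ →₀ ℕ) (T : Fin d → ι) :
    (wordBasis e d).coord T ∘ₗ gamAct d (weightIdem E hE d μ) =
      (if wordWeight (g ∘ T) = μ then 1 else 0 : k) • (wordBasis e d).coord T := by
  refine (wordBasis e d).ext fun w => ?_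
  rw [LinearMap.comp_apply, gamAct_weightIdem_wordBasis he hE hdiag, LinearMap.smul_apply]
  obtain rfl | hw := eq_or_ne w T
  · split_ifs <;> simp
  · split_ifs <;> simp [hw]

theorem finrank_weightSpace_schurI [Finite ι] (hk : (2 : k) ≠ 0) {rk : ι → ℕ}
    (hrk : Function.Injective rk) (μ : κ →₀ ℕ) :
    Module.finrank k (LinearMap.range ((schurI k lam).map V V (weightIdem E hE lam.card μ))) =
      Nat.card {w : Fin lam.card → ι // IsSemistandardWord p rk w ∧ wordWeight (g ∘ w) = μ} := by
  rw [finrank_range_schurI_map he hk hrk (coord_comp_gamAct_weightIdem he hE hdiag μ)]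
  simp

end Diagonal

theorem degree_wordWeight (w : Fin d → κ) : (wordWeight w).degree = d := by
  simp [wordWeight, map_sum]

theorem formalCh_eq_rename_hookSchur [Fintype κ] [DecidableEq κ] {r : ℕ} {V : CliffMod k r}
    {E : κ → CHom V V}
    (hE : ∀ a, pr k 0 (E a) = E a) {W : SchurMod V lam.card} {m n : ℕ} (g : Fin m ⊕ Fin n → κ)
    (h : ∀ μ, Module.finrank k (LinearMap.range (W.act (weightIdem E hE lam.card μ))) =
      Nat.card {w : Fin lam.card → Fin m ⊕ Fin n //
        IsSemistandardWord (parity m n) (letterRank m n) w ∧ wordWeight (g ∘ w) = μ}) :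
    formalCh E hE W = MvPolynomial.rename g (hookSchur lam m n) := by
  ext μ
  rw [coeff_formalCh, coeff_rename_hookSchur, h]
  split_ifs with hμ
  · rfl
  · rw [eq_comm, Nat.cast_eq_zero, Nat.card_eq_zero]
    exact Or.inl ⟨fun w => hμ (w.2.2 ▸ degree_wordWeight _)⟩

theorem pr_piSuperSpace_single [DecidableEq ι] (p : ι → ZMod 2) (i : ι) :
    (piSuperSpace k p).proj (p i) (Pi.single i 1) = Pi.single i 1 := by
  funext j
  rw [piSuperSpace_apply]
  obtain rfl | h := eq_or_ne j i <;> simp [*]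

theorem matUnit_single [DecidableEq ι] (i j : ι) :
    matUnit k i (Pi.single j 1) = if j = i then Pi.single j 1 else 0 := by
  obtain rfl | h := eq_or_ne j i
  · simp [matUnit]
  · simp [matUnit, h, h.symm]

theorem matUnit_inl_add_matUnit_inr_single {n : ℕ} (a : Fin n) (i : Fin n ⊕ Fin n) :
    (matUnit k (Sum.inl a) + matUnit k (Sum.inr a) : Module.End k (Fin n ⊕ Fin n → k))
      (Pi.single i 1) = if Sum.elim id id i = a then Pi.single i 1 else 0 := by
  rw [LinearMap.add_apply, matUnit_single, matUnit_single]
  obtain i | i := i <;> by_cases h : i = a <;> simp [h]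

theorem chS_schurI (hk : (2 : k) ≠ 0) (lam : YoungDiagram) (m n : ℕ) :
    chS ((schurI k lam).ev (kmn k m n)) = hookSchur lam m n := by
  let e : Module.Basis (Fin m ⊕ Fin n) k (kmn k m n).carrier := Pi.basisFun k _
  have he (i) : e i = (Pi.single i 1 : Fin m ⊕ Fin n → k) := Pi.basisFun_apply k _ i
  refine (formalCh_eq_rename_hookSchur pr_unitS id
    (finrank_weightSpace_schurI (e := e) (p := parity m n) (fun i => ?_) pr_unitS (fun a i => ?_) hk
      (letterRank_injective m n))).trans (MvPolynomial.rename_id_apply _)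
  · rw [he]
    exact pr_piSuperSpace_single (parity m n) i
  · rw [he]
    exact matUnit_single a i

theorem chQ_schurII (hk : (2 : k) ≠ 0) (lam : YoungDiagram) (n : ℕ) :
    chQ ((schurII k lam).ev (Vn k n)) = hallLittlewood lam n := by
  let e : Module.Basis (Fin n ⊕ Fin n) k (Vn k n).forget.carrier := Pi.basisFun k _
  have he (i) : e i = (Pi.single i 1 : Fin n ⊕ Fin n → k) := Pi.basisFun_apply k _ i
  refine formalCh_eq_rename_hookSchur pr_unitQ (Sum.elim id id) fun μ => ?_
  change Module.finrank k (LinearMap.range ((schurI k lam).map (Vn k n).forget (Vn k n).forget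
    (forgetGam (Vn k n) (Vn k n) lam.card (weightIdem (unitQ k) pr_unitQ lam.card μ)))) = _
  rw [forgetGam_weightIdem]
  refine finrank_weightSpace_schurI (e := e) (p := parity n n) (fun i => ?_) _ (fun a i => ?_) hk
    (letterRank_injective n n) μ
  · rw [he]
    exact pr_piSuperSpace_single (parity n n) i
  · rw [he]
    exact matUnit_inl_add_matUnit_inr_single a i

end Characters

end SchurSuper

end

theorem mainTheorem6 {k : Type*} [Field k] (hk : (2 : k) ≠ 0) (lam : YoungDiagram) :
    (∀ n : ℕ, SchurSuper.chQ ((SchurSuper.schurII k lam).ev (SchurSuper.Vn k n)) =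
      SchurSuper.hallLittlewood lam n) ∧
    SchurSuper.chI (SchurSuper.schurI k lam) = SchurSuper.hsLim lam ∧
    SchurSuper.chII (SchurSuper.schurII k lam) = SchurSuper.hallLittlewoodLim lam :=
  ⟨SchurSuper.chQ_schurII hk lam,
    Subtype.ext (funext fun m => funext fun n => SchurSuper.chS_schurI hk lam m n),
    Subtype.ext (funext fun n => SchurSuper.chQ_schurII hk lam n)⟩
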